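/- **Setting.** Let $V$ be a finite set and $G$ the complete graph on $V$. Let $C_{max}$ be a cycle cover of $G$ (a set of vertex-disjoint cycles of length at least $3$ covering $V$) and $M$ a perfect matching of $G$. A *$3$-kite* is a triangle of $C_{max}$ with exactly one edge of $M$ joining two of its vertices; a *$4$-kite* is a $4$-cycle of $C_{max}$ with exactly two edges of $M$ joining two of its vertices; a kite is a $3$-kite or a $4$-kite. Assume that the two edges of $M$ joining vertices of a $4$-kite are sides (not diagonals) of it. By an *edge inside a kite $c$* we mean an edge of $G$ joining two vertices of $c$ (an edge or a diagonal of $c$). Let $\tilde G$ arise from $G$ by subdividing each edge that lies inside some kite by a new vertex into two *half-edges*. Let $C_2$ be a relaxed cycle cover improving $C_{max}$ with respect to $M$, i.e. a set of edges of $\tilde G$ such that every $v\in V$ is incident to exactly two edges of $C_2$, and for each $3$-kite (resp. $4$-kite) $c$ the number of half-edges in $C_2$ of edges inside $c$ is even and at most $4$ (resp. $6$). Let $I(C_2)$ be the set of edges of $G$ contained in $C_2$ as a whole (edges that are not subdivided, or both half-edges), and $H(C_2)$ the set of edges of $G$ with exactly one half-edge in $C_2$. For $Z\subseteq H(C_2)$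 and disjoint edge sets $F_1$ and $F_2$, let $G'_2$ be the multigraph with one copy of each edge of $M$, of $(I(C_2)\cup Z)\setminus F_2$, and of $F_1$; an edge is *double* if $G'_2$ has two copies of it. Let $C'_2=(I(C_2)\cup Z\cup F_1)\setminus F_2$. The *paths and cycles of $G'_2$* are the members of a partition of $C'_2$ into cycles and paths (a path is a trail with distinct ends and no repeated interior vertex; an end may coincide with an interior vertex) such that two edges of $C'_2$ that follow each other at a vertex on a path or cycle of $C_2$ also follow each other on a member of the partition, and the partition is maximal: no two ends of paths lie at a common vertex. A path of $G'_2$ is *amenable* if (i) neither of its ends has degree $4$ in $G'_2$, or (ii) its ends can be named $w$ (first) and $v$ (last) so that $v$ has degree $4$, $w$ has degree less than $4$, and the last edge is double, or the last-but-one edge is double, or the last-but-one and last-but-three vertices are matched in $M$. **Lemma F12.** There exist an orientation $D_2$ of $I(C_2)$ into directed paths and cycles, such that each kite has equally many incoming and outgoing edges, and a partition of $H(C_2)$ into $Z_1,Z_2$ containing equally many edges inside each kite, such that the following holds both for $Z=Z_1$ with $I(C_2)$ oriented by $D_2$, and for $Z=Z_2$ with $I(C_2)$ oriented by the opposite orientation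 $opp(D_2)$. There are disjoint sets $F_1,F_2$ of edges, and a partition into paths and cycles of the resulting $G'_2$ as above, with: 1. $F_1\subseteq C_{max}\setminus((Z\cup I(C_2))\cap M)$; 2. $F_2\subseteq I(C_2)\cup Z$; 3. for each kite $c$, either (i) $F_1$ contains exactly one edge of $c$ and $F_2$ contains no edge inside $c$, or (ii) $c$ is a $4$-kite, $F_1$ contains exactly two edges of $c$ and $F_2$ contains exactly one edge inside $c$, which is not in $M$; 4. for each kite $c$, $F_2$ contains exactly one outgoing edge of $c$ (an edge directed from a vertex of $c$ to a vertex outside $c$); 5. for each kite $c$ and each vertex $v$ of $c$, the number of edges of $F_2$ incident to $v$ is at most one greater than the number of edges of $F_1$ incident to $v$; 6. no cycle of $G'_2$ of odd length $l$ has $l$ (or more) double edges incident to it (i.e. having an endpoint on it); 7. each path of $G'_2$ is amenable. -/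

import Mathlib

open scoped Classical

/-! Edges of the complete graph on `V` are the non-diagonal elements of `Sym2 V`. -/

namespace MaxTSP

variable {V : Type*}

/-- A cycle cover: a spanning 2-regular graph. Its cycles are its connected components. -/
def IsCycleCover (C : SimpleGraph V) : Prop :=
  ∀ v, (C.neighborSet v).ncard = 2

/-- A perfect matching: a spanning 1-regular graph. -/
def IsPerfectMatching (M : SimpleGraph V) : Prop :=
  ∀ v, (M.neighborSet v).ncard = 1

section Kites

variable {C : SimpleGraph V}

/-- The edges of the complete graph joining two vertices of the cycle `c`
(the edges of `c` together with its diagonals). -/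
def inside (c : C.ConnectedComponent) : Set (Sym2 V) :=
  {e | ¬ e.IsDiag ∧ ∀ x ∈ e, x ∈ c.supp}

/-- Degree of flexibility: the number of edges of `M` with both endpoints on the cycle `c`. -/
noncomputable def flex (M : SimpleGraph V) (c : C.ConnectedComponent) : ℕ :=
  (M.edgeSet ∩ inside c).ncard

def IsThreeKite (M : SimpleGraph V) (c : C.ConnectedComponent) : Prop :=
  c.supp.ncard = 3 ∧ flex M c = 1

def IsFourKite (M : SimpleGraph V) (c : C.ConnectedComponent) : Prop :=
  c.supp.ncard = 4 ∧ flex M c = 2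

def IsKite (M : SimpleGraph V) (c : C.ConnectedComponent) : Prop :=
  IsThreeKite M c ∨ IsFourKite M c

end Kites

/-- An edge is problematic if its endpoints belong to the same kite. -/
def Problematic (C M : SimpleGraph V) (e : Sym2 V) : Prop :=
  ∃ c : C.ConnectedComponent, IsKite M c ∧ e ∈ inside c

/-- The graph obtained from the complete graph on `V` by subdividing every problematic edge `e`
with one new vertex `Sum.inr e`. An edge between `Sum.inl u` and `Sum.inr e` is
the half-edge of `e` at `u`. (Elements of `Sym2 V` that are not problematic edges are isolated.) -/
def splitGraph (C M : SimpleGraph V) : SimpleGraph (V ⊕ Sym2 V) where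
  Adj
    | .inl u, .inl v => u ≠ v ∧ ¬ Problematic C M s(u, v)
    | .inl u, .inr e => u ∈ e ∧ Problematic C M e
    | .inr e, .inl u => u ∈ e ∧ Problematic C M e
    | .inr _, .inr _ => False
  symm := ⟨by
    rintro (u | e) (v | f) h
    · exact ⟨h.1.symm, by rw [Sym2.eq_swap]; exact h.2⟩
    · exact h
    · exact h
    · exact h⟩
  loopless := ⟨by
    rintro (u | e) h
    · exact h.1 rfl
    · exact h⟩

/-- The half-edges in `T` of the edges (and diagonals) of the cycle `c`. -/
def halfEdgesOf {C : SimpleGraph V} (T : SimpleGraph (V ⊕ Sym2 V)) (c : C.ConnectedComponent) :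
    Set (V × Sym2 V) :=
  {p | p.2 ∈ inside c ∧ T.Adj (.inl p.1) (.inr p.2)}

/-- `T` is (the edge set of) a relaxed cycle cover improving `C` with respect to `M`. -/
structure IsRelaxedCycleCover (C M : SimpleGraph V) (T : SimpleGraph (V ⊕ Sym2 V)) : Prop where
  le : T ≤ splitGraph C M
  two : ∀ v : V, (T.neighborSet (.inl v)).ncard = 2
  three_kite : ∀ c : C.ConnectedComponent, IsThreeKite M c →
    Even (halfEdgesOf T c).ncard ∧ (halfEdgesOf T c).ncard ≤ 4
  four_kite : ∀ c : C.ConnectedComponent, IsFourKite M c →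
    Even (halfEdgesOf T c).ncard ∧ (halfEdgesOf T c).ncard ≤ 6

/-- `T` contains, at the vertex `u`, the edge `uv` or its half-edge at `u`. -/
def UsesAt (T : SimpleGraph (V ⊕ Sym2 V)) (u v : V) : Prop :=
  T.Adj (.inl u) (.inl v) ∨ T.Adj (.inl u) (.inr s(u, v))

/-- `I(C₂)`: the edges of the complete graph contained as a whole in `T`. -/
def wholeEdges (T : SimpleGraph (V ⊕ Sym2 V)) : Set (Sym2 V) :=
  {e | ∃ u v, e = s(u, v) ∧ UsesAt T u v ∧ UsesAt T v u}

/-- `H(C₂)`: the edges of which `T` contains exactly one half-edge. -/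
def halfUsedEdges (T : SimpleGraph (V ⊕ Sym2 V)) : Set (Sym2 V) :=
  {e | ∃ u v, e = s(u, v) ∧ UsesAt T u v ∧ ¬ UsesAt T v u}

/-- `D` (with `D u v` meaning that the edge `uv` is directed from `u` to `v`) is an orientation of
`I(C₂)` into directed paths and cycles in which every kite has as many incoming as outgoing
edges. -/
structure IsBalancedOrientation (C M : SimpleGraph V) (T : SimpleGraph (V ⊕ Sym2 V))
    (D : V → V → Prop) : Prop where
  edge : ∀ u v, s(u, v) ∈ wholeEdges T ↔ D u v ∨ D v u
  asymm : ∀ u v, D u v → ¬ D v u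
  out_unique : ∀ u v w, D u v → D u w → v = w
  in_unique : ∀ u v w, D v u → D w u → v = w
  balanced : ∀ c : C.ConnectedComponent, IsKite M c →
    {p : V × V | p.1 ∈ c.supp ∧ p.2 ∉ c.supp ∧ D p.1 p.2}.ncard =
      {p : V × V | p.1 ∉ c.supp ∧ p.2 ∈ c.supp ∧ D p.1 p.2}.ncard

/-- `H(C₂)` is partitioned into `Z₁` and `Z₂` so that each kite has half of its edges of `H(C₂)` in
`Z₁` and the other half in `Z₂`. -/
structure IsBalancedSplit (C M : SimpleGraph V) (T : SimpleGraph (V ⊕ Sym2 V))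
    (Z₁ Z₂ : Set (Sym2 V)) : Prop where
  union : Z₁ ∪ Z₂ = halfUsedEdges T
  disj : Disjoint Z₁ Z₂
  balanced : ∀ c : C.ConnectedComponent, IsKite M c →
    (Z₁ ∩ inside c).ncard = (Z₂ ∩ inside c).ncard

section Multigraph

/-! The multigraph `G₂'` consists of one copy of every edge of `M`, one copy of every edge of
`(I(C₂) ∪ Z) \ F₂` and one copy of every edge of `F₁`. Below, `B` stands for `I(C₂) ∪ Z`. -/

/-- The number of copies of `e` in `G₂'`. -/
noncomputable def mult (M : SimpleGraph V) (B F₁ F₂ : Set (Sym2 V)) (e : Sym2 V) : ℕ :=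
  (if e ∈ M.edgeSet then 1 else 0) + (if e ∈ B \ F₂ then 1 else 0) + (if e ∈ F₁ then 1 else 0)

/-- The degree of `v` in the multigraph `G₂'`. -/
noncomputable def multDegree [Fintype V] (M : SimpleGraph V) (B F₁ F₂ : Set (Sym2 V)) (v : V) : ℕ :=
  ∑ u ∈ Finset.univ.erase v, mult M B F₁ F₂ s(v, u)

/-- The edge set `C₂' = (I(C₂) ∪ Z ∪ F₁) \ F₂`. -/
def exchanged (B F₁ F₂ : Set (Sym2 V)) : Set (Sym2 V) :=
  (B ∪ F₁) \ F₂

end Multigraph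

/-- A path of a partition into paths and cycles: a non-closed trail, none of whose interior
vertices is repeated among the interior vertices. (The last vertex of such a path may be an
interior vertex of the same path.) -/
def IsPathPiece {G : SimpleGraph V} {u v : V} (p : G.Walk u v) : Prop :=
  u ≠ v ∧ p.IsTrail ∧ p.support.tail.dropLast.Nodup

/-- `a` and `b` are neighbouring entries of the list `l`. -/
def Consecutive {α : Type*} (l : List α) (a b : α) : Prop :=
  [a, b] <:+: l ∨ [b, a] <:+: l

/-- `paths` and `cycles` form a partition of the edge set `E'` into paths and cycles.
Two edges of `E'` that follow each other at a vertex on a path or cycle of `T` follow each other on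
a member of the partition, and the partition is maximal: no two path ends meet at a vertex,
so no path can be prolonged or closed there. -/
structure IsPathCyclePartition (T : SimpleGraph (V ⊕ Sym2 V)) (E' : Set (Sym2 V))
    (paths : Set (Σ u v, (SimpleGraph.fromEdgeSet E').Walk u v))
    (cycles : Set (Σ u, (SimpleGraph.fromEdgeSet E').Walk u u)) : Prop where
  isPath : ∀ p ∈ paths, IsPathPiece p.2.2
  isCycle : ∀ c ∈ cycles, c.2.IsCycle
  cover : ∀ e ∈ E', (∃ p ∈ paths, e ∈ p.2.2.edges) ∨ (∃ c ∈ cycles, e ∈ c.2.edges)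
  disj_paths : ∀ p ∈ paths, ∀ q ∈ paths, p ≠ q → p.2.2.edges.Disjoint q.2.2.edges
  disj_cycles : ∀ c ∈ cycles, ∀ d ∈ cycles, c ≠ d → c.2.edges.Disjoint d.2.edges
  disj : ∀ p ∈ paths, ∀ c ∈ cycles, p.2.2.edges.Disjoint c.2.edges
  follow : ∀ v a b : V, a ≠ b → s(v, a) ∈ E' → s(v, b) ∈ E' → UsesAt T v a → UsesAt T v b →
    (∃ p ∈ paths, Consecutive p.2.2.edges s(v, a) s(v, b)) ∨
      (∃ c ∈ cycles, Consecutive (c.2.edges ++ c.2.edges) s(v, a) s(v, b))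
  maximal : ∀ p ∈ paths, ∀ q ∈ paths, p ≠ q →
    p.1 ≠ q.1 ∧ p.1 ≠ q.2.1 ∧ p.2.1 ≠ q.1 ∧ p.2.1 ≠ q.2.1

/-- The end `v` of `p` has degree 4, its beginning `w` has degree less than 4, and the last edge
is double, or the last-but-one edge is double, or the last-but-one and the last-but-three
vertices are matched in `M`. Here `m` gives the number of copies of an edge, `d` the degrees. -/
def AmenableAtEnd {G : SimpleGraph V} (M : SimpleGraph V) (m : Sym2 V → ℕ) (d : V → ℕ)
    {w v : V} (p : G.Walk w v) : Prop :=
  d v = 4 ∧ d w < 4 ∧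
    ((∃ e, p.edges.reverse[0]? = some e ∧ m e = 2) ∨
      (∃ e, p.edges.reverse[1]? = some e ∧ m e = 2) ∨
      (∃ x y, p.support.reverse[1]? = some x ∧ p.support.reverse[3]? = some y ∧ M.Adj x y))

/-- An amenable path. Either end of the path may play the role of its last vertex. -/
def Amenable {G : SimpleGraph V} (M : SimpleGraph V) (m : Sym2 V → ℕ) (d : V → ℕ)
    {w v : V} (p : G.Walk w v) : Prop :=
  (d w ≠ 4 ∧ d v ≠ 4) ∨ AmenableAtEnd M m d p ∨ AmenableAtEnd M m d p.reverse

/-- `F₁`, `F₂` are exchange sets, for the relaxed cycle cover `T`, the orientation `D` of `I(C₂)`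
and the chosen set `Z`, with all the required properties. -/
structure IsExchangePair [Fintype V] (C M : SimpleGraph V) (T : SimpleGraph (V ⊕ Sym2 V))
    (D : V → V → Prop) (Z F₁ F₂ : Set (Sym2 V)) : Prop where
  disj : Disjoint F₁ F₂
  subset₁ : F₁ ⊆ C.edgeSet \ ((Z ∪ wholeEdges T) ∩ M.edgeSet)
  subset₂ : F₂ ⊆ wholeEdges T ∪ Z
  kite : ∀ c : C.ConnectedComponent, IsKite M c →
    ((F₁ ∩ inside c).ncard = 1 ∧ F₂ ∩ inside c = ∅) ∨
      (IsFourKite M c ∧ (F₁ ∩ inside c).ncard = 2 ∧ (F₂ ∩ inside c).ncard = 1 ∧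
        Disjoint (F₂ ∩ inside c) M.edgeSet)
  outgoing : ∀ c : C.ConnectedComponent, IsKite M c →
    {p : V × V | p.1 ∈ c.supp ∧ p.2 ∉ c.supp ∧ D p.1 p.2 ∧ s(p.1, p.2) ∈ F₂}.ncard = 1
  degree : ∀ c : C.ConnectedComponent, IsKite M c → ∀ v ∈ c.supp,
    {e ∈ F₂ | v ∈ e}.ncard ≤ {e ∈ F₁ | v ∈ e}.ncard + 1
  partition : ∃ paths cycles,
    IsPathCyclePartition T (exchanged (wholeEdges T ∪ Z) F₁ F₂) paths cycles ∧
    (∀ c ∈ cycles, Odd c.2.length →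
      {e | mult M (wholeEdges T ∪ Z) F₁ F₂ e = 2 ∧ ∃ x ∈ e, x ∈ c.2.support}.ncard
        < c.2.length) ∧
    (∀ p ∈ paths, Amenable M (mult M (wholeEdges T ∪ Z) F₁ F₂)
      (multDegree M (wholeEdges T ∪ Z) F₁ F₂) p.2.2)

end MaxTSP

/-! The proof reduces the lemma to a finite problem inside a single kite, and couples the kites only
through one binary choice per kite.

Orientation. Regard every whole edge as two opposite darts. Reversal is one fixed-point-free
involution; a second one, β, pairs the two darts leaving a vertex with two whole edges, and pairs
the dead ends of each component, whose number is even by the parity condition on half-edges. A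
2-colouring of the darts that is proper for both involutions (`exists_coloring_of_involutive`) is
the balanced orientation.

Trails. Boundary edges (whole edges not inside a kite) keep their direction, except that each kite c
gives up the outgoing boundary edge of one vertex x c. Inside a kite the edges left by the exchange
are directed so that at most one arc leaves each vertex. At most two arcs enter a vertex: the main
one, continued by the leaving arc, and possibly another whose trail stops there. Such a system
splits into paths and cycles (`IsTrailSystem.exists_partition`); two trails entering a vertex that
no arc leaves are glued. All ends of paths are leaves, of degree at most 3, or stops, and
amenability at a stop is visible inside the kite.

Odd cycles. If a cycle of length l has l incident double edges, then each of its vertices is bad: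
the trail that stops there arrives along an edge of M (`IsArcSet.ncard_double_lt`). The solutions
inside kites are such that a bad vertex on a cycle has a neighbour on the cycle in the same kite
that is not bad, or else keeps both its boundary edges and is a designated vertex of its kite. So an
all-bad cycle would run through boundary arcs and designated vertices only. Each kite has two
options b, with vertices p b and x b; under option b only p (!b), and only if it differs from p b,
is designated. As two disjoint cycles of the orientation need at least four such vertices and each
kite owns at most two, Hall's theorem gives a choice of options that spoils every such cycle
(`exists_transversal`, `exists_selection`).

Finite check. A removed outgoing edge may enter another kite, so each option must come with a
solution for every set of removed incoming edges. Up to numbering there are finitely many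
configurations of half-edges and boundary edges in a kite. For each of them a split of the half-used
edges that works for both orientations is found by evaluation (`solvableAll_three`,
`solvableAll_four`). `IsConfig.exists_split` states the outcome, `Solution.Spec.isKiteSolution`
carries it over to the graph, and `exists_exchangePair` assembles the kites. -/

namespace MaxTSP

/-! ### Finite search over the local configurations of a kite

The vertices of a kite are numbered `0, 1, 2` (and `3`) so that `01` (and `23`) are the edges of
the matching and `01, 12, 23, 30` (respectively `01, 12, 20`) are the sides. -/

namespace Local

/-- The `k`-th binary digit of `m`. -/
def bit (m k : ℕ) : Bool := Nat.ble 1 (Nat.land 1 (Nat.shiftRight m k))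

/-- The `i`-th octal digit of `a`. -/
def digit (a i : ℕ) : ℕ := Nat.land (Nat.shiftRight a (Nat.mul 3 i)) 7

/-- Membership of the edge `ij` in a set of edges encoded by six bits, for the edges
`01, 02, 03, 12, 13, 23`. -/
def edge (m i j : ℕ) : Bool :=
  -- With truncated subtraction the index is i + j - 1 if ij = 0 and i + j otherwise, which numbers
  -- the six pairs from 0 to 5 in the order above.
  !(Nat.beq i j) && bit m (Nat.sub (Nat.add i j) (Nat.sub 1 (Nat.mul i j)))

/-- Only n = 3 and n = 4 occur. Quantifiers and sums are written out, over raw `Nat` and `Bool`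
operations, to be cheap for evaluation by the kernel. -/
def allBelow (n : ℕ) (p : ℕ → Bool) : Bool :=
  p 0 && (p 1 && (p 2 && (Nat.ble n 3 || p 3)))

def sumBelow (n : ℕ) (p : ℕ → Bool) : ℕ :=
  Nat.add (p 0).toNat (Nat.add (p 1).toNat (Nat.add (p 2).toNat
    (cond (Nat.ble n 3) 0 (p 3).toNat)))

def edgeCount (n : ℕ) (f : ℕ → ℕ → Bool) : ℕ :=
  Nat.add (Nat.add (f 0 1).toNat (Nat.add (f 0 2).toNat (f 1 2).toNat))
    (cond (Nat.ble n 3) 0 (Nat.add (f 0 3).toNat (Nat.add (f 1 3).toNat (f 2 3).toNat)))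

def edgeMask (f : ℕ → ℕ → Bool) : ℕ :=
  Nat.add (Nat.add (f 0 1).toNat
      (Nat.add (Nat.mul 2 (f 0 2).toNat) (Nat.mul 4 (f 0 3).toNat)))
    (Nat.add (Nat.mul 8 (f 1 2).toNat)
      (Nat.add (Nat.mul 16 (f 1 3).toNat) (Nat.mul 32 (f 2 3).toNat)))

/-- Evaluate the argument before it is substituted. -/
def force (k : ℕ) (f : ℕ → Bool) : Bool :=
  Nat.rec (f 0) (fun k _ => f (Nat.succ k)) k

def mate (i j : ℕ) : Bool := Nat.beq (Nat.xor i 1) j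

def side (n i j : ℕ) : Bool := Nat.ble n 3 || Nat.beq (Nat.mod (Nat.add i j) 2) 1

/-- A candidate for a local solution: the mask of the edges that are kept, the octal digits of
the successors, of the main predecessors, of the second predecessors (`4` if there is none), and
the mask of an added edge that was present before; the last entry encodes the set of the vertices
that have a successor, and the set of those that have a second predecessor. -/
abbrev Template := ℕ × ℕ × ℕ × ℕ × ℕ × ℕ

/-- The data of a kite: the number of vertices, the half-edges, the other edges inside the kite, the
vertices with an incoming and those with an outgoing boundary edge that is kept, the vertex whose
outgoing boundary edge is removed, the vertices whose incoming boundary edge is removed, and the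
vertices that may be avoided by odd cycles for other reasons. -/
structure Config where
  n : ℕ
  used : ℕ → ℕ → Bool
  rest : ℕ → ℕ → Bool
  keptIn : ℕ → Bool
  keptOut : ℕ → Bool
  x : ℕ
  gone : ℕ → Bool
  allowed : ℕ → Bool

/-- A solution inside a kite: the sets `F₁` and `F₂`, the successors and the predecessors. -/
structure Solution where
  f₁ : ℕ → ℕ → Bool
  f₂ : ℕ → ℕ → Bool
  next : ℕ → ℕ
  pred₁ : ℕ → ℕ
  pred₂ : ℕ → ℕ

namespace Solution

variable (s : Solution) (c : Config)

def inside (v : ℕ) : Bool := !Nat.ble c.n v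

/-- The predecessor on the trail through `v`. -/
def main (v : ℕ) : ℕ := cond (c.keptIn v) 4 (s.pred₁ v)

/-- The predecessor of `v` whose trail ends at `v`. -/
def halt (v : ℕ) : ℕ := cond (c.keptIn v) (s.pred₁ v) (s.pred₂ v)

def sink (v : ℕ) : Bool := !inside c (s.next v) && !c.keptOut v

/-- An edge of M that carries an arc is double. At a bad vertex this double edge is not an edge of
the cycle through the vertex, since the arc on it stops. -/
def bad (v : ℕ) : Bool := inside c (s.halt c v) && mate (s.halt c v) v

/-- Condition 5, including the removed boundary edges at `v`: at most one outgoing and one incoming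
edge. -/
def degreeOk (v : ℕ) : Bool :=
  Nat.ble (Nat.add (sumBelow c.n (s.f₂ v)) (Nat.add (Nat.beq v c.x).toNat (c.gone v).toNat))
    (Nat.add (sumBelow c.n (s.f₁ v)) 1)

/-- The three alternatives of amenability for a trail that stops at `v` through the arc from `p`,
read backwards along the main predecessors inside the kite. -/
def amenableOk (p v : ℕ) : Bool :=
  mate p v || (inside c (s.main c p) && (mate (s.main c p) p ||
    (inside c (s.main c (s.main c p)) && mate (s.main c (s.main c p)) p)))

/-- A stopping edge is not continued at `v`. If the relaxed cycle cover uses it at `v`, then the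
cover must use none of the other edges that remain there. -/
def followOk (v : ℕ) : Bool :=
  !c.used v (s.halt c v) || (!c.keptIn v && (!c.keptOut v &&
    ((!inside c (s.main c v) || !c.used v (s.main c v)) &&
      (!inside c (s.next v) || !c.used v (s.next v)))))

/-- A stop requires a main arc at the same vertex. At a sink the two trails are then glued, so that
neither amenability nor the order of the edges is at stake. -/
def haltOk (v : ℕ) : Bool :=
  !inside c (s.halt c v) || ((c.keptIn v || inside c (s.main c v)) &&
    (sink s c v || (amenableOk s c (s.halt c v) v && followOk s c v)))

/-- Excludes cycles of bad vertices as far as this is possible within a kite: the vertex lies on no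
cycle, or a neighbour on its trail is not bad, or it is passed by two boundary edges and is left to
the selection among the kites. -/
def badOk (v : ℕ) : Bool :=
  !bad s c v || (sink s c v || ((c.keptIn v && (c.keptOut v && c.allowed v)) ||
    ((inside c (s.next v) && !bad s c (s.next v)) ||
      (inside c (s.main c v) && !bad s c (s.main c v)))))

/-- An edge of F₁ that was present before is double without belonging to M. If its head is a sink,
then neither of its ends lies on a cycle. For 4-kites `edgeOk` forbids such edges. -/
def doubleOk (v : ℕ) : Bool :=
  Nat.beq c.n 4 || allBelow c.n fun u =>
    !Nat.beq (s.next u) v || (!(c.rest u v && s.f₁ u v) || sink s c v)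

/-- The degree is tested only where a boundary edge is removed; elsewhere `predOk` already covers
it. -/
def vertexOk (v : ℕ) : Bool :=
  (!(Nat.beq v c.x || c.gone v) || degreeOk s c v) && ((!inside c (s.next v) || !c.keptOut v) &&
    ((!c.keptIn v || !inside c (s.pred₂ v)) &&
      (haltOk s c v && (badOk s c v && doubleOk s c v))))

def countOk : Bool :=
  (Nat.beq (edgeCount c.n s.f₁) 1 && Nat.beq (edgeCount c.n s.f₂) 0) ||
    (Nat.beq c.n 4 && (Nat.beq (edgeCount c.n s.f₁) 2 && (Nat.beq (edgeCount c.n s.f₂) 1 &&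
      allBelow c.n fun i => allBelow c.n fun j => !s.f₂ i j || !mate i j)))

def predOk (v : ℕ) : Bool :=
  Nat.ble (sumBelow c.n (s.f₂ v)) (Nat.add (sumBelow c.n (s.f₁ v)) 1) &&
  (!inside c (s.pred₁ v) || Nat.beq (s.next (s.pred₁ v)) v) &&
    (!inside c (s.pred₂ v) || (Nat.beq (s.next (s.pred₂ v)) v && !Nat.beq (s.pred₁ v) (s.pred₂ v)))

def edgeOk (i j : ℕ) : Bool :=
  (!s.f₁ i j || (side c.n i j && !(c.rest i j && mate i j))) &&
  ((!s.f₂ i j || (c.rest i j && !s.f₁ i j)) &&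
  -- `xor` with a negation expresses equivalence: an edge survives the exchange if and only if it
  -- carries an arc.
  ((xor ((c.rest i j || s.f₁ i j) && !s.f₂ i j)
    (!(Nat.beq (s.next i) j || Nat.beq (s.next j) i))) &&
  (!Nat.beq (s.next i) j || (!Nat.beq (s.next j) i &&
    ((Nat.beq (s.pred₁ j) i || Nat.beq (s.pred₂ j) i) &&
    (!(c.rest i j && s.f₁ i j) || Nat.beq c.n 3))))))

/-- The conditions that depend only on the edges inside the kite. -/
def edgesOk : Bool :=
  countOk s c && ((allBelow c.n fun v => predOk s c v) &&
    allBelow c.n fun i => allBelow c.n fun j => edgeOk s c i j)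

def verticesOk : Bool := allBelow c.n fun v => vertexOk s c v

end Solution

/-- Subtraction from 63 complements a mask of six bits. Thus F₁ consists of the edges kept but not
present before, together with the duplicated edge, and F₂ of those present before but not kept. -/
def Template.toSolution (t : Template) (bm : ℕ) : Solution where
  f₁ := edge (Nat.lor (Nat.land t.1 (Nat.sub 63 bm)) t.2.2.2.2.1)
  f₂ := edge (Nat.land bm (Nat.sub 63 t.1))
  next := digit t.2.1
  pred₁ := digit t.2.2.1
  pred₂ := digit t.2.2.2.1

/-- The conditions in `edgesOk` read only the size and the edges inside the kite. The other fields
are therefore dummies, and the templates are filtered once for all choices of boundary edges. -/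
def Template.fits (n bm : ℕ) (t : Template) : Bool :=
  (t.toSolution bm).edgesOk
    ⟨n, fun _ _ => false, edge bm, fun _ => false, fun _ => false, 0, fun _ => false, fun _ => false⟩

/-- Nothing is assumed about this table, since every entry is tested before use. The octal digit 4
stands for no vertex; 2340 is 4444 in octal. -/
def templates (n : ℕ) : List Template :=
  if Nat.beq n 3 then
  [(11, 2065, 2114, 2340, 0, 7), (9, 2321, 2116, 2340, 0, 3), (9, 2145, 2308, 2324, 8, 37),
   (1, 2337, 2308, 2340, 0, 1), (11, 2114, 2065, 2340, 0, 7), (3, 2306, 2081, 2340, 2, 3),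
   (3, 2306, 2081, 2340, 0, 3), (2, 2338, 2084, 2340, 2, 1), (1, 2308, 2337, 2340, 0, 2),
   (8, 2324, 2148, 2340, 8, 2)]
  else
  [(45, 1091, 209, 2340, 0, 15), (41, 2257, 1092, 2340, 0, 7), (37, 1283, 225, 2340, 0, 11),
   (13, 2115, 273, 2340, 0, 7), (37, 225, 1283, 2340, 0, 13), (9, 2321, 2116, 2340, 0, 3),
   (51, 706, 1049, 2340, 0, 15), (13, 273, 2115, 2340, 0, 11), (41, 1092, 2257, 2340, 0, 14),
   (37, 2243, 1313, 292, 0, 135), (45, 209, 1091, 2340, 0, 15), (35, 2242, 1057, 2340, 0, 7),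
   (41, 1297, 2244, 2148, 0, 75), (43, 1041, 2242, 2148, 0, 79), (5, 2307, 289, 2340, 0, 3),
   (35, 1057, 2242, 2340, 0, 13), (36, 228, 1315, 2340, 0, 12), (53, 707, 1305, 292, 0, 143),
   (33, 2273, 1284, 2340, 0, 5), (51, 1049, 706, 2340, 0, 15), (33, 1284, 2273, 2340, 0, 10),
   (21, 771, 281, 2340, 0, 11), (57, 1113, 708, 2324, 0, 47), (1, 2337, 2308, 2340, 0, 1),
   (25, 785, 2140, 2308, 0, 43), (32, 1316, 2276, 2340, 0, 8), (49, 708, 1305, 2340, 0, 14),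
   (11, 2065, 2114, 2340, 0, 7), (41, 1297, 2116, 2276, 0, 75), (36, 1315, 228, 2340, 0, 9),
   (5, 260, 2339, 2337, 0, 26), (37, 2243, 289, 1316, 0, 135), (40, 1124, 2260, 2340, 0, 12),
   (44, 212, 1123, 2340, 0, 14), (39, 194, 1057, 2339, 0, 31), (44, 1123, 212, 2340, 0, 13),
   (38, 1059, 226, 2340, 0, 13), (36, 2275, 292, 1316, 0, 133), (52, 220, 803, 1316, 0, 142),
   (41, 1121, 2260, 2308, 0, 45), (38, 226, 1059, 2340, 0, 13), (5, 289, 2307, 2340, 0, 9),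
   (21, 281, 771, 2340, 0, 11), (56, 1116, 724, 2340, 0, 14), (37, 196, 1315, 2337, 0, 30),
   (56, 724, 1116, 2340, 0, 14), (9, 2116, 2321, 2340, 0, 6), (11, 2114, 2065, 2340, 0, 7),
   (40, 1300, 2148, 2276, 0, 74), (41, 1121, 2244, 2324, 0, 45), (40, 2260, 1124, 2340, 0, 6),
   (37, 196, 1313, 2339, 0, 30), (9, 2145, 2324, 2308, 0, 37)]

def masks : List ℕ := [0, 1, 2, 3, 4, 5, 6, 7, 8, 9, 10, 11, 12, 13, 14, 15]

def vertices (n : ℕ) : List ℕ := if Nat.beq n 3 then [0, 1, 2] else [0, 1, 2, 3]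

/-- The mask `r` runs through the sets of incoming boundary edges that other kites may remove; each
needs its own template. The test of the last entry of a template is a quick rejection on which
soundness does not depend. -/
def option (n : ℕ) (used : ℕ → ℕ → Bool) (l : List Template) (bm im om x : ℕ)
    (allowed skip : ℕ → Bool) : Bool :=
  force (Nat.sub om (Nat.shiftLeft 1 x)) fun ko =>
  masks.all fun r => !Nat.beq (Nat.lor r im) im || (skip r ||
    (force (Nat.sub im r) fun ki => l.any fun t =>
      Nat.beq (Nat.land t.2.2.2.2.2 (Nat.add ko (Nat.mul 16 ki))) 0 &&
      (t.toSolution bm).verticesOk ⟨n, used, edge bm, bit ki, bit ko, x, bit r, allowed⟩))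

/-- Either some removed edge leaves no vertex to the selection, or there are two options that leave
the distinct vertices `p₁` and `p₀` respectively. The second option may fail when it removes the
edge leaving `p₁`, the vertex it protects, while the incoming edge of `p₁` is gone too;
`exists_selection` avoids this case. -/
def good (n : ℕ) (used : ℕ → ℕ → Bool) (l : List Template) (bm im om : ℕ) : Bool :=
  ((vertices n).any fun x => bit om x &&
    option n used l bm im om x (fun _ => false) (fun _ => false)) ||
  ((vertices n).any fun p₁ => (vertices n).any fun x₀ =>
    bit om x₀ && (option n used l bm im om x₀ (Nat.beq p₁) (fun _ => false) &&
    ((vertices n).any fun p₀ => !Nat.beq p₀ p₁ && ((vertices n).any fun x₁ =>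
      bit om x₁ && option n used l bm im om x₁ (Nat.beq p₀)
        (fun r => Nat.beq x₁ p₁ && bit r p₁)))))

/-- The half-edges, incoming and outgoing boundary edges that are possible at the vertex `i`;
the half-edges are given by four bits. -/
def rows (n i : ℕ) : List (ℕ × Bool × Bool) :=
  (masks.flatMap fun r => [(r, false, false), (r, false, true), (r, true, false),
    (r, true, true)]).filter fun t =>
      Nat.beq (Nat.add (sumBelow n (bit t.1)) (Nat.add t.2.1.toNat t.2.2.toNat)) 2 &&
      (!bit t.1 i && (Nat.beq n 4 || !bit t.1 3))

def mask4 (a b c d : Bool) : ℕ :=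
  Nat.add (Nat.add a.toNat (Nat.mul 2 b.toNat)) (Nat.add (Nat.mul 4 c.toNat) (Nat.mul 8 d.toNat))

/-- Properties shared by all kites: as many incoming as outgoing edges, at least one of them, and
opposite directions at the ends of a whole edge inside the kite when each end has exactly one
boundary edge. The last clause normalises the numbering of a 4-kite. -/
def balanced (n m : ℕ) (inn out : ℕ → Bool) : Bool :=
  Nat.beq (sumBelow n inn) (sumBelow n out) && (Nat.ble 1 (sumBelow n out) &&
  allBelow n fun i => allBelow n fun j =>
    !(bit m (Nat.add (Nat.mul 4 i) j) && bit m (Nat.add (Nat.mul 4 j) i)) ||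
    (!(xor (inn i) (out i)) || (!(xor (inn j) (out j)) || xor (inn i) (inn j)))) &&
  (Nat.ble n 3 || allBelow n fun i => Nat.ble (Nat.add (inn 0).toNat (out 0).toNat)
    (Nat.add (inn i).toNat (out i).toNat))

def splits : List ℕ :=
  [0, 1, 2, 3, 4, 5, 6, 7, 8, 9, 10, 11, 12, 13, 14, 15, 16, 17, 18, 19, 20, 21, 22, 23, 24, 25, 26,
   27, 28, 29, 30, 31, 32, 33, 34, 35, 36, 37, 38, 39, 40, 41, 42, 43, 44, 45, 46, 47, 48, 49, 50,
   51, 52, 53, 54, 55, 56, 57, 58, 59, 60, 61, 62, 63]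

/-- The second half of the split is tested with `im` and `om` exchanged, as it belongs to the
opposite orientation. -/
def solvable (n m im om : ℕ) : Bool :=
  let used := fun i j => bit m (Nat.add (Nat.mul 4 i) j)
  force (edgeMask fun i j => used i j && used j i) fun whole =>
  force (edgeMask fun i j => xor (used i j) (used j i)) fun half =>
  splits.any fun z => Nat.beq (Nat.lor z half) half &&
    (Nat.beq (Nat.mul 2 (edgeCount n (edge z))) (edgeCount n (edge half)) &&
    ((force (Nat.lor whole z) fun bm =>
      good n used ((templates n).filter (Template.fits n bm)) bm im om) &&
    (force (Nat.lor whole (Nat.xor half z)) fun bm =>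
      good n used ((templates n).filter (Template.fits n bm)) bm om im)))

/-- Reversing the orientation exchanges the two halves of a split, so configurations with `om < im`
are skipped. -/
def solvableAll (n : ℕ) (r₃ : List (ℕ × Bool × Bool)) : Bool :=
  (rows n 0).all fun a => (rows n 1).all fun b => (rows n 2).all fun c => r₃.all fun d =>
    force (Nat.add (Nat.add a.1 (Nat.mul 16 b.1)) (Nat.add (Nat.mul 256 c.1) (Nat.mul 4096 d.1)))
      fun m => force (mask4 a.2.1 b.2.1 c.2.1 d.2.1) fun im =>
        force (mask4 a.2.2 b.2.2 c.2.2 d.2.2) fun om =>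
          !balanced n m (bit im) (bit om) || (Nat.ble (Nat.succ om) im || solvable n m im om)

-- For a 3-kite the fourth row is a dummy without half-edges and boundary edges.
set_option maxRecDepth 10000 in
theorem solvableAll_three : solvableAll 3 [(0, false, false)] = true := by decide +kernel

set_option maxRecDepth 10000 in
theorem solvableAll_four : solvableAll 4 (rows 4 3) = true := by decide +kernel

/-! ### Reading off the result of the search -/

theorem bit_eq (m k : ℕ) : bit m k = m.testBit k := by
  have h : Nat.land 1 (Nat.shiftRight m k) = (m / 2 ^ k) % 2 := by
    change 1 &&& (m >>> k) = _
    rw [Nat.one_and_eq_mod_two, Nat.shiftRight_eq_div_pow]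
  rw [bit, h, Nat.testBit_eq_decide_div_mod_eq]
  have h2 : m / 2 ^ k % 2 = 0 ∨ m / 2 ^ k % 2 = 1 := by omega
  rcases h2 with h2 | h2 <;> rw [h2] <;> decide

theorem force_eq (k : ℕ) (f : ℕ → Bool) : force k f = f k := by
  cases k <;> rfl

theorem allBelow_iff {n : ℕ} (hn : n = 3 ∨ n = 4) (p : ℕ → Bool) :
    allBelow n p = true ↔ ∀ i < n, p i = true := by
  rcases hn with rfl | rfl
  · simp only [allBelow, Nat.ble_eq, le_refl, Bool.and_eq_true, Bool.or_eq_true, true_or, and_true]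
    constructor
    · rintro ⟨h0, h1, h2⟩ i hi
      interval_cases i <;> assumption
    · intro h
      exact ⟨h 0 (by norm_num), h 1 (by norm_num), h 2 (by norm_num)⟩
  · simp only [allBelow, Nat.ble_eq, Bool.and_eq_true, Bool.or_eq_true]
    constructor
    · rintro ⟨h0, h1, h2, h3⟩ i hi
      have h3 : p 3 = true := by simpa using h3
      interval_cases i <;> assumption
    · intro h
      exact ⟨h 0 (by norm_num), h 1 (by norm_num), h 2 (by norm_num), Or.inr (h 3 (by norm_num))⟩

theorem sumBelow_eq {n : ℕ} (hn : n = 3 ∨ n = 4) (p : ℕ → Bool) :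
    sumBelow n p = ∑ i ∈ Finset.range n, (p i).toNat := by
  have h3 : Nat.ble 3 3 = true := rfl
  have h4 : Nat.ble 4 3 = false := rfl
  rcases hn with rfl | rfl <;> simp [sumBelow, Finset.sum_range_succ, add_assoc, h3, h4]

theorem edge_comm (m i j : ℕ) : edge m i j = edge m j i := by
  have h1 : Nat.beq i j = Nat.beq j i := by
    rw [Bool.eq_iff_iff, Nat.beq_eq, Nat.beq_eq, eq_comm]
  have h2 : Nat.add i j = Nat.add j i := Nat.add_comm i j
  have h3 : Nat.mul i j = Nat.mul j i := Nat.mul_comm i j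
  rw [edge, edge, h1, h2, h3]

theorem edge_self (m i : ℕ) : edge m i i = false := by simp [edge]

theorem edge_edgeMask (f : ℕ → ℕ → Bool) (hf : ∀ i j, f i j = f j i) {i j : ℕ} (hi : i < 4)
    (hj : j < 4) (hij : i ≠ j) : edge (edgeMask f) i j = f i j := by
  have key : ∀ a b c d e g : Bool,
      let m := Nat.add (Nat.add a.toNat (Nat.add (Nat.mul 2 b.toNat) (Nat.mul 4 c.toNat)))
        (Nat.add (Nat.mul 8 d.toNat) (Nat.add (Nat.mul 16 e.toNat) (Nat.mul 32 g.toNat)))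
      edge m 0 1 = a ∧ edge m 0 2 = b ∧ edge m 0 3 = c ∧ edge m 1 2 = d ∧ edge m 1 3 = e ∧
        edge m 2 3 = g := by decide +kernel
  obtain ⟨h01, h02, h03, h12, h13, h23⟩ := key (f 0 1) (f 0 2) (f 0 3) (f 1 2) (f 1 3) (f 2 3)
  change edge (edgeMask f) 0 1 = _ at h01
  change edge (edgeMask f) 0 2 = _ at h02
  change edge (edgeMask f) 0 3 = _ at h03
  change edge (edgeMask f) 1 2 = _ at h12
  change edge (edgeMask f) 1 3 = _ at h13
  change edge (edgeMask f) 2 3 = _ at h23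
  interval_cases i <;> interval_cases j <;> first
    | exact absurd rfl hij
    | assumption
    | (rw [edge_comm, hf]; assumption)

theorem edge_lor (a b i j : ℕ) : edge (Nat.lor a b) i j = (edge a i j || edge b i j) := by
  have : Nat.lor a b = a ||| b := rfl
  simp only [edge, bit_eq, this, Nat.testBit_or]
  cases Nat.beq i j <;> simp

theorem edge_xor (a b i j : ℕ) : edge (Nat.xor a b) i j = xor (edge a i j) (edge b i j) := by
  have : Nat.xor a b = a ^^^ b := rfl
  simp only [edge, bit_eq, this, Nat.testBit_xor]
  cases Nat.beq i j <;> simp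

theorem bit_mask4 (a b c d : Bool) : bit (mask4 a b c d) 0 = a ∧ bit (mask4 a b c d) 1 = b ∧
    bit (mask4 a b c d) 2 = c ∧ bit (mask4 a b c d) 3 = d ∧ mask4 a b c d < 16 := by
  revert a b c d; decide +kernel

theorem mask4_mem (a b c d : Bool) : mask4 a b c d ∈ masks := by
  revert a b c d; decide +kernel

theorem mem_rows {n i : ℕ} (a b c d x y : Bool)
    (h : sumBelow n (bit (mask4 a b c d)) + (x.toNat + y.toNat) = 2)
    (hi : bit (mask4 a b c d) i = false) (hn : n = 4 ∨ d = false) :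
    (mask4 a b c d, x, y) ∈ rows n i := by
  rw [rows, List.mem_filter]
  constructor
  · rw [List.mem_flatMap]
    exact ⟨_, mask4_mem a b c d, by cases x <;> cases y <;> simp⟩
  · have h3 := (bit_mask4 a b c d).2.2.2.1
    have h' : Nat.beq (Nat.add (sumBelow n (bit (mask4 a b c d))) (Nat.add x.toNat y.toNat)) 2
        = true := by rw [Nat.beq_eq]; exact h
    simp only [h', hi, h3, Bool.true_and, Bool.not_false, Bool.or_eq_true, Nat.beq_eq,
      Bool.not_eq_true']
    exact hn

/-- The code of four rows of four bits. -/
def code (r₀ r₁ r₂ r₃ : ℕ) : ℕ :=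
  Nat.add (Nat.add r₀ (Nat.mul 16 r₁)) (Nat.add (Nat.mul 256 r₂) (Nat.mul 4096 r₃))

theorem bit_code {r₀ r₁ r₂ r₃ : ℕ} (h₀ : r₀ < 16) (h₁ : r₁ < 16) (h₂ : r₂ < 16)
    {j : ℕ} (hj : j < 4) : bit (code r₀ r₁ r₂ r₃) j = bit r₀ j ∧
      bit (code r₀ r₁ r₂ r₃) (4 + j) = bit r₁ j ∧ bit (code r₀ r₁ r₂ r₃) (8 + j) = bit r₂ j ∧
      bit (code r₀ r₁ r₂ r₃) (12 + j) = bit r₃ j := by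
  have h : code r₀ r₁ r₂ r₃ = r₀ + 16 * r₁ + (256 * r₂ + 4096 * r₃) := rfl
  simp only [bit_eq, h, Nat.testBit_eq_decide_div_mod_eq]
  interval_cases j <;> refine ⟨?_, ?_, ?_, ?_⟩ <;> congr 2 <;> norm_num <;> omega

/-- The vertices of a function on four places, as a mask. -/
def maskOf (f : ℕ → Bool) : ℕ := mask4 (f 0) (f 1) (f 2) (f 3)

theorem bit_maskOf (f : ℕ → Bool) {i : ℕ} (hi : i < 4) : bit (maskOf f) i = f i := by
  obtain ⟨h0, h1, h2, h3, -⟩ := bit_mask4 (f 0) (f 1) (f 2) (f 3)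
  interval_cases i <;> assumption

theorem maskOf_lt (f : ℕ → Bool) : maskOf f < 16 := (bit_mask4 _ _ _ _).2.2.2.2

theorem maskOf_mem (f : ℕ → Bool) : maskOf f ∈ masks := mask4_mem _ _ _ _

theorem maskOf_sub_aux : ∀ a b c d a' b' c' d' : Bool,
    (!a || a') = true → (!b || b') = true → (!c || c') = true → (!d || d') = true →
    Nat.beq (Nat.lor (mask4 a b c d) (mask4 a' b' c' d')) (mask4 a' b' c' d') = true ∧
    Nat.beq (Nat.sub (mask4 a' b' c' d') (mask4 a b c d))
      (mask4 (a' && !a) (b' && !b) (c' && !c) (d' && !d)) = true := by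
  decide +kernel

theorem maskOf_sub {f g : ℕ → Bool} (h : ∀ i, f i = true → g i = true) :
    Nat.lor (maskOf f) (maskOf g) = maskOf g ∧
      Nat.sub (maskOf g) (maskOf f) = maskOf fun i => g i && !f i := by
  have h' : ∀ i, (!f i || g i) = true := fun i => by
    have := h i
    cases hf : f i <;> simp_all
  obtain ⟨h1, h2⟩ := maskOf_sub_aux _ _ _ _ _ _ _ _ (h' 0) (h' 1) (h' 2) (h' 3)
  exact ⟨Nat.eq_of_beq_eq_true h1, Nat.eq_of_beq_eq_true h2⟩

theorem maskOf_single : ∀ x < 4, Nat.shiftLeft 1 x = maskOf (Nat.beq x) := by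
  intro x hx
  interval_cases x <;> rfl

theorem bit_code_maskOf (f : ℕ → ℕ → Bool) {i j : ℕ} (hi : i < 4) (hj : j < 4) :
    bit (code (maskOf (f 0)) (maskOf (f 1)) (maskOf (f 2)) (maskOf (f 3)))
      (Nat.add (Nat.mul 4 i) j) = f i j := by
  obtain ⟨h0, h1, h2, h3⟩ := bit_code (maskOf_lt (f 0)) (maskOf_lt (f 1)) (maskOf_lt (f 2))
    (r₃ := maskOf (f 3)) hj
  rw [bit_maskOf _ hj] at h0 h1 h2 h3
  interval_cases i
  · simpa using h0
  · simpa using h1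
  · simpa using h2
  · simpa using h3

/-- The exchanged edges of a solution are unordered pairs of distinct vertices. -/
structure Solution.IsSymm (s : Solution) : Prop where
  comm₁ : ∀ i j, s.f₁ i j = s.f₁ j i
  comm₂ : ∀ i j, s.f₂ i j = s.f₂ j i
  self₁ : ∀ i, s.f₁ i i = false
  self₂ : ∀ i, s.f₂ i i = false

theorem Template.isSymm_toSolution (t : Template) (bm : ℕ) : (t.toSolution bm).IsSymm :=
  ⟨fun _ _ => edge_comm _ _ _, fun _ _ => edge_comm _ _ _, fun _ => edge_self _ _,
    fun _ => edge_self _ _⟩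

/-- Whatever incoming boundary edges are removed, there is a solution for each of two choices of
the removed outgoing boundary edge; each choice protects one of two vertices. -/
def Good (n : ℕ) (used rest : ℕ → ℕ → Bool) (inn out : ℕ → Bool) : Prop :=
  ∃ p x : Bool → ℕ, ∀ b, p b < n ∧ x b < n ∧ out (x b) = true ∧
    ∀ gone : ℕ → Bool, (∀ i, gone i = true → inn i = true) →
      (b = true → x true = p true → gone (p true) = false) →
      ∃ (c : Config) (s : Solution), c.n = n ∧ c.x = x b ∧
        (∀ i < n, c.keptIn i = (inn i && !gone i)) ∧
        (∀ i < n, c.keptOut i = (out i && !Nat.beq i (x b))) ∧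
        (∀ i < n, c.gone i = gone i) ∧
        (∀ i < n, c.allowed i = true → i = p (!b) ∧ i ≠ p b) ∧
        (∀ i < n, ∀ j < n, c.used i j = used i j) ∧
        (∀ i < n, ∀ j < n, c.rest i j = rest i j) ∧
        s.IsSymm ∧ s.edgesOk c = true ∧ s.verticesOk c = true

theorem Good.congr {n : ℕ} {used rest rest' : ℕ → ℕ → Bool} {inn out : ℕ → Bool}
    (h : Good n used rest inn out) (hr : ∀ i < n, ∀ j < n, rest i j = rest' i j) :
    Good n used rest' inn out := by
  obtain ⟨p, x, h⟩ := h
  refine ⟨p, x, fun b => ⟨(h b).1, (h b).2.1, (h b).2.2.1, fun gone hg hg' => ?_⟩⟩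
  obtain ⟨c, s, h1, h2, h3, h4, h5, h6, h7, h8, h9⟩ := (h b).2.2.2 gone hg hg'
  exact ⟨c, s, h1, h2, h3, h4, h5, h6, h7,
    fun i hi j hj => (h8 i hi j hj).trans (hr i hi j hj), h9⟩

theorem mem_vertices {n x : ℕ} (hn : n = 3 ∨ n = 4) (hx : x ∈ vertices n) : x < n := by
  rcases hn with rfl | rfl
  · have : vertices 3 = [0, 1, 2] := rfl
    rw [this] at hx
    simp only [List.mem_cons, List.not_mem_nil, or_false] at hx
    omega
  · have : vertices 4 = [0, 1, 2, 3] := rfl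
    rw [this] at hx
    simp only [List.mem_cons, List.not_mem_nil, or_false] at hx
    omega

theorem edgesOk_of_fits {n bm : ℕ} {t : Template} (h : t.fits n bm = true) (c : Config)
    (hn : c.n = n) (hr : c.rest = edge bm) : (t.toSolution bm).edgesOk c = true := by
  rw [← h, Template.fits]
  subst hn
  obtain ⟨n, used, rest, ki, ko, x, gone, allowed⟩ := c
  simp only at hr
  subst hr
  rfl

theorem option_spec {n : ℕ} (hn : n = 3 ∨ n = 4) {used used' : ℕ → ℕ → Bool} {bm x : ℕ}
    {inn out : ℕ → Bool} {allowed : ℕ → Bool} {skip : ℕ → Bool}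
    (hu : ∀ i < n, ∀ j < n, used' i j = used i j) (hx : x < n) (hox : out x = true)
    (h : option n used' ((templates n).filter (Template.fits n bm)) bm (maskOf inn) (maskOf out) x
      allowed skip = true)
    (gone : ℕ → Bool) (hg : ∀ i, gone i = true → inn i = true)
    (hs : skip (maskOf gone) = false) :
    ∃ (c : Config) (s : Solution), c.n = n ∧ c.x = x ∧
        (∀ i < n, c.keptIn i = (inn i && !gone i)) ∧
        (∀ i < n, c.keptOut i = (out i && !Nat.beq i x)) ∧
        (∀ i < n, c.gone i = gone i) ∧ c.allowed = allowed ∧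
        (∀ i < n, ∀ j < n, c.used i j = used i j) ∧
        (∀ i < n, ∀ j < n, c.rest i j = edge bm i j) ∧
        s.IsSymm ∧ s.edgesOk c = true ∧ s.verticesOk c = true := by
  have hn4 : n ≤ 4 := by omega
  rw [option, force_eq, List.all_eq_true] at h
  have h1 := h _ (maskOf_mem gone)
  obtain ⟨ha, hb⟩ := maskOf_sub hg
  have hbeq : ∀ k, Nat.beq k k = true := fun k => by rw [Nat.beq_eq]
  rw [ha, hs, hb, force_eq, hbeq, Bool.not_true, Bool.false_or, Bool.false_or,
    List.any_eq_true] at h1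
  obtain ⟨t, ht, hc⟩ := h1
  rw [List.mem_filter] at ht
  rw [Bool.and_eq_true] at hc
  have hko : Nat.sub (maskOf out) (Nat.shiftLeft 1 x) = maskOf fun i => out i && !Nat.beq x i := by
    rw [maskOf_single x (by omega)]
    refine (maskOf_sub fun i hi => ?_).2
    rw [Nat.beq_eq] at hi
    rwa [← hi]
  rw [hko] at hc
  refine ⟨_, t.toSolution bm, rfl, rfl, ?_, ?_, ?_, rfl, hu, fun _ _ _ _ => rfl,
    t.isSymm_toSolution bm, ?_, hc.2⟩
  · intro i hi
    exact bit_maskOf _ (by omega)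
  · intro i hi
    rw [show Nat.beq i x = Nat.beq x i by rw [Bool.eq_iff_iff, Nat.beq_eq, Nat.beq_eq, eq_comm]]
    exact bit_maskOf _ (by omega)
  · intro i hi
    exact bit_maskOf _ (by omega)
  · exact edgesOk_of_fits ht.2 _ rfl rfl

theorem good_spec {n : ℕ} (hn : n = 3 ∨ n = 4) {used used' rest : ℕ → ℕ → Bool} {bm : ℕ}
    {inn out : ℕ → Bool} (hu : ∀ i < n, ∀ j < n, used' i j = used i j)
    (hr : ∀ i < n, ∀ j < n, edge bm i j = rest i j)
    (h : good n used' ((templates n).filter (Template.fits n bm)) bm (maskOf inn) (maskOf out)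
      = true) : Good n used rest inn out := by
  have hn4 : n ≤ 4 := by omega
  rw [good, Bool.or_eq_true] at h
  rcases h with h | h
  · rw [List.any_eq_true] at h
    obtain ⟨x, hx, h⟩ := h
    have hx := mem_vertices hn hx
    rw [Bool.and_eq_true, bit_maskOf _ (by omega)] at h
    -- No vertex is left to the selection, so the two options coincide and the protected vertex is
    -- an arbitrary one of the kite.
    refine ⟨fun _ => x, fun _ => x, fun b => ⟨hx, hx, h.1, fun gone hg _ => ?_⟩⟩
    obtain ⟨c, s, h1, h2, h3, h4, h5, h6, h7, h8, h9⟩ := option_spec hn hu hx h.1 h.2 gone hg rfl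
    refine ⟨c, s, h1, h2, h3, h4, h5, ?_, h7, ?_, h9⟩
    · intro i _ hi
      rw [h6] at hi
      cases hi
    · intro i hi j hj
      rw [h8 i hi j hj, hr i hi j hj]
  · simp only [List.any_eq_true, Bool.and_eq_true, Bool.not_eq_true'] at h
    obtain ⟨p₁, hp₁, x₀, hx₀, hox₀, ho₀, p₀, hp₀, hp, x₁, hx₁, hox₁, ho₁⟩ := h
    have hp₁ := mem_vertices hn hp₁
    have hp₀ := mem_vertices hn hp₀
    have hx₀ := mem_vertices hn hx₀
    have hx₁ := mem_vertices hn hx₁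
    rw [bit_maskOf _ (by omega)] at hox₀ hox₁
    have hne : p₀ ≠ p₁ := by
      rintro rfl
      rw [← Bool.not_eq_true, Nat.beq_eq] at hp
      exact hp rfl
    refine ⟨fun b => cond b p₁ p₀, fun b => cond b x₁ x₀, fun b => ?_⟩
    cases b
    · refine ⟨hp₀, hx₀, hox₀, fun gone hg _ => ?_⟩
      obtain ⟨c, s, h1, h2, h3, h4, h5, h6, h7, h8, h9⟩ :=
        option_spec hn hu hx₀ hox₀ ho₀ gone hg rfl
      refine ⟨c, s, h1, h2, h3, h4, h5, ?_, h7, ?_, h9⟩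
      · intro i _ hi
        rw [h6, Nat.beq_eq] at hi
        subst hi
        exact ⟨rfl, hne.symm⟩
      · intro i hi j hj
        rw [h8 i hi j hj, hr i hi j hj]
    · refine ⟨hp₁, hx₁, hox₁, fun gone hg hgone => ?_⟩
      obtain ⟨c, s, h1, h2, h3, h4, h5, h6, h7, h8, h9⟩ :=
        option_spec hn hu hx₁ hox₁ ho₁ gone hg (by
          rw [bit_maskOf _ (by omega)]
          rcases eq_or_ne x₁ p₁ with heq | hne
          · have h0 : gone p₁ = false := hgone rfl heq
            rw [h0, Bool.and_false]
          · rw [Bool.and_eq_false_iff]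
            left
            rwa [← Bool.not_eq_true, Nat.beq_eq])
      refine ⟨c, s, h1, h2, h3, h4, h5, ?_, h7, ?_, h9⟩
      · intro i _ hi
        rw [h6, Nat.beq_eq] at hi
        subst hi
        exact ⟨rfl, hne⟩
      · intro i hi j hj
        rw [h8 i hi j hj, hr i hi j hj]

/-- The possible configurations of the half-edges and of the boundary edges of a kite. -/
structure IsConfig (n : ℕ) (used : ℕ → ℕ → Bool) (inn out : ℕ → Bool) : Prop where
  size : n = 3 ∨ n = 4
  used_lt : ∀ i j, used i j = true → i < n ∧ j < n
  inn_lt : ∀ i, inn i = true → i < n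
  out_lt : ∀ i, out i = true → i < n
  irrefl : ∀ i, used i i = false
  degree : ∀ i < n, ∑ j ∈ Finset.range n, (used i j).toNat + ((inn i).toNat + (out i).toNat) = 2
  balanced : ∑ i ∈ Finset.range n, (inn i).toNat = ∑ i ∈ Finset.range n, (out i).toNat
  nonempty : ∃ i, out i = true
  alternate : ∀ i j, used i j = true → used j i = true → inn i ≠ out i → inn j ≠ out j →
    inn i ≠ inn j
  first : n = 4 → ∀ i < n, (inn 0).toNat + (out 0).toNat ≤ (inn i).toNat + (out i).toNat

variable {n : ℕ} {used : ℕ → ℕ → Bool} {inn out : ℕ → Bool}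

theorem IsConfig.swap (h : IsConfig n used inn out) : IsConfig n used out inn where
  size := h.size
  used_lt := h.used_lt
  inn_lt := h.out_lt
  out_lt := h.inn_lt
  irrefl := h.irrefl
  degree i hi := by rw [add_comm (out i).toNat]; exact h.degree i hi
  balanced := h.balanced.symm
  nonempty := by
    by_contra hne
    push Not at hne
    obtain ⟨i, hi⟩ := h.nonempty
    have h0 : ∑ i ∈ Finset.range n, (inn i).toNat = 0 :=
      Finset.sum_eq_zero fun j _ => by simp [hne j]
    rw [h.balanced, Finset.sum_eq_zero_iff] at h0
    have := h0 i (Finset.mem_range.2 (h.out_lt i hi))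
    simp [hi] at this
  alternate i j h1 h2 h3 h4 := by
    have := h.alternate i j h1 h2 h3.symm h4.symm
    revert h3 h4 this
    cases inn i <;> cases inn j <;> cases out i <;> cases out j <;> simp
  first h4 i hi := by
    have := h.first h4 i hi
    omega

theorem IsConfig.mem_rows (h : IsConfig n used inn out) {i : ℕ} (hi : i < n) :
    (maskOf (used i), inn i, out i) ∈ rows n i := by
  have hn := h.size
  have hsum : sumBelow n (bit (maskOf (used i))) = ∑ j ∈ Finset.range n, (used i j).toNat := by
    rw [sumBelow_eq hn]
    refine Finset.sum_congr rfl fun j hj => ?_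
    rw [Finset.mem_range] at hj
    exact congrArg Bool.toNat (bit_maskOf (used i) (by omega))
  have hdeg := h.degree i hi
  rw [← hsum] at hdeg
  refine Local.mem_rows _ _ _ _ _ _ ?_ ?_ ?_
  · exact hdeg
  · exact (bit_maskOf (used i) (by omega)).trans (h.irrefl i)
  · rcases hn with rfl | rfl
    · right
      by_contra h3
      rw [Bool.not_eq_false] at h3
      have := (h.used_lt _ _ h3).2
      omega
    · left; rfl

theorem IsConfig.balanced_eq (h : IsConfig n used inn out) :
    Local.balanced n (code (maskOf (used 0)) (maskOf (used 1)) (maskOf (used 2)) (maskOf (used 3)))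
      (bit (maskOf inn)) (bit (maskOf out)) = true := by
  have hn := h.size
  have hn4 : n ≤ 4 := by omega
  have hsum : ∀ f : ℕ → Bool, sumBelow n (bit (maskOf f)) = ∑ i ∈ Finset.range n, (f i).toNat := by
    intro f
    rw [sumBelow_eq hn]
    refine Finset.sum_congr rfl fun j hj => ?_
    rw [Finset.mem_range] at hj
    rw [bit_maskOf _ (by omega)]
  simp only [Local.balanced, hsum, Bool.and_eq_true, Nat.beq_eq]
  refine ⟨⟨h.balanced, ?_, ?_⟩, ?_⟩
  · obtain ⟨i, hi⟩ := h.nonempty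
    rw [Nat.ble_eq]
    calc 1 = (out i).toNat := by rw [hi]; rfl
      _ ≤ _ := Finset.single_le_sum (f := fun i => (out i).toNat) (fun _ _ => Nat.zero_le _)
        (Finset.mem_range.2 (h.out_lt i hi))
  · rw [allBelow_iff hn]
    intro i hi
    rw [allBelow_iff hn]
    intro j hj
    rw [bit_code_maskOf used (by omega) (by omega), bit_code_maskOf used (by omega) (by omega),
      bit_maskOf _ (by omega), bit_maskOf _ (by omega), bit_maskOf _ (by omega),
      bit_maskOf _ (by omega)]
    have := h.alternate i j
    revert this
    cases used i j <;> cases used j i <;> cases inn i <;> cases inn j <;> cases out i <;>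
      cases out j <;> simp
  · rw [Bool.or_eq_true, allBelow_iff hn, Nat.ble_eq]
    rcases hn with rfl | rfl
    · left; exact le_rfl
    · right
      intro i hi
      rw [Nat.ble_eq, bit_maskOf _ (by omega), bit_maskOf _ (by omega), bit_maskOf _ (by omega),
        bit_maskOf _ (by omega)]
      exact h.first rfl i hi

theorem IsConfig.solvable (h : IsConfig n used inn out) (hle : maskOf inn ≤ maskOf out) :
    Local.solvable n
      (code (maskOf (used 0)) (maskOf (used 1)) (maskOf (used 2)) (maskOf (used 3)))
      (maskOf inn) (maskOf out) = true := by
  have key : solvableAll n [(maskOf (used 3), inn 3, out 3)] = true := by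
    rcases h.size with rfl | rfl
    · have h3 : ∀ j, used 3 j = false := fun j => by
        by_contra h3
        rw [Bool.not_eq_false] at h3
        have := (h.used_lt _ _ h3).1
        omega
      have hi : inn 3 = false := by
        by_contra h3
        rw [Bool.not_eq_false] at h3
        have := h.inn_lt _ h3
        omega
      have ho : out 3 = false := by
        by_contra h3
        rw [Bool.not_eq_false] at h3
        have := h.out_lt _ h3
        omega
      have hm : maskOf (used 3) = 0 := by
        rw [maskOf, h3, h3, h3, h3]; rfl
      rw [hm, hi, ho]
      exact solvableAll_three
    · have := solvableAll_four
      simp only [solvableAll, List.all_eq_true, List.mem_singleton] at this ⊢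
      rintro a ha b hb c hc d rfl
      exact this a ha b hb c hc _ (h.mem_rows (by norm_num))
  simp only [solvableAll, List.all_eq_true, List.mem_singleton, forall_eq, force_eq] at key
  have hn : 3 ≤ n := by have := h.size; omega
  have := key _ (h.mem_rows (i := 0) (by omega)) _ (h.mem_rows (i := 1) (by omega)) _
    (h.mem_rows (i := 2) (by omega))
  have hb := h.balanced_eq
  rw [Bool.or_eq_true, Bool.or_eq_true] at this
  rcases this with this | this | this
  · exfalso
    rw [Bool.not_eq_true', ← Bool.not_eq_true] at this
    exact this hb
  · rw [Nat.ble_eq] at this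
    exact absurd hle (Nat.not_le.2 this)
  · exact this

theorem IsConfig.exists_split_aux (h : IsConfig n used inn out) (hle : maskOf inn ≤ maskOf out) :
    ∃ z : ℕ → ℕ → Bool, (∀ i j, z i j = z j i) ∧
      (∀ i < n, ∀ j < n, z i j = true → used i j ≠ used j i) ∧
      2 * edgeCount n z = edgeCount n (fun i j => xor (used i j) (used j i)) ∧
      Good n used (fun i j => (used i j && used j i) || z i j) inn out ∧
      Good n used (fun i j => (used i j && used j i) || xor (xor (used i j) (used j i)) (z i j))
        out inn := by
  have hn := h.size
  have hn4 : n ≤ 4 := by omega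
  have hs := h.solvable hle
  rw [Local.solvable] at hs
  simp only [force_eq, List.any_eq_true, Bool.and_eq_true, Nat.beq_eq] at hs
  set m := code (maskOf (used 0)) (maskOf (used 1)) (maskOf (used 2)) (maskOf (used 3)) with hm
  have hu : ∀ i < 4, ∀ j < 4, bit m (Nat.add (Nat.mul 4 i) j) = used i j := fun i hi j hj =>
    bit_code_maskOf used hi hj
  set whole := edgeMask fun i j => bit m (Nat.add (Nat.mul 4 i) j) && bit m (Nat.add (Nat.mul 4 j) i)
  set half := edgeMask fun i j =>
    xor (bit m (Nat.add (Nat.mul 4 i) j)) (bit m (Nat.add (Nat.mul 4 j) i))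
  have hwhole : ∀ i < 4, ∀ j < 4, i ≠ j → edge whole i j = (used i j && used j i) := by
    intro i hi j hj hij
    rw [edge_edgeMask _ (fun i j => Bool.and_comm _ _) hi hj hij, hu i hi j hj, hu j hj i hi]
  have hhalf : ∀ i < 4, ∀ j < 4, i ≠ j → edge half i j = xor (used i j) (used j i) := by
    intro i hi j hj hij
    rw [edge_edgeMask _ (fun i j => Bool.xor_comm _ _) hi hj hij, hu i hi j hj, hu j hj i hi]
  obtain ⟨z, -, hz, hcount, hg₁, hg₂⟩ := hs
  refine ⟨edge z, edge_comm z, ?_, ?_, ?_, ?_⟩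
  · intro i hi j hj hij heq
    have hne : i ≠ j := by
      rintro rfl
      rw [edge_self] at hij
      cases hij
    have := edge_lor z half i j
    rw [hz, hij, hhalf i (by omega) j (by omega) hne, heq] at this
    simp at this
  · refine hcount.trans ?_
    simp only [edgeCount, hhalf 0 (by norm_num) 1 (by norm_num) (by norm_num),
      hhalf 0 (by norm_num) 2 (by norm_num) (by norm_num),
      hhalf 0 (by norm_num) 3 (by norm_num) (by norm_num),
      hhalf 1 (by norm_num) 2 (by norm_num) (by norm_num),
      hhalf 1 (by norm_num) 3 (by norm_num) (by norm_num),
      hhalf 2 (by norm_num) 3 (by norm_num) (by norm_num)]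
  · refine good_spec hn (fun i hi j hj => hu i (by omega) j (by omega)) ?_ hg₁
    intro i hi j hj
    rw [edge_lor]
    rcases eq_or_ne i j with rfl | hij
    · rw [edge_self, edge_self, h.irrefl]; rfl
    · rw [hwhole i (by omega) j (by omega) hij]
  · refine good_spec hn (fun i hi j hj => hu i (by omega) j (by omega)) ?_ hg₂
    intro i hi j hj
    rw [edge_lor, edge_xor]
    rcases eq_or_ne i j with rfl | hij
    · rw [edge_self, edge_self, edge_self, h.irrefl]; rfl
    · rw [hwhole i (by omega) j (by omega) hij, hhalf i (by omega) j (by omega) hij]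

/-- The edges with exactly one half-edge can be halved so that both halves admit solutions, one for
the given orientation of the boundary edges and one for the opposite orientation. -/
theorem IsConfig.exists_split (h : IsConfig n used inn out) :
    ∃ z : ℕ → ℕ → Bool, (∀ i j, z i j = z j i) ∧
      (∀ i < n, ∀ j < n, z i j = true → used i j ≠ used j i) ∧
      2 * edgeCount n z = edgeCount n (fun i j => xor (used i j) (used j i)) ∧
      Good n used (fun i j => (used i j && used j i) || z i j) inn out ∧
      Good n used (fun i j => (used i j && used j i) || xor (xor (used i j) (used j i)) (z i j))
        out inn := by
  rcases le_total (maskOf inn) (maskOf out) with hle | hle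
  · exact h.exists_split_aux hle
  -- The complement of the half found for the reversed configuration has the required properties.
  · have hn := h.size
    obtain ⟨z, hz, hsub, hcount, hg₁, hg₂⟩ := h.swap.exists_split_aux hle
    refine ⟨fun i j => xor (xor (used i j) (used j i)) (z i j) && (decide (i < n) && decide (j < n)),
      ?_, ?_, ?_, ?_, ?_⟩
    · intro i j
      show (_ && _) = (_ && _)
      rw [hz i j, Bool.xor_comm (used i j), Bool.and_comm (decide (i < n))]
    · intro i hi j hj hij heq
      have := hsub i hi j hj
      dsimp only at hij
      revert hij this heq
      cases used i j <;> cases used j i <;> cases z i j <;> simp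
    · have key : ∀ i < n, ∀ j < n, (xor (xor (used i j) (used j i)) (z i j) &&
          (decide (i < n) && decide (j < n))).toNat + (z i j).toNat =
          (xor (used i j) (used j i)).toNat := by
        intro i hi j hj
        have := hsub i hi j hj
        revert this
        simp only [hi, hj, decide_true, Bool.and_true]
        cases used i j <;> cases used j i <;> cases z i j <;> simp
      have h3 : Nat.ble 3 3 = true := rfl
      have h4 : Nat.ble 4 3 = false := rfl
      rcases hn with rfl | rfl
      · have := key 0 (by norm_num) 1 (by norm_num)
        have := key 0 (by norm_num) 2 (by norm_num)
        have := key 1 (by norm_num) 2 (by norm_num)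
        simp only [edgeCount, h3, cond_true, Nat.add_eq] at hcount ⊢
        omega
      · have := key 0 (by norm_num) 1 (by norm_num)
        have := key 0 (by norm_num) 2 (by norm_num)
        have := key 1 (by norm_num) 2 (by norm_num)
        have := key 0 (by norm_num) 3 (by norm_num)
        have := key 1 (by norm_num) 3 (by norm_num)
        have := key 2 (by norm_num) 3 (by norm_num)
        simp only [edgeCount, h4, cond_false, Nat.add_eq] at hcount ⊢
        omega
    · refine hg₂.congr fun i hi j hj => ?_
      simp [hi, hj]
    · refine hg₁.congr fun i hi j hj => ?_
      simp only [hi, hj, decide_true, Bool.and_true]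
      cases used i j <;> cases used j i <;> cases z i j <;> simp

end Local
/-! ### Orientations from pairs of involutions -/

/-- Two fixed-point-free involutions admit a 2-colouring that is proper for both. -/
theorem exists_coloring_of_involutive {X : Type*} (α β : Equiv.Perm X)
    (hα : ∀ x, α (α x) = x) (hβ : ∀ x, β (β x) = x) (hα' : ∀ x, α x ≠ x) (hβ' : ∀ x, β x ≠ x) :
    ∃ f : X → Bool, (∀ x, f (α x) = !f x) ∧ ∀ x, f (β x) = !f x := by
  have hαi : α⁻¹ = α := Equiv.ext fun x => by rw [Equiv.Perm.inv_eq_iff_eq, hα]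
  have hβi : β⁻¹ = β := Equiv.ext fun x => by rw [Equiv.Perm.inv_eq_iff_eq, hβ]
  set γ := β * α with hγ
  have hconj : α * γ * α⁻¹ = γ⁻¹ := by
    rw [hγ, mul_inv_rev, hαi, hβi]
    ext x
    simp [hα]
  have hpow : ∀ k : ℤ, ∀ x, α ((γ ^ k) x) = (γ ^ (-k)) (α x) := by
    intro k x
    have h1 : α * γ ^ k * α⁻¹ = γ ^ (-k) := by
      rw [← conj_zpow, hconj, inv_zpow, zpow_neg]
    rw [← h1]
    simp [hαi, hα]
  -- Since α inverts γ = βα, it permutes the orbits of γ, and β x lies in the orbit of α x. Hence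
  -- both involutions act alike on orbits, and it suffices that no orbit is mapped to itself.
  let r := Equiv.Perm.SameCycle.setoid γ
  have hαr : ∀ x y, r x y → r (α x) (α y) := by
    rintro x y ⟨k, rfl⟩
    exact ⟨-k, (hpow k x).symm⟩
  -- If α x = γ^k x, then α fixes γ^m x when k = 2m, and β fixes α (γ^m x) when k = 2m + 1.
  have hne : ∀ x, ¬ r x (α x) := by
    rintro x ⟨k, hk⟩
    obtain ⟨m, rfl | rfl⟩ := Int.even_or_odd' k
    · refine hα' ((γ ^ m) x) ?_
      rw [hpow, ← hk, ← Equiv.Perm.mul_apply, ← zpow_add]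
      congr 2
      ring
    · refine hβ' (α ((γ ^ m) x)) ?_
      have h2 : α ((γ ^ m) x) = (γ ^ (m + 1)) x := by
        rw [hpow, ← hk, ← Equiv.Perm.mul_apply, ← zpow_add]
        congr 2
        ring
      have h3 : (γ ^ (m + 1)) x = β (α ((γ ^ m) x)) := by
        rw [add_comm, zpow_add, zpow_one]
        rfl
      rw [← h3, h2]
  have hβr : ∀ x, r (β x) (α x) := by
    intro x
    refine Equiv.Perm.SameCycle.symm ⟨1, ?_⟩
    rw [zpow_one, hγ, Equiv.Perm.mul_apply, hα]
  let q : X → Quotient r := Quotient.mk r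
  have hq : ∀ x, q x ≠ q (α x) := fun x h => hne x (Quotient.exact h)
  have hqβ : ∀ x, q (β x) = q (α x) := fun x => Quotient.sound (hβr x)
  -- Any linear order on the orbits distinguishes the two members of each pair of orbits.
  obtain ⟨lo, -⟩ := exists_wellFoundedLT (Quotient r)
  have hqα : ∀ x, q (α (β x)) = q x := fun x => by
    have := Quotient.sound (s := r) (hαr _ _ (hβr x))
    rwa [hα] at this
  have hlt : ∀ a b : Quotient r, a ≠ b → (decide (b < a) = !decide (a < b)) := by
    intro a b hab
    rcases lt_or_gt_of_ne hab with h | h <;> simp [h, not_lt.2 h.le]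
  refine ⟨fun x => decide (q x < q (α x)), fun x => ?_, fun x => ?_⟩
  · simp only [hα]
    exact hlt _ _ (hq x)
  · simp only [hqβ, hqα]
    exact hlt _ _ (hq x)

/-- A family of finite sets of even size can be paired up. -/
theorem exists_pairing {X ι : Type*} [Finite X] (f : X → ι)
    (h : ∀ i, Even (Nat.card {x // f x = i})) :
    ∃ β : Equiv.Perm X, (∀ x, β (β x) = x) ∧ (∀ x, β x ≠ x) ∧ ∀ x, f (β x) = f x := by
  cases nonempty_fintype X
  have key : ∀ i, ∃ e : {x // f x = i} → {x // f x = i}, (∀ x, e (e x) = x) ∧ ∀ x, e x ≠ x := by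
    intro i
    obtain ⟨k, hk⟩ := h i
    have e : {x // f x = i} ≃ Fin k × Bool := Fintype.equivOfCardEq (by
      rw [← Nat.card_eq_fintype_card, hk, Fintype.card_prod, Fintype.card_fin, Fintype.card_bool,
        mul_two])
    refine ⟨fun x => e.symm ((e x).1, !(e x).2), fun x => by simp, fun x hx => ?_⟩
    have := congrArg (fun y => (e y).2) hx
    simp at this
  choose e he he' using key
  have hinv : ∀ x, ((e _ ⟨((e (f x) ⟨x, rfl⟩ : {y // f y = f x}) : X), rfl⟩ :
      {y // f y = f (e (f x) ⟨x, rfl⟩ : {y // f y = f x})}) : X) = x := by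
    intro x
    have h1 : ∀ i (y : {y // f y = i}), ((e (f y.1) ⟨y.1, rfl⟩ : {z // f z = f y.1}) : X) =
        (e i y : {z // f z = i}) := by
      rintro i ⟨y, rfl⟩
      rfl
    rw [h1 _ (e (f x) ⟨x, rfl⟩), he]
  refine ⟨Function.Involutive.toPerm (fun x => ((e (f x) ⟨x, rfl⟩ : {y // f y = f x}) : X)) hinv,
    hinv, fun x hx => he' (f x) ⟨x, rfl⟩ (Subtype.ext hx), fun x => (e (f x) ⟨x, rfl⟩).2⟩

/-! ### Selecting one of two options in every kite -/

/-- A union of directed cycles. -/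
structure IsCyclic {V : Type*} (D : V → V → Prop) (K : Finset V) : Prop where
  nonempty : K.Nonempty
  next : ∀ v ∈ K, ∃ w ∈ K, D v w
  prev : ∀ v ∈ K, ∃ u ∈ K, D u v

section Selection

variable {V ι : Type*} {D : V → V → Prop}

theorem IsCyclic.inter (ho : ∀ u v w, D u v → D u w → v = w)
    (hi : ∀ u v w, D v u → D w u → v = w) {K L : Finset V} (hK : IsCyclic D K) (hL : IsCyclic D L)
    (h : (K ∩ L).Nonempty) : IsCyclic D (K ∩ L) where
  nonempty := h
  next v hv := by
    rw [Finset.mem_inter] at hv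
    obtain ⟨w, hw, hvw⟩ := hK.next v hv.1
    obtain ⟨w', hw', hvw'⟩ := hL.next v hv.2
    obtain rfl := ho _ _ _ hvw hvw'
    exact ⟨w, Finset.mem_inter.2 ⟨hw, hw'⟩, hvw⟩
  prev v hv := by
    rw [Finset.mem_inter] at hv
    obtain ⟨w, hw, hvw⟩ := hK.prev v hv.1
    obtain ⟨w', hw', hvw'⟩ := hL.prev v hv.2
    obtain rfl := hi _ _ _ hvw hvw'
    exact ⟨w, Finset.mem_inter.2 ⟨hw, hw'⟩, hvw⟩

theorem IsCyclic.two_le_card (h0 : ∀ v, ¬ D v v) {K : Finset V} (hK : IsCyclic D K) :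
    2 ≤ K.card := by
  obtain ⟨v, hv⟩ := hK.nonempty
  obtain ⟨w, hw, hvw⟩ := hK.next v hv
  exact Finset.one_lt_card.2 ⟨v, hv, w, hw, fun h => h0 v (by rwa [← h] at hvw)⟩

/-- If every index owns at most two vertices then each index can select one of them so that every
union of cycles formed by such vertices contains a selected vertex. -/
theorem exists_transversal [Finite ι] (h0 : ∀ v, ¬ D v v) (ho : ∀ u v w, D u v → D u w → v = w)
    (hi : ∀ u v w, D v u → D w u → v = w) (p : ι → Bool → V) :
    ∃ b : ι → Bool, ∀ K, IsCyclic D K → (∀ v ∈ K, ∃ c i, v = p c i) → ∃ c, p c (b c) ∈ K := by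
  cases nonempty_fintype ι
  let Q : Finset V → Prop := fun K => IsCyclic D K ∧ ∀ v ∈ K, ∃ c i, v = p c i
  -- It suffices to hit the minimal sets. They are pairwise disjoint because a nonempty intersection
  -- of two cyclic sets is cyclic.
  let J := {K : Finset V // Minimal Q K}
  let t : J → Finset ι := fun K => Finset.univ.filter fun c => ∃ i, p c i ∈ K.1
  have hdisj : ∀ K L : J, K ≠ L → Disjoint K.1 L.1 := by
    intro K L hKL
    rw [Finset.disjoint_iff_inter_eq_empty]
    by_contra hne
    have hne := Finset.nonempty_iff_ne_empty.2 hne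
    have hQ : Q (K.1 ∩ L.1) := ⟨K.2.prop.1.inter ho hi L.2.prop.1 hne, fun v hv =>
      K.2.prop.2 v (Finset.mem_inter.1 hv).1⟩
    have h1 := K.2.eq_of_le hQ Finset.inter_subset_left
    have h2 := L.2.eq_of_le hQ Finset.inter_subset_right
    exact hKL (Subtype.ext (h1.symm.trans h2))
  -- Hall's condition: k disjoint sets have at least 2k vertices together, and every index owns at
  -- most two vertices.
  have hall : ∀ s : Finset J, s.card ≤ (s.biUnion t).card := by
    intro s
    have h1 : 2 * s.card ≤ (s.biUnion fun K => K.1).card := by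
      rw [Finset.card_biUnion fun K _ L _ h => hdisj K L h, mul_comm]
      exact Finset.card_nsmul_le_sum s _ 2 fun K _ => K.2.prop.1.two_le_card h0
    have h2 : (s.biUnion fun K => K.1) ⊆
        (s.biUnion t).biUnion fun c => {p c false, p c true} := by
      intro v hv
      rw [Finset.mem_biUnion] at hv
      obtain ⟨K, hK, hv⟩ := hv
      obtain ⟨c, i, rfl⟩ := K.2.prop.2 v hv
      rw [Finset.mem_biUnion]
      refine ⟨c, Finset.mem_biUnion.2 ⟨K, hK, ?_⟩, ?_⟩
      · rw [Finset.mem_filter]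
        exact ⟨Finset.mem_univ _, i, hv⟩
      · cases i <;> simp
    have h3 := (Finset.card_le_card h2).trans (Finset.card_biUnion_le_card_mul _ _ 2 fun c _ =>
      Finset.card_le_two)
    omega
  obtain ⟨f, hf, hft⟩ := (Finset.all_card_le_biUnion_card_iff_exists_injective t).1 hall
  have hex : ∀ K : J, ∃ i, p (f K) i ∈ K.1 := fun K => (Finset.mem_filter.1 (hft K)).2
  choose g hg using hex
  -- Each minimal set receives an index of its own, which selects a vertex in it; the remaining
  -- indices choose arbitrarily.
  refine ⟨fun c => if h : ∃ K, f K = c then g h.choose else false, fun K hK hKp => ?_⟩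
  obtain ⟨L, hLK, hL⟩ : ∃ L, L ≤ K ∧ Minimal Q L :=
    exists_minimal_le_of_wellFoundedLT Q K ⟨hK, hKp⟩
  have h : ∃ K, f K = f ⟨L, hL⟩ := ⟨_, rfl⟩
  refine ⟨f ⟨L, hL⟩, hLK ?_⟩
  have hc : h.choose = ⟨L, hL⟩ := hf h.choose_spec
  have hL' := hg ⟨L, hL⟩
  simp only [dif_pos h, hc]
  exact hL'

/-- The selection of `exists_transversal` where every option moreover removes the arc that leaves
the vertex `x c (b c)`, and the second option is only available if its vertex is not the head of a
removed arc or differs from the tail of its own removed arc. -/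
theorem exists_selection [Finite ι] (h0 : ∀ v, ¬ D v v) (ho : ∀ u v w, D u v → D u w → v = w)
    (hi : ∀ u v w, D v u → D w u → v = w) (p x : ι → Bool → V)
    (hne : ∀ c c' i i', D (x c' i') (p c i) → c' ≠ c) :
    ∃ b : ι → Bool,
      (∀ K, IsCyclic D K → (∀ v ∈ K, ∃ c i, v = p c i) → ∃ c, p c (b c) ∈ K ∨ x c (b c) ∈ K) ∧
      ∀ c, b c = true → x c true = p c true → ∀ c', ¬ D (x c' (b c')) (p c true) := by
  cases nonempty_fintype ι
  let P : (ι → Bool) → Prop := fun b =>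
    ∀ K, IsCyclic D K → (∀ v ∈ K, ∃ c i, v = p c i) → ∃ c, p c (b c) ∈ K ∨ x c (b c) ∈ K
  -- Among the choices that hit all cyclic sets, take one with the fewest indices whose second
  -- option removes the arc leaving the vertex it protects.
  let μ : (ι → Bool) → ℕ := fun b =>
    (Finset.univ.filter fun c => b c = true ∧ x c true = p c true).card
  obtain ⟨b₀, hb₀⟩ := exists_transversal h0 ho hi p
  have hP₀ : ∃ b, P b := ⟨b₀, fun K h1 h2 => (hb₀ K h1 h2).imp fun _ => Or.inl⟩
  obtain ⟨b, hb, hmin⟩ := exists_minimalFor_of_wellFoundedLT P μ hP₀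
  refine ⟨b, hb, fun c hc hx c' hD => ?_⟩
  have hcc : c' ≠ c := hne _ _ _ _ hD
  let b' := Function.update b c false
  have hb' : P b' := by
    intro K h1 h2
    obtain ⟨e, he⟩ := hb K h1 h2
    rcases eq_or_ne e c with rfl | hec
    -- Changing the option of this index does no harm: the cyclic set also contains the predecessor
    -- of the protected vertex, which by uniqueness of incoming arcs is the tail of the arc removed
    -- by `c'`.
    · rw [hc, hx, or_self] at he
      obtain ⟨u, hu, huv⟩ := h1.prev _ he
      obtain rfl := hi _ _ _ huv hD
      exact ⟨c', Or.inr (by simpa [b', Function.update_of_ne hcc] using hu)⟩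
    · exact ⟨e, by simpa [b', Function.update_of_ne hec] using he⟩
  have hlt : μ b' < μ b := by
    refine Finset.card_lt_card ?_
    rw [Finset.ssubset_iff_of_subset]
    · exact ⟨c, by simp [hc, hx], by simp [b']⟩
    · intro e
      simp only [Finset.mem_filter, Finset.mem_univ, true_and]
      rintro ⟨h1, h2⟩
      refine ⟨?_, h2⟩
      rcases eq_or_ne e c with rfl | hec
      · exact hc
      · simpa [b', Function.update_of_ne hec] using h1
  exact absurd (hmin hb' hlt.le) (not_le.2 hlt)

end Selection

/-! ### The edges of a relaxed cycle cover at a vertex -/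

section Slots

variable {V : Type*} {C M : SimpleGraph V} {T : SimpleGraph (V ⊕ Sym2 V)}

theorem IsRelaxedCycleCover.ne (hT : IsRelaxedCycleCover C M T) {u v : V} (h : UsesAt T u v) :
    u ≠ v := by
  rintro rfl
  rcases h with h | h
  · exact (hT.le h).1 rfl
  · obtain ⟨-, c, -, hc⟩ := hT.le h
    exact hc.1 (Sym2.mk_isDiag_iff.2 rfl)

theorem IsRelaxedCycleCover.adj_inl (hT : IsRelaxedCycleCover C M T) {u v : V}
    (h : UsesAt T u v) (hp : ¬ Problematic C M s(u, v)) : T.Adj (.inl u) (.inl v) := by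
  rcases h with h | h
  · exact h
  · exact absurd (hT.le h).2 hp

theorem IsRelaxedCycleCover.adj_inr (hT : IsRelaxedCycleCover C M T) {u v : V}
    (h : UsesAt T u v) (hp : Problematic C M s(u, v)) : T.Adj (.inl u) (.inr s(u, v)) := by
  rcases h with h | h
  · exact absurd hp (hT.le h).2
  · exact h

theorem IsRelaxedCycleCover.usesAt_symm (hT : IsRelaxedCycleCover C M T) {u v : V}
    (h : UsesAt T u v) (hp : ¬ Problematic C M s(u, v)) : UsesAt T v u :=
  Or.inl (hT.adj_inl h hp).symm

theorem IsRelaxedCycleCover.ncard_usesAt (hT : IsRelaxedCycleCover C M T) (u : V) :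
    {v | UsesAt T u v}.ncard = 2 := by
  rw [← hT.two u]
  refine Set.ncard_congr (fun v _ => if Problematic C M s(u, v) then .inr s(u, v) else .inl v)
    ?_ ?_ ?_
  · intro v hv
    rw [SimpleGraph.mem_neighborSet]
    split_ifs with hp
    · exact hT.adj_inr hv hp
    · exact hT.adj_inl hv hp
  · intro v w hv hw h
    split_ifs at h with h1 h2 h2
    · exact Sym2.congr_right.1 (Sum.inr_injective h)
    · exact Sum.inl_injective h
  · rintro (v | e) hv
    · exact ⟨v, Or.inl hv, if_neg (hT.le hv).2⟩
    · obtain ⟨hu, hp⟩ := hT.le hv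
      obtain ⟨v, rfl⟩ := hu
      exact ⟨v, Or.inr hv, if_pos hp⟩

theorem mem_wholeEdges {u v : V} : s(u, v) ∈ wholeEdges T ↔ UsesAt T u v ∧ UsesAt T v u := by
  constructor
  · rintro ⟨a, b, h, h1, h2⟩
    rcases Sym2.eq_iff.1 h with ⟨rfl, rfl⟩ | ⟨rfl, rfl⟩
    · exact ⟨h1, h2⟩
    · exact ⟨h2, h1⟩
  · rintro ⟨h1, h2⟩
    exact ⟨u, v, rfl, h1, h2⟩

theorem mem_halfUsedEdges {u v : V} :
    s(u, v) ∈ halfUsedEdges T ↔ (UsesAt T u v ∧ ¬ UsesAt T v u) ∨ (UsesAt T v u ∧ ¬ UsesAt T u v) := by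
  constructor
  · rintro ⟨a, b, h, h1, h2⟩
    rcases Sym2.eq_iff.1 h with ⟨rfl, rfl⟩ | ⟨rfl, rfl⟩
    · exact Or.inl ⟨h1, h2⟩
    · exact Or.inr ⟨h1, h2⟩
  · rintro (⟨h1, h2⟩ | ⟨h1, h2⟩)
    · exact ⟨u, v, rfl, h1, h2⟩
    · exact ⟨v, u, Sym2.eq_swap, h1, h2⟩

theorem mem_inside {c : C.ConnectedComponent} {u v : V} :
    s(u, v) ∈ inside c ↔ u ≠ v ∧ u ∈ c.supp ∧ v ∈ c.supp := by
  simp only [inside, Set.mem_ofPred_eq, Sym2.mk_isDiag_iff, Sym2.mem_iff, forall_eq_or_imp,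
    forall_eq, ne_eq]

theorem component_eq {c d : C.ConnectedComponent} {v : V} (hc : v ∈ c.supp) (hd : v ∈ d.supp) :
    c = d := by
  rw [SimpleGraph.ConnectedComponent.mem_supp_iff] at hc hd
  rw [← hc, ← hd]

theorem problematic_iff {u v : V} (h : u ≠ v) : Problematic C M s(u, v) ↔
    ∃ c : C.ConnectedComponent, IsKite M c ∧ u ∈ c.supp ∧ v ∈ c.supp := by
  simp only [Problematic, mem_inside, ne_eq, h, not_false_eq_true, true_and]

theorem IsRelaxedCycleCover.half_subset (hT : IsRelaxedCycleCover C M T) {u v : V}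
    (h : UsesAt T u v) (h' : ¬ UsesAt T v u) :
    ∃ c : C.ConnectedComponent, IsKite M c ∧ u ∈ c.supp ∧ v ∈ c.supp := by
  rw [← problematic_iff (hT.ne h)]
  by_contra hp
  exact h' (hT.usesAt_symm h hp)

/-- Both bounds on half-edges, 4 and 6, are 2n - 2 for a kite with n vertices. As each vertex
carries two edges or half-edges of the cover, this forces boundary edges in every kite. -/
theorem IsRelaxedCycleCover.even_card (hT : IsRelaxedCycleCover C M T) {c : C.ConnectedComponent}
    (hc : IsKite M c) :
    Even {p : V × V | p.1 ∈ c.supp ∧ p.2 ∈ c.supp ∧ UsesAt T p.1 p.2}.ncard ∧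
      {p : V × V | p.1 ∈ c.supp ∧ p.2 ∈ c.supp ∧ UsesAt T p.1 p.2}.ncard + 2 ≤
        2 * c.supp.ncard := by
  have h : {p : V × V | p.1 ∈ c.supp ∧ p.2 ∈ c.supp ∧ UsesAt T p.1 p.2}.ncard =
      (halfEdgesOf T c).ncard := by
    refine Set.ncard_congr (fun p _ => (p.1, s(p.1, p.2))) ?_ ?_ ?_
    · rintro ⟨u, v⟩ ⟨hu, hv, h⟩
      exact ⟨mem_inside.2 ⟨hT.ne h, hu, hv⟩,
        hT.adj_inr h ((problematic_iff (hT.ne h)).2 ⟨c, hc, hu, hv⟩)⟩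
    · rintro ⟨u, v⟩ ⟨u', v'⟩ - - h
      simp only [Prod.mk.injEq] at h
      obtain ⟨rfl, h⟩ := h
      rw [Sym2.congr_right.1 h]
    · rintro ⟨u, e⟩ ⟨he, h⟩
      obtain ⟨v, hv⟩ := (hT.le h).1
      dsimp only at hv
      subst hv
      obtain ⟨-, hu, hv⟩ := mem_inside.1 he
      exact ⟨(u, v), ⟨hu, hv, Or.inr h⟩, rfl⟩
  rw [h]
  rcases hc with hc | hc
  · obtain ⟨h1, h2⟩ := hT.three_kite c hc
    rw [hc.1]
    exact ⟨h1, by omega⟩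
  · obtain ⟨h1, h2⟩ := hT.four_kite c hc
    rw [hc.1]
    exact ⟨h1, by omega⟩

end Slots

/-! ### The balanced orientation -/

theorem even_card_of_involutive {X : Type*} [Finite X] (α : X → X) (hα : Function.Involutive α)
    (h : ∀ x, α x ≠ x) : Even (Nat.card X) := by
  cases nonempty_fintype X
  have h1 : ∑ _x : X, (1 : ZMod 2) = 0 :=
    Finset.sum_involution (fun x _ => α x) (fun _ _ => by decide) (fun x _ _ => h x)
      (fun x _ => Finset.mem_univ _) fun x _ => hα x
  rwa [Finset.sum_const, Finset.card_univ, nsmul_one, ZMod.natCast_eq_zero_iff_even,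
    ← Nat.card_eq_fintype_card] at h1

section Orientation

variable {V : Type*} {C M : SimpleGraph V} {T : SimpleGraph (V ⊕ Sym2 V)}

/-- The two directions of every edge that is contained as a whole. -/
abbrev Dart (T : SimpleGraph (V ⊕ Sym2 V)) : Type _ :=
  {p : V × V // UsesAt T p.1 p.2 ∧ UsesAt T p.2 p.1}

def Dart.rev (x : Dart T) : Dart T := ⟨x.1.swap, x.2.symm⟩

theorem Dart.rev_rev (x : Dart T) : x.rev.rev = x := rfl

theorem IsRelaxedCycleCover.rev_ne (hT : IsRelaxedCycleCover C M T) (x : Dart T) : x.rev ≠ x := by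
  intro h
  have : x.1.2 = x.1.1 := congrArg (fun y : Dart T => y.1.1) h
  exact hT.ne x.2.1 this.symm

def wholeNbr (T : SimpleGraph (V ⊕ Sym2 V)) (u : V) : Set V := {v | UsesAt T u v ∧ UsesAt T v u}

def halfNbr (T : SimpleGraph (V ⊕ Sym2 V)) (u : V) : Set V := {v | UsesAt T u v ∧ ¬ UsesAt T v u}

theorem IsRelaxedCycleCover.ncard_wholeNbr [Finite V] (hT : IsRelaxedCycleCover C M T) (u : V) :
    (wholeNbr T u).ncard + (halfNbr T u).ncard = 2 := by
  rw [← hT.ncard_usesAt u, ← Set.ncard_union_eq]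
  · congr 1
    ext v
    by_cases h : UsesAt T v u <;> simp [wholeNbr, halfNbr, h]
  · rw [Set.disjoint_left]
    exact fun v h1 h2 => h2.2 h1.2

/-- Outside kites nothing is half used. In a kite the number of half-edges is even and those of
whole edges come in pairs, so the remaining ones are even in number. Each vertex has two edges or
half-edges, so it contributes an odd number to them exactly if one whole edge meets it. -/
theorem IsRelaxedCycleCover.even_deadEnds [Finite V] (hT : IsRelaxedCycleCover C M T)
    (c : C.ConnectedComponent) : Even {u | u ∈ c.supp ∧ (wholeNbr T u).ncard = 1}.ncard := by
  cases nonempty_fintype V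
  rcases Set.eq_empty_or_nonempty {u | u ∈ c.supp ∧ (wholeNbr T u).ncard = 1} with h0 | ⟨u, hu, hu1⟩
  · rw [h0, Set.ncard_empty]
    exact Even.zero
  have hc : IsKite M c := by
    have h1 := hT.ncard_wholeNbr u
    have h2 : (halfNbr T u).ncard ≠ 0 := by omega
    obtain ⟨v, hv⟩ := Set.nonempty_of_ncard_ne_zero h2
    obtain ⟨d, hd, hud, -⟩ := hT.half_subset hv.1 hv.2
    rwa [component_eq hu hud]
  have h1 := (hT.even_card hc).1
  have hw : Even {p : V × V | p.1 ∈ c.supp ∧ p.2 ∈ c.supp ∧ UsesAt T p.1 p.2 ∧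
      UsesAt T p.2 p.1}.ncard := by
    rw [← Nat.card_coe_set_eq]
    refine even_card_of_involutive
      (fun p => ⟨p.1.swap, p.2.2.1, p.2.1, p.2.2.2.2, p.2.2.2.1⟩) (fun p => rfl) fun p hp => ?_
    have : p.1.2 = p.1.1 := congrArg (fun y => y.1.1) hp
    exact hT.ne p.2.2.2.1 this.symm
  have hsplit : {p : V × V | p.1 ∈ c.supp ∧ p.2 ∈ c.supp ∧ UsesAt T p.1 p.2}.ncard =
      {p : V × V | p.1 ∈ c.supp ∧ p.2 ∈ c.supp ∧ UsesAt T p.1 p.2 ∧ UsesAt T p.2 p.1}.ncard +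
      {p : V × V | p.1 ∈ c.supp ∧ UsesAt T p.1 p.2 ∧ ¬ UsesAt T p.2 p.1}.ncard := by
    rw [← Set.ncard_union_eq]
    · congr 1
      ext ⟨a, b⟩
      simp only [Set.mem_union, Set.mem_ofPred_eq]
      constructor
      · tauto
      · rintro (h | ⟨h1, h2, h3⟩)
        · tauto
        · obtain ⟨d, -, had, hbd⟩ := hT.half_subset h2 h3
          rw [← component_eq h1 had] at hbd
          exact ⟨h1, hbd, h2⟩
    · rw [Set.disjoint_left]
      exact fun v h1 h2 => h2.2.2 h1.2.2.2
  rw [hsplit, Nat.even_add] at h1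
  have hh := h1.1 hw
  have hsum : {p : V × V | p.1 ∈ c.supp ∧ UsesAt T p.1 p.2 ∧ ¬ UsesAt T p.2 p.1}.ncard =
      ∑ a ∈ c.supp.toFinset, (halfNbr T a).ncard := by
    rw [Finset.sum_congr rfl fun a _ => Set.ncard_eq_toFinset_card' (halfNbr T a),
      ← Finset.card_sigma, Set.ncard_eq_toFinset_card']
    refine Finset.card_bij (fun p _ => ⟨p.1, p.2⟩) ?_ ?_ ?_
    · rintro ⟨a, b⟩ h
      rw [Set.mem_toFinset] at h
      rw [Finset.mem_sigma, Set.mem_toFinset, Set.mem_toFinset]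
      exact h
    · rintro ⟨a, b⟩ - ⟨a', b'⟩ - h
      simpa using h
    · rintro ⟨a, b⟩ h
      rw [Finset.mem_sigma, Set.mem_toFinset, Set.mem_toFinset] at h
      exact ⟨(a, b), Set.mem_toFinset.2 h, rfl⟩
  rw [hsum, Finset.even_sum_iff_even_card_odd] at hh
  convert hh using 1
  rw [Set.ncard_eq_toFinset_card']
  congr 1
  ext a
  have := hT.ncard_wholeNbr a
  simp only [Set.mem_toFinset, Finset.mem_filter, Set.mem_ofPred_eq]
  refine and_congr_right fun _ => ?_
  rw [Nat.odd_iff]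
  omega

/-- The vertex of the tail if two whole edges meet there, and its component otherwise. -/
noncomputable def Dart.place (C : SimpleGraph V) (x : Dart T) : V ⊕ C.ConnectedComponent :=
  if (wholeNbr T x.1.1).ncard = 2 then .inl x.1.1 else .inr (C.connectedComponentMk x.1.1)

theorem Dart.component_of_place {x y : Dart T} (h : x.place C = y.place C) :
    C.connectedComponentMk x.1.1 = C.connectedComponentMk y.1.1 := by
  unfold Dart.place at h
  split_ifs at h
  · rw [Sum.inl_injective h]
  · exact Sum.inr_injective h

/-- Two darts leave a vertex with two whole edges, and one dart leaves a dead end. -/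
theorem IsRelaxedCycleCover.even_place [Finite V] (hT : IsRelaxedCycleCover C M T)
    (i : V ⊕ C.ConnectedComponent) : Even (Nat.card {x : Dart T // x.place C = i}) := by
  rcases i with u | c
  · by_cases hu : (wholeNbr T u).ncard = 2
    · have : Nat.card {x : Dart T // x.place C = .inl u} = (wholeNbr T u).ncard := by
        rw [← Nat.card_coe_set_eq]
        refine Nat.card_congr ⟨fun x => ⟨x.1.1.2, ?_⟩, fun v => ⟨⟨(u, v), v.2⟩, if_pos hu⟩, ?_, ?_⟩
        · obtain ⟨⟨⟨a, b⟩, hab⟩, hx⟩ := x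
          unfold Dart.place at hx
          split_ifs at hx
          obtain rfl := Sum.inl_injective hx
          exact hab
        · rintro ⟨⟨⟨a, b⟩, hab⟩, hx⟩
          unfold Dart.place at hx
          split_ifs at hx
          obtain rfl := Sum.inl_injective hx
          rfl
        · intro v
          rfl
      rw [this, hu]
      exact even_two
    · have : IsEmpty {x : Dart T // x.place C = .inl u} := by
        refine ⟨fun x => ?_⟩
        obtain ⟨x, hx⟩ := x
        unfold Dart.place at hx
        split_ifs at hx with h
        rw [Sum.inl_injective hx] at h
        exact hu h
      rw [Nat.card_of_isEmpty]
      exact Even.zero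
  · have hplace : ∀ x : Dart T, x.place C = .inr c →
        x.1.1 ∈ c.supp ∧ (wholeNbr T x.1.1).ncard = 1 := by
      intro x hx
      unfold Dart.place at hx
      split_ifs at hx with h
      refine ⟨Sum.inr_injective hx, ?_⟩
      have h1 := hT.ncard_wholeNbr x.1.1
      have h2 : (wholeNbr T x.1.1).ncard ≠ 0 := by
        exact ((Set.ncard_pos (Set.toFinite _)).2 ⟨x.1.2, x.2⟩).ne'
      omega
    convert hT.even_deadEnds c using 1
    rw [← Nat.card_coe_set_eq]
    refine Nat.card_congr (Equiv.ofBijective (fun x => ⟨x.1.1.1, hplace x.1 x.2⟩) ⟨?_, ?_⟩)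
    · rintro ⟨⟨⟨a, b⟩, hab⟩, hx⟩ ⟨⟨⟨a', b'⟩, hab'⟩, hx'⟩ h
      have ha : a = a' := congrArg Subtype.val h
      subst ha
      obtain ⟨w, hw⟩ := Set.ncard_eq_one.1 (hplace _ hx).2
      have hb : b ∈ wholeNbr T a := hab
      have hb' : b' ∈ wholeNbr T a := hab'
      dsimp only at hw
      rw [hw, Set.mem_singleton_iff] at hb hb'
      subst hb hb'
      rfl
    · rintro ⟨u, hu, hu1⟩
      obtain ⟨v, hv⟩ : (wholeNbr T u).Nonempty :=
        Set.nonempty_of_ncard_ne_zero (by omega)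
      refine ⟨⟨⟨(u, v), hv⟩, ?_⟩, rfl⟩
      unfold Dart.place
      rw [if_neg (by dsimp only; omega)]
      exact congrArg _ hu

/-- Darts of colour `true` give the directions. Reversal changes the colour, so each whole edge gets
exactly one direction; the pairing changes it as well, so paths pass straight through vertices and
dead ends of a component balance each other. -/
theorem IsRelaxedCycleCover.exists_orientation [Finite V] (hT : IsRelaxedCycleCover C M T) :
    ∃ D, IsBalancedOrientation C M T D := by
  obtain ⟨β, hβ, hβ', hβp⟩ := exists_pairing (Dart.place (T := T) C) hT.even_place
  obtain ⟨col, hcα, hcβ⟩ := exists_coloring_of_involutive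
    (Function.Involutive.toPerm (Dart.rev (T := T)) Dart.rev_rev) β Dart.rev_rev hβ hT.rev_ne hβ'
  replace hcα : ∀ x : Dart T, col x.rev = !col x := hcα
  have huniq : ∀ x y : Dart T, x.1.1 = y.1.1 → col x = col y → x = y := by
    intro x y hxy hcol
    by_contra hne
    have hpl : x.place C = .inl x.1.1 := by
      unfold Dart.place
      rw [if_pos]
      have h1 := hT.ncard_wholeNbr x.1.1
      have h2 : 1 < (wholeNbr T x.1.1).ncard := by
        rw [Set.one_lt_ncard_iff]
        refine ⟨x.1.2, y.1.2, x.2, hxy ▸ y.2, fun h => hne (Subtype.ext (Prod.ext hxy h))⟩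
      omega
    have hcard : (wholeNbr T x.1.1).ncard = 2 := by
      by_contra h
      unfold Dart.place at hpl
      rw [if_neg h] at hpl
      cases hpl
    have hz : (β x).1.1 = x.1.1 := by
      have h1 := hβp x
      rw [hpl] at h1
      unfold Dart.place at h1
      split_ifs at h1
      exact Sum.inl_injective h1
    -- Only two darts leave the vertex, so `y` would have to be `β x`, which has the other colour.
    have h3 : ({x.1.2, y.1.2, (β x).1.2} : Set V).ncard ≤ 2 := by
      rw [← hcard]
      refine Set.ncard_le_ncard ?_
      rintro v (rfl | rfl | rfl)
      · exact x.2
      · exact hxy ▸ y.2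
      · exact hz ▸ (β x).2
    rw [Set.ncard_eq_three.2 ⟨_, _, _, fun h => hne (Subtype.ext (Prod.ext hxy h)),
      fun h => hβ' x (Subtype.ext (Prod.ext hz h.symm)), fun h => ?_, rfl⟩] at h3
    · omega
    · have h4 : y = β x := Subtype.ext (Prod.ext (hxy.symm.trans hz.symm) h)
      have h5 := hcβ x
      rw [← h4, hcol] at h5
      cases h6 : col y <;> simp [h6] at h5
  refine ⟨fun u v => ∃ h, col ⟨(u, v), h⟩ = true, ?_, ?_, ?_, ?_, ?_⟩
  · intro u v
    rw [mem_wholeEdges]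
    constructor
    · intro h
      cases hc : col ⟨(u, v), h⟩
      · right
        refine ⟨h.symm, ?_⟩
        have := hcα ⟨(u, v), h⟩
        rw [hc] at this
        exact this
      · exact Or.inl ⟨h, hc⟩
    · rintro (⟨h, -⟩ | ⟨h, -⟩)
      · exact h
      · exact h.symm
  · rintro u v ⟨h, hc⟩ ⟨h', hc'⟩
    have := hcα ⟨(u, v), h⟩
    rw [hc] at this
    exact Bool.false_ne_true (this.symm.trans hc')
  · rintro u v w ⟨h, hc⟩ ⟨h', hc'⟩
    have := huniq ⟨(u, v), h⟩ ⟨(u, w), h'⟩ rfl (hc.trans hc'.symm)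
    exact congrArg (fun x : Dart T => x.1.2) this
  · rintro u v w ⟨h, hc⟩ ⟨h', hc'⟩
    have h1 := hcα ⟨(v, u), h⟩
    have h2 := hcα ⟨(w, u), h'⟩
    rw [hc] at h1
    rw [hc'] at h2
    have := huniq (Dart.rev ⟨(v, u), h⟩) (Dart.rev ⟨(w, u), h'⟩) rfl (h1.trans h2.symm)
    exact congrArg (fun x : Dart T => x.1.2) this
  · intro c hc
    let S : Bool → Set (Dart T) := fun i => {x | x.1.1 ∈ c.supp ∧ col x = i}
    let S₁ : Bool → Set (Dart T) := fun i => {x | x.1.1 ∈ c.supp ∧ x.1.2 ∈ c.supp ∧ col x = i}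
    let S₂ : Bool → Set (Dart T) := fun i => {x | x.1.1 ∈ c.supp ∧ x.1.2 ∉ c.supp ∧ col x = i}
    -- The pairing flips colours among all darts leaving vertices of the kite, and reversal flips
    -- them among the darts within the kite. The difference counts outgoing and incoming boundary
    -- edges.
    have hS : (S true).ncard = (S false).ncard := by
      have hsupp : ∀ x : Dart T, (β x).1.1 ∈ c.supp ↔ x.1.1 ∈ c.supp := fun x => by
        rw [SimpleGraph.ConnectedComponent.mem_supp_iff,
          SimpleGraph.ConnectedComponent.mem_supp_iff, Dart.component_of_place (hβp x)]
      refine Set.ncard_congr (fun x _ => β x) ?_ ?_ ?_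
      · rintro x ⟨h1, h2⟩
        exact ⟨(hsupp x).2 h1, by rw [hcβ, h2]; rfl⟩
      · intro x y _ _ h
        exact β.injective h
      · rintro x ⟨h1, h2⟩
        exact ⟨β x, ⟨(hsupp x).2 h1, by rw [hcβ, h2]; rfl⟩, hβ x⟩
    have hS₁ : (S₁ true).ncard = (S₁ false).ncard := by
      refine Set.ncard_congr (fun x _ => x.rev) ?_ ?_ ?_
      · rintro x ⟨h1, h2, h3⟩
        exact ⟨h2, h1, by rw [hcα, h3]; rfl⟩
      · intro x y _ _ h
        rw [← Dart.rev_rev x, h, Dart.rev_rev]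
      · rintro x ⟨h1, h2, h3⟩
        exact ⟨x.rev, ⟨h2, h1, by rw [hcα, h3]; rfl⟩, rfl⟩
    have hsplit : ∀ i, (S i).ncard = (S₁ i).ncard + (S₂ i).ncard := by
      intro i
      rw [← Set.ncard_union_eq]
      · congr 1
        ext x
        simp only [S, S₁, S₂, Set.mem_union, Set.mem_ofPred_eq]
        tauto
      · rw [Set.disjoint_left]
        exact fun x h1 h2 => h2.2.1 h1.2.1
    have hS₂ : (S₂ true).ncard = (S₂ false).ncard := by
      have h1 := hsplit true
      have h2 := hsplit false
      omega
    have hout : {p : V × V | p.1 ∈ c.supp ∧ p.2 ∉ c.supp ∧ ∃ h, col ⟨(p.1, p.2), h⟩ = true}.ncard =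
        (S₂ true).ncard := by
      symm
      refine Set.ncard_congr (fun x _ => x.1) ?_ ?_ ?_
      · rintro ⟨⟨u, v⟩, h⟩ ⟨h1, h2, h3⟩
        exact ⟨h1, h2, h, h3⟩
      · intro x y _ _ h
        exact Subtype.ext h
      · rintro ⟨u, v⟩ ⟨h1, h2, h3, h4⟩
        exact ⟨⟨(u, v), h3⟩, ⟨h1, h2, h4⟩, rfl⟩
    have hin : {p : V × V | p.1 ∉ c.supp ∧ p.2 ∈ c.supp ∧ ∃ h, col ⟨(p.1, p.2), h⟩ = true}.ncard =
        (S₂ false).ncard := by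
      symm
      refine Set.ncard_congr (fun x _ => x.rev.1) ?_ ?_ ?_
      · rintro ⟨⟨u, v⟩, h⟩ ⟨h1, h2, h3⟩
        refine ⟨h2, h1, h.symm, ?_⟩
        have := hcα ⟨(u, v), h⟩
        rw [h3] at this
        exact this
      · intro x y _ _ h
        have h' : x.rev = y.rev := Subtype.ext h
        rw [← Dart.rev_rev x, h', Dart.rev_rev]
      · rintro ⟨u, v⟩ ⟨h1, h2, h3, h4⟩
        refine ⟨⟨(v, u), h3.symm⟩, ⟨h2, h1, ?_⟩, rfl⟩
        have := hcα ⟨(u, v), h3⟩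
        rw [h4] at this
        exact this
    rw [hout, hin, hS₂]

end Orientation

/-! ### Decomposing a directed edge set into paths and cycles -/

theorem consecutive_of_getElem? {α : Type*} {l : List α} {k : ℕ} {a b : α} (ha : l[k]? = some a)
    (hb : l[k + 1]? = some b) : Consecutive l a b := by
  left
  induction l generalizing k with
  | nil => simp at ha
  | cons x l ih =>
    cases k with
    | zero =>
      cases l with
      | nil => simp at hb
      | cons y l =>
        simp only [List.getElem?_cons_zero, List.getElem?_cons_succ, Option.some.injEq, zero_add]
          at ha hb
        subst ha hb
        exact (List.prefix_append [x, y] l).isInfix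
    | succ k => exact (ih (by simpa using ha) (by simpa using hb)).trans (List.suffix_cons x l).isInfix

theorem Consecutive.symm {α : Type*} {l : List α} {a b : α} (h : Consecutive l a b) :
    Consecutive l b a := Or.symm h

theorem Consecutive.append_right {α : Type*} {l : List α} {a b : α} (h : Consecutive l a b)
    (m : List α) : Consecutive (l ++ m) a b :=
  h.imp (fun h => h.trans (List.prefix_append l m).isInfix)
    fun h => h.trans (List.prefix_append l m).isInfix

theorem Consecutive.append_left {α : Type*} {l : List α} {a b : α} (h : Consecutive l a b)
    (m : List α) : Consecutive (m ++ l) a b :=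
  h.imp (fun h => h.trans (List.suffix_append m l).isInfix)
    fun h => h.trans (List.suffix_append m l).isInfix

theorem Consecutive.reverse {α : Type*} {l : List α} {a b : α} (h : Consecutive l a b) :
    Consecutive l.reverse a b :=
  h.symm.imp (fun ⟨s, t, h⟩ => ⟨t.reverse, s.reverse, by simp [← h]⟩)
    fun ⟨s, t, h⟩ => ⟨t.reverse, s.reverse, by simp [← h]⟩

section Walk

variable {V : Type*} {G : SimpleGraph V}

/-- The walk through the vertices `g 0, …, g n`. -/
def walkOf (g : ℕ → V) : (n : ℕ) → (∀ k < n, G.Adj (g k) (g (k + 1))) → G.Walk (g 0) (g n)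
  | 0, _ => .nil
  | n + 1, h => (walkOf g n fun k hk => h k (hk.trans n.lt_succ_self)).concat (h n n.lt_succ_self)

theorem support_walkOf (g : ℕ → V) : ∀ (n : ℕ) (h : ∀ k < n, G.Adj (g k) (g (k + 1))),
    (walkOf g n h).support = (List.range (n + 1)).map g
  | 0, _ => rfl
  | n + 1, h => by
    rw [walkOf, SimpleGraph.Walk.support_concat, support_walkOf g n, List.range_succ (n := n + 1)]
    simp

theorem edges_walkOf (g : ℕ → V) : ∀ (n : ℕ) (h : ∀ k < n, G.Adj (g k) (g (k + 1))),
    (walkOf g n h).edges = (List.range n).map fun k => s(g k, g (k + 1))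
  | 0, _ => rfl
  | n + 1, h => by
    rw [walkOf, SimpleGraph.Walk.edges_concat, edges_walkOf g n, List.range_succ (n := n)]
    simp

end Walk

/-- A set `A` of arcs, at most one of which leaves each vertex, together with a subset `S` of
arcs at whose heads the trails stop. -/
structure IsTrailSystem {V : Type*} (A S : V → V → Prop) : Prop where
  asymm : ∀ u v, A u v → ¬ A v u
  out_unique : ∀ u v w, A u v → A u w → v = w
  sub : ∀ u v, S u v → A u v
  main_unique : ∀ u v w, A u v → ¬ S u v → A w v → ¬ S w v → u = w
  stop_unique : ∀ u v w, S u v → S w v → u = w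
  -- Consequently a vertex without a main incoming arc has no incoming arc at all, and is the
  -- beginning of a trail if an arc leaves it.
  stop_main : ∀ u v, S u v → ∃ w, A w v ∧ ¬ S w v

namespace IsTrailSystem

variable {V : Type*} {A S : V → V → Prop}

/-- The head of the arc that leaves `v`. -/
noncomputable def next (A : V → V → Prop) (v : V) : V := if h : ∃ u, A v u then h.choose else v

theorem next_eq (h : IsTrailSystem A S) {u v : V} (huv : A u v) : next A u = v := by
  have hex : ∃ v, A u v := ⟨v, huv⟩
  rw [next, dif_pos hex]
  exact h.out_unique _ _ _ hex.choose_spec huv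

/-- The trail through the arc that leaves `v` continues after this arc. -/
def Continues (A S : V → V → Prop) (v : V) : Prop :=
  A v (next A v) ∧ ¬ S v (next A v) ∧ A (next A v) (next A (next A v))

def IsStart (A : V → V → Prop) (v : V) : Prop := A v (next A v) ∧ ∀ u, ¬ A u v

theorem continues_inj (h : IsTrailSystem A S) {u v : V} (hu : Continues A S u)
    (hv : Continues A S v) (huv : next A u = next A v) : u = v :=
  h.main_unique _ (next A v) _ (huv ▸ hu.1) (huv ▸ hu.2.1) hv.1 hv.2.1

/-- Main arcs determine their predecessors, so trails that share a vertex can be followed back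
together until one of them reaches its beginning, which no arc enters. -/
theorem iterate_inj (h : IsTrailSystem A S) {w w' : V} (hw : IsStart A w) (hw' : IsStart A w')
    {i j : ℕ} (hi : ∀ k < i, Continues A S ((next A)^[k] w))
    (hj : ∀ k < j, Continues A S ((next A)^[k] w'))
    (heq : (next A)^[i] w = (next A)^[j] w') : i = j ∧ w = w' := by
  induction i generalizing j with
  | zero =>
    cases j with
    | zero => exact ⟨rfl, heq⟩
    | succ j =>
      have h1 := (hj j j.lt_succ_self).1
      rw [Function.iterate_succ_apply'] at heq
      rw [← heq] at h1
      exact absurd h1 (hw.2 _)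
  | succ i ih =>
    cases j with
    | zero =>
      have h1 := (hi i i.lt_succ_self).1
      rw [Function.iterate_succ_apply'] at heq
      rw [heq] at h1
      exact absurd h1 (hw'.2 _)
    | succ j =>
      rw [Function.iterate_succ_apply', Function.iterate_succ_apply'] at heq
      have h1 := h.continues_inj (hi i i.lt_succ_self) (hj j j.lt_succ_self) heq
      obtain ⟨h2, h3⟩ := ih (fun k hk => hi k (hk.trans i.lt_succ_self))
        (fun k hk => hj k (hk.trans j.lt_succ_self)) h1
      exact ⟨congrArg _ h2, h3⟩

theorem exists_not_continues [Finite V] (h : IsTrailSystem A S) {w : V} (hw : IsStart A w) :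
    ∃ k, ¬ Continues A S ((next A)^[k] w) := by
  by_contra hc
  push Not at hc
  exact not_injective_infinite_finite (fun k => (next A)^[k] w) fun i j hij =>
    (h.iterate_inj hw hw (fun k _ => hc k) (fun k _ => hc k) hij).1

/-- The trail that begins at `w` has `len w + 1` arcs. -/
noncomputable def len (A S : V → V → Prop) (w : V) : ℕ :=
  if h : ∃ k, ¬ Continues A S ((next A)^[k] w) then Nat.find h else 0

theorem continues_of_lt {w : V} {k : ℕ} (hk : k < len A S w) :
    Continues A S ((next A)^[k] w) := by
  unfold len at hk
  split_ifs at hk with h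
  · exact not_not.1 (Nat.find_min h hk)
  · exact absurd hk k.not_lt_zero

theorem not_continues_len [Finite V] (h : IsTrailSystem A S) {w : V} (hw : IsStart A w) :
    ¬ Continues A S ((next A)^[len A S w] w) := by
  have h1 := h.exists_not_continues hw
  unfold len
  rw [dif_pos h1]
  exact Nat.find_spec h1

theorem le_len [Finite V] (h : IsTrailSystem A S) {w : V} (hw : IsStart A w) {k : ℕ}
    (hk : ∀ j < k, Continues A S ((next A)^[j] w)) : k ≤ len A S w := by
  by_contra hlt
  exact h.not_continues_len hw (hk _ (not_le.1 hlt))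

theorem arc_of_le {w : V} (hw : IsStart A w) {k : ℕ} (hk : k ≤ len A S w) :
    A ((next A)^[k] w) ((next A)^[k + 1] w) := by
  rw [Function.iterate_succ_apply']
  cases k with
  | zero => exact hw.1
  | succ k =>
    have := (continues_of_lt (S := S) hk).2.2
    rwa [Function.iterate_succ_apply']

theorem tail_inj (h : IsTrailSystem A S) {w w' : V} (hw : IsStart A w) (hw' : IsStart A w')
    {i j : ℕ} (hi : i ≤ len A S w) (hj : j ≤ len A S w')
    (heq : (next A)^[i] w = (next A)^[j] w') : i = j ∧ w = w' :=
  h.iterate_inj hw hw' (fun _ hk => continues_of_lt (hk.trans_le hi))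
    (fun _ hk => continues_of_lt (hk.trans_le hj)) heq

/-- The last tail of the trail that begins at `w`. -/
noncomputable def lastTail (A S : V → V → Prop) (w : V) : V := (next A)^[len A S w] w

/-- The last vertex of the trail that begins at `w`. -/
noncomputable def last (A S : V → V → Prop) (w : V) : V := (next A)^[len A S w + 1] w

theorem arc_last {w : V} (hw : IsStart A w) : A (lastTail A S w) (last A S w) :=
  arc_of_le hw le_rfl

theorem lastTail_inj (h : IsTrailSystem A S) {w w' : V} (hw : IsStart A w) (hw' : IsStart A w')
    (heq : lastTail A S w = lastTail A S w') : w = w' :=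
  (h.tail_inj hw hw' le_rfl le_rfl heq).2

theorem stop_or_sink [Finite V] (h : IsTrailSystem A S) {w : V} (hw : IsStart A w) :
    S (lastTail A S w) (last A S w) ∨ ∀ u, ¬ A (last A S w) u := by
  by_contra hc
  push Not at hc
  obtain ⟨h1, u, hu⟩ := hc
  have h2 : next A (lastTail A S w) = last A S w := h.next_eq (arc_last hw)
  refine h.not_continues_len hw ⟨?_, ?_, ?_⟩
  · exact h2 ▸ arc_last hw
  · exact fun h3 => h1 (h2 ▸ h3)
  · change A (next A (lastTail A S w)) (next A (next A (lastTail A S w)))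
    rw [h2, h.next_eq hu]
    exact hu

/-- The tails of the arcs that lie on no trail with a beginning. -/
def IsRecurrent (A S : V → V → Prop) (v : V) : Prop :=
  A v (next A v) ∧ ∀ w k, IsStart A w → (∀ j < k, Continues A S ((next A)^[j] w)) →
    (next A)^[k] w ≠ v

/-- Without a main arc into `v` there would be no arc into `v`, and `v` itself would be a beginning.
A trail from a beginning that reached the predecessor would go on to `v`. -/
theorem IsRecurrent.exists_prev (h : IsTrailSystem A S) {v : V} (hv : IsRecurrent A S v) :
    ∃ u, IsRecurrent A S u ∧ Continues A S u ∧ next A u = v := by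
  obtain ⟨u, hu, hu'⟩ : ∃ u, A u v ∧ ¬ S u v := by
    by_contra hc
    push Not at hc
    refine hv.2 v 0 ⟨hv.1, fun u hu => ?_⟩ (fun j hj => absurd hj j.not_lt_zero) rfl
    obtain ⟨w, hw, hw'⟩ := h.stop_main u v (hc u hu)
    exact hw' (hc w hw)
  have hn := h.next_eq hu
  have hc : Continues A S u := by
    refine ⟨?_, ?_, ?_⟩ <;> rw [hn]
    · exact hu
    · exact hu'
    · exact hv.1
  refine ⟨u, ⟨hc.1, fun w k hw hk hwu => ?_⟩, hc, hn⟩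
  refine hv.2 w (k + 1) hw (fun j hj => ?_) ?_
  · rcases (Nat.lt_succ_iff.1 hj).lt_or_eq with hj | rfl
    · exact hk j hj
    · rwa [hwu]
  · rw [Function.iterate_succ_apply', hwu, hn]

/-- The choice of a recurrent predecessor is injective, hence surjective by finiteness; so every
recurrent vertex is such a predecessor and its trail continues. -/
theorem IsRecurrent.next [Finite V] (h : IsTrailSystem A S) {v : V} (hv : IsRecurrent A S v) :
    IsRecurrent A S (next A v) ∧ Continues A S v := by
  have hex : ∀ v : {v // IsRecurrent A S v}, ∃ u : {v // IsRecurrent A S v},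
      Continues A S u.1 ∧ IsTrailSystem.next A u.1 = v.1 := by
    rintro ⟨v, hv⟩
    obtain ⟨u, hu, h1, h2⟩ := hv.exists_prev h
    exact ⟨⟨u, hu⟩, h1, h2⟩
  choose g hg hg' using hex
  have hinj : Function.Injective g := fun x y hxy => Subtype.ext (by rw [← hg', hxy, hg'])
  obtain ⟨y, hy⟩ := Finite.surjective_of_injective hinj ⟨v, hv⟩
  have h1 := hg y
  have h2 := hg' y
  rw [hy] at h1 h2
  exact ⟨h2 ▸ y.2, h1⟩

theorem IsRecurrent.iterate [Finite V] (h : IsTrailSystem A S) {v : V} (hv : IsRecurrent A S v)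
    (k : ℕ) : IsRecurrent A S ((IsTrailSystem.next A)^[k] v) := by
  induction k with
  | zero => exact hv
  | succ k ih =>
    rw [Function.iterate_succ_apply']
    exact (ih.next h).1

theorem IsRecurrent.mem_periodicPts [Finite V] (h : IsTrailSystem A S) {v : V}
    (hv : IsRecurrent A S v) : v ∈ Function.periodicPts (IsTrailSystem.next A) := by
  let F : {v // IsRecurrent A S v} → {v // IsRecurrent A S v} := fun x => ⟨_, (x.2.next h).1⟩
  have hF : Function.Injective F := fun x y hxy =>
    Subtype.ext (h.continues_inj (x.2.next h).2 (y.2.next h).2 (congrArg Subtype.val hxy))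
  obtain ⟨n, hn, hn'⟩ := hF.mem_periodicPts ⟨v, hv⟩
  refine ⟨n, hn, ?_⟩
  have key : ∀ k, (F^[k] ⟨v, hv⟩).1 = (IsTrailSystem.next A)^[k] v := by
    intro k
    induction k with
    | zero => rfl
    | succ k ih =>
      rw [Function.iterate_succ_apply', Function.iterate_succ_apply', ← ih]
  have h1 := key n
  rw [hn'.eq] at h1
  exact h1.symm

end IsTrailSystem

/-! ### Paths formed by trails with a beginning -/

namespace IsTrailSystem

variable {V : Type*} {A S : V → V → Prop} {G : SimpleGraph V}

/-- The edge underlying the arc that leaves `u`. -/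
noncomputable def arc (A : V → V → Prop) (u : V) : Sym2 V := s(u, next A u)

theorem arc_inj (h : IsTrailSystem A S) {u v : V} (hu : A u (next A u)) (hv : A v (next A v))
    (huv : arc A u = arc A v) : u = v := by
  rcases Sym2.eq_iff.1 huv with ⟨h1, -⟩ | ⟨h1, h2⟩
  · exact h1
  · rw [h2, h1] at hu
    exact absurd hu (h.asymm _ _ hv)

/-- The tails of the arcs of the trail that begins at `w`. -/
noncomputable def tails (A S : V → V → Prop) (w : V) : List V :=
  (List.range (len A S w + 1)).map fun k => (next A)^[k] w

theorem mem_tails {w u : V} : u ∈ tails A S w ↔ ∃ k ≤ len A S w, (next A)^[k] w = u := by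
  simp only [tails, List.mem_map, List.mem_range, Nat.lt_succ_iff]

theorem arc_of_mem_tails {w u : V} (hw : IsStart A w) (hu : u ∈ tails A S w) :
    A u (next A u) := by
  obtain ⟨k, hk, rfl⟩ := mem_tails.1 hu
  have := arc_of_le (S := S) hw hk
  rwa [Function.iterate_succ_apply'] at this

theorem nodup_tails (h : IsTrailSystem A S) {w : V} (hw : IsStart A w) : (tails A S w).Nodup := by
  rw [tails, List.nodup_map_iff_inj_on List.nodup_range]
  intro i hi j hj hij
  rw [List.mem_range, Nat.lt_succ_iff] at hi hj
  exact (h.tail_inj hw hw hi hj hij).1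

theorem start_unique (h : IsTrailSystem A S) {w w' u : V} (hw : IsStart A w) (hw' : IsStart A w')
    (hu : u ∈ tails A S w) (hu' : u ∈ tails A S w') : w = w' := by
  obtain ⟨i, hi, rfl⟩ := mem_tails.1 hu
  obtain ⟨j, hj, hij⟩ := mem_tails.1 hu'
  exact (h.tail_inj hw hw' hi hj hij.symm).2

theorem tails_getElem? {w : V} {k : ℕ} (hk : k ≤ len A S w) :
    (tails A S w)[k]? = some ((next A)^[k] w) := by
  rw [tails, List.getElem?_map, List.getElem?_range (Nat.lt_succ_of_le hk)]
  rfl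

theorem length_tails {w : V} : (tails A S w).length = len A S w + 1 := by simp [tails]

noncomputable def trail (S : V → V → Prop) (hG : ∀ u v, A u v → G.Adj u v) {w : V}
    (hw : IsStart A w) : G.Walk w (last A S w) :=
  walkOf (fun k => (next A)^[k] w) (len A S w + 1) fun _ hk =>
    hG _ _ (arc_of_le hw (Nat.lt_succ_iff.1 hk))

variable (hG : ∀ u v, A u v → G.Adj u v)

theorem edges_trail {w : V} (hw : IsStart A w) :
    (trail S hG hw).edges = (tails A S w).map (arc A) := by
  refine (edges_walkOf _ _ _).trans ?_
  rw [tails, List.map_map]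
  refine List.map_congr_left fun k _ => ?_
  rw [Function.iterate_succ_apply']
  rfl

theorem support_trail {w : V} (hw : IsStart A w) :
    (trail S hG hw).support = tails A S w ++ [last A S w] := by
  refine (support_walkOf _ _ _).trans ?_
  rw [List.range_succ, List.map_append, tails]
  rfl

/-- Two trails that end at the same vertex, as one walk. -/
noncomputable def merged (S : V → V → Prop) {w₁ w₂ : V} (h₁ : IsStart A w₁) (h₂ : IsStart A w₂)
    (h : last A S w₂ = last A S w₁) : G.Walk w₁ w₂ :=
  (trail S hG h₁).append ((trail S hG h₂).copy rfl h).reverse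

theorem edges_merged {w₁ w₂ : V} (h₁ : IsStart A w₁) (h₂ : IsStart A w₂)
    (h : last A S w₂ = last A S w₁) :
    (merged hG S h₁ h₂ h).edges = (tails A S w₁).map (arc A) ++ (tails A S w₂).reverse.map (arc A) := by
  rw [merged, SimpleGraph.Walk.edges_append, SimpleGraph.Walk.edges_reverse,
    SimpleGraph.Walk.edges_copy, edges_trail, edges_trail, List.map_reverse]

theorem support_merged {w₁ w₂ : V} (h₁ : IsStart A w₁) (h₂ : IsStart A w₂)
    (h : last A S w₂ = last A S w₁) :
    (merged hG S h₁ h₂ h).support =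
      tails A S w₁ ++ last A S w₁ :: (tails A S w₂).reverse := by
  rw [merged, SimpleGraph.Walk.support_append, SimpleGraph.Walk.support_reverse,
    SimpleGraph.Walk.support_copy, support_trail, support_trail]
  simp

/-- Two trails meet at a vertex that no arc leaves. -/
def IsMeeting (A S : V → V → Prop) (v : V) : Prop := (∀ u, ¬ A v u) ∧ ∃ t, S t v

/-- The paths formed by the trails that have a beginning. -/
def paths (S : V → V → Prop) : Set (Σ u v, G.Walk u v) :=
  {p | (∃ (w : V) (hw : IsStart A w), ¬ IsMeeting A S (last A S w) ∧
      p = ⟨w, last A S w, trail S hG hw⟩) ∨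
    -- The first trail enters the sink by the main arc and the second one by the stopping arc, so a
    -- glued pair is listed in one order only.
    ∃ (w₁ w₂ : V) (h₁ : IsStart A w₁) (h₂ : IsStart A w₂) (h : last A S w₂ = last A S w₁),
      (∀ u, ¬ A (last A S w₁) u) ∧ ¬ S (lastTail A S w₁) (last A S w₁) ∧
      S (lastTail A S w₂) (last A S w₂) ∧ p = ⟨w₁, w₂, merged hG S h₁ h₂ h⟩}

theorem mem_edges_of_mem_paths {p : Σ u v, G.Walk u v} (hp : p ∈ paths hG S) {e : Sym2 V}
    (he : e ∈ p.2.2.edges) :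
    ∃ w u, IsStart A w ∧ (w = p.1 ∨ w = p.2.1) ∧ u ∈ tails A S w ∧ e = arc A u := by
  obtain ⟨w, hw, -, rfl⟩ | ⟨w₁, w₂, h₁, h₂, h, -, -, -, rfl⟩ := hp
  · rw [edges_trail, List.mem_map] at he
    obtain ⟨u, hu, rfl⟩ := he
    exact ⟨w, u, hw, Or.inl rfl, hu, rfl⟩
  · rw [edges_merged, List.mem_append, List.mem_map, List.mem_map] at he
    obtain ⟨u, hu, rfl⟩ | ⟨u, hu, rfl⟩ := he
    · exact ⟨w₁, u, h₁, Or.inl rfl, hu, rfl⟩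
    · exact ⟨w₂, u, h₂, Or.inr rfl, List.mem_reverse.1 hu, rfl⟩

/-- Whether the trail from `w` is glued, and to which partner, is determined by its last arc.
Disjointness and maximality of the paths rest on this. -/
theorem eq_of_shared_start (h : IsTrailSystem A S) {p q : Σ u v, G.Walk u v}
    (hp : p ∈ paths hG S) (hq : q ∈ paths hG S) {w : V} (hw : IsStart A w)
    (hwp : w = p.1 ∨ w = p.2.1) (hwq : w = q.1 ∨ w = q.2.1) : p = q := by
  have hlast : ∀ w' : V, IsStart A w' → w ≠ last A S w' := by
    rintro w' hw' rfl
    exact hw.2 _ (arc_last hw')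
  obtain ⟨w', hw', hm, rfl⟩ | ⟨w₁, w₂, h₁, h₂, h12, hout, hS₁, hS₂, rfl⟩ := hp
  · obtain rfl := hwp.resolve_right (hlast _ hw')
    obtain ⟨w', hw'', hm', rfl⟩ | ⟨v₁, v₂, k₁, k₂, k12, kout, kS₁, kS₂, rfl⟩ := hq
    · obtain rfl := hwq.resolve_right (hlast _ hw'')
      rfl
    · rcases hwq with rfl | rfl
      · exact absurd ⟨kout, _, k12 ▸ kS₂⟩ hm
      · exact absurd ⟨k12 ▸ kout, _, kS₂⟩ hm
  · obtain ⟨w', hw'', hm', rfl⟩ | ⟨v₁, v₂, k₁, k₂, k12, kout, kS₁, kS₂, rfl⟩ := hq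
    · obtain rfl := hwq.resolve_right (hlast _ hw'')
      rcases hwp with rfl | rfl
      · exact absurd ⟨hout, _, h12 ▸ hS₂⟩ hm'
      · exact absurd ⟨h12 ▸ hout, _, hS₂⟩ hm'
    · have hl : last A S w₁ = last A S v₁ := by
        rcases hwp with rfl | rfl
        · rcases hwq with rfl | rfl
          · rfl
          · exact k12
        · rcases hwq with rfl | rfl
          · exact h12.symm
          · exact h12.symm.trans k12
      have e₁ : w₁ = v₁ := h.lastTail_inj h₁ k₁
        (h.main_unique _ (last A S v₁) _ (hl ▸ arc_last h₁) (hl ▸ hS₁) (arc_last k₁) kS₁)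
      have e₂ : w₂ = v₂ := h.lastTail_inj h₂ k₂
        (h.stop_unique _ (last A S v₂) _ (by rw [k12, ← hl, ← h12]; exact hS₂) kS₂)
      subst e₁ e₂
      rfl

/-- Trails through recurrent vertices continue forever, so an arc into a sink lies on a trail with a
beginning and is its last arc. -/
theorem exists_start_of_not_continues [Finite V] (h : IsTrailSystem A S) {t v : V} (ht : A t v)
    (hout : ∀ u, ¬ A v u) : ∃ w, IsStart A w ∧ lastTail A S w = t ∧ last A S w = v := by
  have hn := h.next_eq ht
  have hc : ¬ Continues A S t := fun hc => by
    have := hc.2.2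
    rw [hn] at this
    exact hout _ this
  have hr : ¬ IsRecurrent A S t := fun hr => hc (hr.next h).2
  have hA : A t (next A t) := hn.symm ▸ ht
  unfold IsRecurrent at hr
  push Not at hr
  obtain ⟨w, k, hw, hk, rfl⟩ := hr hA
  have hlen : k = len A S w := by
    refine (h.le_len hw hk).antisymm (not_lt.1 fun hlt => hc (continues_of_lt hlt))
  subst hlen
  refine ⟨w, hw, rfl, ?_⟩
  rw [last, Function.iterate_succ_apply', hn]

theorem exists_meeting [Finite V] (h : IsTrailSystem A S) {w t : V} (hw : IsStart A w)
    (hout : ∀ u, ¬ A (last A S w) u) (ht : S t (last A S w)) :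
    ∃ (w₁ w₂ : V), IsStart A w₁ ∧ IsStart A w₂ ∧ last A S w₂ = last A S w₁ ∧
      ¬ S (lastTail A S w₁) (last A S w₁) ∧ S (lastTail A S w₂) (last A S w₂) ∧
      (w = w₁ ∨ w = w₂) := by
  obtain ⟨s, hs, hs'⟩ := h.stop_main _ _ ht
  obtain ⟨w₁, h₁, ht₁, hl₁⟩ := h.exists_start_of_not_continues hs hout
  obtain ⟨w₂, h₂, ht₂, hl₂⟩ := h.exists_start_of_not_continues (h.sub _ _ ht) hout
  refine ⟨w₁, w₂, h₁, h₂, hl₂.trans hl₁.symm, by rwa [ht₁, hl₁], by rwa [ht₂, hl₂], ?_⟩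
  by_cases hS : S (lastTail A S w) (last A S w)
  · right
    refine h.lastTail_inj hw h₂ ?_
    rw [ht₂]
    exact h.stop_unique _ _ _ hS ht
  · left
    refine h.lastTail_inj hw h₁ ?_
    rw [ht₁]
    exact h.main_unique _ _ _ (arc_last hw) hS hs hs'

/-- Interior vertices are distinct tails of arcs, together with the sink in the case of glued
trails, which is no tail. Only the vertex at which a trail stops can reappear, and this is permitted
for an end. The beginning differs from a last vertex because no arc enters it. -/
theorem isPathPiece_of_mem_paths [Finite V] (h : IsTrailSystem A S) {p : Σ u v, G.Walk u v}
    (hp : p ∈ paths hG S) : IsPathPiece p.2.2 := by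
  obtain ⟨w, hw, -, rfl⟩ | ⟨w₁, w₂, h₁, h₂, h12, hout, hS₁, hS₂, rfl⟩ := hp
  · refine ⟨?_, ⟨?_⟩, ?_⟩
    · intro heq
      dsimp only at heq
      refine hw.2 (lastTail A S w) ?_
      have := arc_last (S := S) hw
      rwa [← heq] at this
    · rw [edges_trail, List.nodup_map_iff_inj_on (h.nodup_tails hw)]
      exact fun u hu v hv huv => h.arc_inj (arc_of_mem_tails hw hu) (arc_of_mem_tails hw hv) huv
    · rw [support_trail, ← List.tail_dropLast, List.dropLast_concat]
      exact (h.nodup_tails hw).sublist (List.tail_sublist _)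
  · have hne : w₁ ≠ w₂ := by
      rintro rfl
      exact hS₁ hS₂
    have hd : (tails A S w₁).Disjoint (tails A S w₂) := fun u hu hu' =>
      hne (h.start_unique h₁ h₂ hu hu')
    refine ⟨hne, ⟨?_⟩, ?_⟩
    · rw [edges_merged, ← List.map_append, List.nodup_map_iff_inj_on]
      · have hA : ∀ u ∈ tails A S w₁ ++ (tails A S w₂).reverse, A u (next A u) := by
          intro u hu
          rw [List.mem_append, List.mem_reverse] at hu
          rcases hu with hu | hu
          · exact arc_of_mem_tails h₁ hu
          · exact arc_of_mem_tails h₂ hu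
        exact fun u hu v hv huv => h.arc_inj (hA u hu) (hA v hv) huv
      · rw [List.nodup_append']
        exact ⟨h.nodup_tails h₁, List.nodup_reverse.2 (h.nodup_tails h₂), fun u hu hu' =>
          hd hu (List.mem_reverse.1 hu')⟩
    · rw [support_merged]
      refine List.Nodup.sublist ((List.dropLast_sublist _).trans (List.tail_sublist _)) ?_
      rw [List.nodup_append', List.nodup_cons]
      refine ⟨h.nodup_tails h₁, ⟨fun hm => ?_, List.nodup_reverse.2 (h.nodup_tails h₂)⟩, ?_⟩
      · exact hout _ (arc_of_mem_tails h₂ (List.mem_reverse.1 hm))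
      · intro u hu hu'
        rw [List.mem_cons, List.mem_reverse] at hu'
        rcases hu' with rfl | hu'
        · exact hout _ (arc_of_mem_tails h₁ hu)
        · exact hd hu hu'

theorem exists_path [Finite V] (h : IsTrailSystem A S) {w : V} (hw : IsStart A w) :
    ∃ p ∈ paths hG S, (∀ u ∈ tails A S w, arc A u ∈ p.2.2.edges) ∧
      ∀ k < len A S w, Consecutive p.2.2.edges (arc A ((next A)^[k] w))
        (arc A ((next A)^[k + 1] w)) := by
  have hedge : ∀ k ≤ len A S w, ((tails A S w).map (arc A))[k]? =
      some (arc A ((next A)^[k] w)) := fun k hk => by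
    rw [List.getElem?_map, tails_getElem? hk]
    rfl
  by_cases hm : IsMeeting A S (last A S w)
  · obtain ⟨hout, t, ht⟩ := hm
    obtain ⟨w₁, w₂, h₁, h₂, h12, hS₁, hS₂, hww⟩ := h.exists_meeting hw hout ht
    refine ⟨_, Or.inr ⟨w₁, w₂, h₁, h₂, h12, ?_, hS₁, hS₂, rfl⟩, ?_, ?_⟩
    · rcases hww with rfl | rfl
      · exact hout
      · exact h12 ▸ hout
    · intro u hu
      rw [edges_merged, List.mem_append, List.mem_map, List.mem_map]
      rcases hww with rfl | rfl
      · exact Or.inl ⟨u, hu, rfl⟩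
      · exact Or.inr ⟨u, List.mem_reverse.2 hu, rfl⟩
    · intro k hk
      rw [edges_merged]
      rcases hww with rfl | rfl
      · refine Consecutive.append_right (consecutive_of_getElem? (hedge k hk.le) (hedge (k + 1) hk)) _
      · rw [List.map_reverse]
        refine Consecutive.append_left (Consecutive.reverse ?_) _
        exact consecutive_of_getElem? (hedge k hk.le) (hedge (k + 1) hk)
  · refine ⟨_, Or.inl ⟨w, hw, hm, rfl⟩, ?_, ?_⟩
    · intro u hu
      rw [edges_trail, List.mem_map]
      exact ⟨u, hu, rfl⟩
    · intro k hk
      rw [edges_trail]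
      exact consecutive_of_getElem? (hedge k hk.le) (hedge (k + 1) hk)

end IsTrailSystem

/-! ### Cycles through recurrent vertices -/

namespace IsTrailSystem

variable {V : Type*} {A S : V → V → Prop} {G : SimpleGraph V}

theorem arc_iterate [Finite V] (h : IsTrailSystem A S) {v : V} (hv : IsRecurrent A S v) (k : ℕ) :
    A ((next A)^[k] v) ((next A)^[k + 1] v) := by
  rw [Function.iterate_succ_apply']
  exact (hv.iterate h k).1

/-- The cycle through a vertex that lies on no trail with a beginning. -/
noncomputable def cycle [Finite V] (h : IsTrailSystem A S) (hG : ∀ u v, A u v → G.Adj u v) {v : V}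
    (hv : IsRecurrent A S v) : G.Walk v v :=
  (walkOf (fun k => (next A)^[k] v) (Function.minimalPeriod (next A) v) fun k _ =>
    hG _ _ (h.arc_iterate hv k)).copy (Function.iterate_zero_apply _ _) Function.iterate_minimalPeriod

/-- The vertices of the cycle through `v`. -/
noncomputable def orbit (A : V → V → Prop) (v : V) : List V :=
  (List.range (Function.minimalPeriod (next A) v)).map fun k => (next A)^[k] v

theorem nodup_orbit (v : V) : (orbit A v).Nodup := by
  rw [orbit, List.nodup_map_iff_inj_on List.nodup_range]
  intro i hi j hj hij
  rw [List.mem_range] at hi hj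
  exact Function.iterate_injOn_Iio_minimalPeriod hi hj hij

theorem mem_orbit_of_iterate [Finite V] (h : IsTrailSystem A S) {v : V} (hv : IsRecurrent A S v)
    (k : ℕ) : (next A)^[k] v ∈ orbit A v := by
  rw [orbit, List.mem_map]
  refine ⟨k % Function.minimalPeriod (next A) v, ?_, Function.iterate_mod_minimalPeriod_eq⟩
  rw [List.mem_range]
  exact Nat.mod_lt _ (Function.minimalPeriod_pos_of_mem_periodicPts (hv.mem_periodicPts h))

theorem exists_iterate_of_mem_orbit {u v : V} (hu : u ∈ orbit A v) : ∃ k, (next A)^[k] v = u := by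
  rw [orbit, List.mem_map] at hu
  obtain ⟨k, -, rfl⟩ := hu
  exact ⟨k, rfl⟩

theorem exists_iterate_iterate_eq [Finite V] (h : IsTrailSystem A S) {v : V}
    (hv : IsRecurrent A S v) (k : ℕ) : ∃ j, (next A)^[j] ((next A)^[k] v) = v := by
  obtain ⟨n, hn, hn'⟩ := hv.mem_periodicPts h
  refine ⟨n * k - k, ?_⟩
  rw [← Function.iterate_add_apply, Nat.sub_add_cancel (Nat.le_mul_of_pos_left k hn)]
  exact (hn'.mul_const k).eq

variable [Finite V]

theorem edges_cycle (h : IsTrailSystem A S) (hG : ∀ u v, A u v → G.Adj u v) {v : V}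
    (hv : IsRecurrent A S v) : (cycle h hG hv).edges = (orbit A v).map (arc A) := by
  rw [cycle, SimpleGraph.Walk.edges_copy]
  refine (edges_walkOf _ _ _).trans ?_
  rw [orbit, List.map_map]
  refine List.map_congr_left fun k _ => ?_
  rw [Function.iterate_succ_apply']
  rfl

theorem support_cycle (h : IsTrailSystem A S) (hG : ∀ u v, A u v → G.Adj u v) {v : V}
    (hv : IsRecurrent A S v) : (cycle h hG hv).support = orbit A v ++ [v] := by
  rw [cycle, SimpleGraph.Walk.support_copy]
  refine (support_walkOf _ _ _).trans ?_
  rw [List.range_succ, List.map_append, orbit, List.map_singleton, Function.iterate_minimalPeriod]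

theorem mem_support_cycle (h : IsTrailSystem A S) (hG : ∀ u v, A u v → G.Adj u v) {u v : V}
    (hv : IsRecurrent A S v) : u ∈ (cycle h hG hv).support ↔ u ∈ orbit A v := by
  rw [support_cycle, List.mem_append, List.mem_singleton, or_iff_left_of_imp]
  rintro rfl
  exact h.mem_orbit_of_iterate hv 0

theorem length_cycle (h : IsTrailSystem A S) (hG : ∀ u v, A u v → G.Adj u v) {v : V}
    (hv : IsRecurrent A S v) : (cycle h hG hv).length = (orbit A v).length := by
  rw [← SimpleGraph.Walk.length_edges, edges_cycle, List.length_map]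

theorem recurrent_of_mem_orbit (h : IsTrailSystem A S) {u v : V} (hv : IsRecurrent A S v)
    (hu : u ∈ orbit A v) : IsRecurrent A S u := by
  obtain ⟨k, rfl⟩ := exists_iterate_of_mem_orbit hu
  exact hv.iterate h k

theorem isCycle_cycle (h : IsTrailSystem A S) (hG : ∀ u v, A u v → G.Adj u v) {v : V}
    (hv : IsRecurrent A S v) : (cycle h hG hv).IsCycle := by
  have hpos := Function.minimalPeriod_pos_of_mem_periodicPts (hv.mem_periodicPts h)
  rw [SimpleGraph.Walk.isCycle_def]
  refine ⟨⟨?_⟩, fun hnil => ?_, ?_⟩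
  · rw [edges_cycle, List.nodup_map_iff_inj_on (nodup_orbit v)]
    exact fun x hx y hy hxy => h.arc_inj (h.recurrent_of_mem_orbit hv hx).1
      (h.recurrent_of_mem_orbit hv hy).1 hxy
  · have := congrArg SimpleGraph.Walk.length hnil
    rw [length_cycle] at this
    simp only [orbit, List.length_map, List.length_range, SimpleGraph.Walk.length_nil] at this
    omega
  · rw [cycle, SimpleGraph.Walk.support_copy, support_walkOf, List.range_succ_eq_map, List.map_cons, List.tail_cons, List.map_map,
      List.nodup_map_iff_inj_on List.nodup_range]
    intro i hi j hj hij
    rw [List.mem_range] at hi hj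
    simp only [Function.comp_apply, Nat.succ_eq_add_one, Function.iterate_succ_apply'] at hij
    exact Function.iterate_injOn_Iio_minimalPeriod hi hj (h.continues_inj
      ((hv.iterate h i).next h).2 ((hv.iterate h j).next h).2 hij)

/-- One cycle for every orbit. -/
def cycles (h : IsTrailSystem A S) (hG : ∀ u v, A u v → G.Adj u v) : Set (Σ u, G.Walk u u) :=
  {c | ∃ (v : V) (hv : IsRecurrent A S v),
    -- The vertex of least number represents its orbit.
    (∀ k, Finite.equivFin V v ≤ Finite.equivFin V ((next A)^[k] v)) ∧ c = ⟨v, cycle h hG hv⟩}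

theorem exists_cycle (h : IsTrailSystem A S) (hG : ∀ u v, A u v → G.Adj u v) {u : V}
    (hu : IsRecurrent A S u) : ∃ v, ∃ hv : IsRecurrent A S v, u ∈ orbit A v ∧
      (⟨v, cycle h hG hv⟩ : Σ u, G.Walk u u) ∈ cycles h hG := by
  obtain ⟨v, ⟨k, rfl⟩, hmin⟩ := exists_minimalFor_of_wellFoundedLT
    (fun v => ∃ k, (next A)^[k] u = v) (Finite.equivFin V) ⟨u, 0, rfl⟩
  have hv := hu.iterate h k
  refine ⟨_, hv, ?_, _, hv, fun j => ?_, rfl⟩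
  · obtain ⟨j, hj⟩ := h.exists_iterate_iterate_eq hu k
    have := h.mem_orbit_of_iterate hv j
    rwa [hj] at this
  · rcases le_total (Finite.equivFin V ((next A)^[k] u))
      (Finite.equivFin V ((next A)^[j] ((next A)^[k] u))) with hle | hle
    · exact hle
    · exact hmin ⟨j + k, Function.iterate_add_apply _ _ _ _⟩ hle

theorem cycle_unique (h : IsTrailSystem A S) (hG : ∀ u v, A u v → G.Adj u v) {c d : Σ u, G.Walk u u}
    (hc : c ∈ cycles h hG) (hd : d ∈ cycles h hG) {u : V} (huc : u ∈ orbit A c.1)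
    (hud : u ∈ orbit A d.1) : c = d := by
  obtain ⟨v, hv, hmin, rfl⟩ := hc
  obtain ⟨v', hv', hmin', rfl⟩ := hd
  obtain ⟨i, rfl⟩ := exists_iterate_of_mem_orbit huc
  obtain ⟨j, hij⟩ := exists_iterate_of_mem_orbit hud
  obtain ⟨a, ha⟩ := h.exists_iterate_iterate_eq hv i
  obtain ⟨b, hb⟩ := h.exists_iterate_iterate_eq hv' j
  have h1 := hmin (b + i)
  have h2 := hmin' (a + j)
  rw [Function.iterate_add_apply, ← hij, hb] at h1
  rw [Function.iterate_add_apply, hij, ha] at h2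
  obtain rfl := (Finite.equivFin V).injective (h1.antisymm h2)
  rfl

theorem consecutive_cycle (h : IsTrailSystem A S) (hG : ∀ u v, A u v → G.Adj u v) {u v : V}
    (hv : IsRecurrent A S v) (hu : u ∈ orbit A v) :
    Consecutive ((cycle h hG hv).edges ++ (cycle h hG hv).edges) (arc A u) (arc A (next A u)) := by
  rw [edges_cycle]
  rw [orbit, List.mem_map] at hu
  obtain ⟨k, hk, rfl⟩ := hu
  rw [List.mem_range] at hk
  rw [← Function.iterate_succ_apply' (next A)]
  have hget : ∀ j < Function.minimalPeriod (next A) v,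
      ((orbit A v).map (arc A))[j]? = some (arc A ((next A)^[j] v)) := fun j hj => by
    rw [List.getElem?_map, orbit, List.getElem?_map, List.getElem?_range hj]
    rfl
  have hlen : ((orbit A v).map (arc A)).length = Function.minimalPeriod (next A) v := by
    simp [orbit]
  refine consecutive_of_getElem? (k := k) ?_ ?_
  · rw [List.getElem?_append_left (hlen ▸ hk), hget k hk]
  · rcases (Nat.succ_le_of_lt hk).lt_or_eq with hlt | heq
    · rw [List.getElem?_append_left (hlen ▸ hlt), hget _ hlt]
    -- The last edge of the cycle is followed by the first edge of the second copy of the list.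
    · have h0 : 0 < Function.minimalPeriod (next A) v := by omega
      rw [List.getElem?_append_right (by omega), hlen,
        show k + 1 - Function.minimalPeriod (next A) v = 0 by omega, hget 0 h0]
      rw [Nat.succ_eq_add_one] at heq
      rw [Nat.succ_eq_add_one, heq, Function.iterate_minimalPeriod]
      rfl

end IsTrailSystem

/-- At most one arc is incident to `v`. -/
def IsLeaf {V : Type*} (A : V → V → Prop) (v : V) : Prop := ∃ y, ∀ x, A x v ∨ A v x → x = y

/-- The walk `p` begins at a leaf and either ends at a leaf or stops, through an arc of `S`, at a
vertex that some arc leaves; in the latter case the arcs of `A \ S` that precede the last one are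
traversed at the end of `p`. -/
def HasTrailEnds {V : Type*} {G : SimpleGraph V} (A S : V → V → Prop) {w v : V} (p : G.Walk w v) :
    Prop :=
  IsLeaf A w ∧ (IsLeaf A v ∨ ∃ t, S t v ∧ (∃ u, A v u) ∧ p.edges.reverse[0]? = some s(t, v) ∧
    p.support.reverse[1]? = some t ∧ ∀ q, A q t → ¬ S q t → p.edges.reverse[1]? = some s(q, t) ∧
      ∀ r, A r q → ¬ S r q → p.support.reverse[3]? = some r)

namespace IsTrailSystem

variable {V : Type*} {A S : V → V → Prop} {G : SimpleGraph V}

theorem IsStart.isLeaf (h : IsTrailSystem A S) {w : V} (hw : IsStart A w) : IsLeaf A w :=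
  ⟨next A w, fun x hx => by
    rcases hx with hx | hx
    · exact absurd hx (hw.2 x)
    · exact (h.next_eq hx).symm⟩

/-- An unglued trail that ends at a sink arrives by the only arc there, so the sink is a leaf; any
other unglued trail ends with an arc of `S`. Since main predecessors are unique, the arcs before the
stop are those of the trail. Both ends of a glued path are beginnings. -/
theorem hasTrailEnds [Finite V] (h : IsTrailSystem A S) (hG : ∀ u v, A u v → G.Adj u v)
    {p : Σ u v, G.Walk u v} (hp : p ∈ paths hG S) : HasTrailEnds A S p.2.2 := by
  obtain ⟨w, hw, hm, rfl⟩ | ⟨w₁, w₂, h₁, h₂, h12, hout, hS₁, hS₂, rfl⟩ := hp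
  · refine ⟨hw.isLeaf h, ?_⟩
    dsimp only
    by_cases hout : ∀ u, ¬ A (last A S w) u
    · left
      refine ⟨lastTail A S w, fun x hx => ?_⟩
      have hx := hx.resolve_right (hout x)
      have hns : ∀ t, ¬ S t (last A S w) := fun t ht => hm ⟨hout, t, ht⟩
      exact h.main_unique _ _ _ hx (hns x) (arc_last hw) (hns _)
    · right
      have hS := (h.stop_or_sink hw).resolve_right hout
      push Not at hout
      have hE : ∀ j ≤ len A S w, (trail S hG hw).edges.reverse[j]? =
          some (arc A ((next A)^[len A S w - j] w)) := by
        intro j hj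
        rw [edges_trail, List.getElem?_reverse (by rw [List.length_map, length_tails]; omega),
          List.length_map, length_tails, List.getElem?_map,
          show len A S w + 1 - 1 - j = len A S w - j by omega, tails_getElem? (by omega)]
        rfl
      have hV : ∀ j ≤ len A S w, (trail S hG hw).support.reverse[j + 1]? =
          some ((next A)^[len A S w - j] w) := by
        intro j hj
        rw [support_trail, List.reverse_append, List.reverse_singleton, List.singleton_append,
          List.getElem?_cons_succ, List.getElem?_reverse (by rw [length_tails]; omega),
          length_tails, show len A S w + 1 - 1 - j = len A S w - j by omega,
          tails_getElem? (by omega)]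
      have hprev : ∀ k ≤ len A S w, ∀ q, A q ((next A)^[k] w) → ¬ S q ((next A)^[k] w) →
          ∃ j, k = j + 1 ∧ (next A)^[j] w = q := by
        intro k hk q hq hq'
        cases k with
        | zero => exact absurd hq (hw.2 q)
        | succ k =>
          refine ⟨k, rfl, ?_⟩
          have hc := continues_of_lt (A := A) (S := S) hk
          rw [Function.iterate_succ_apply'] at hq hq'
          exact h.main_unique _ _ _ hc.1 hc.2.1 hq hq'
      refine ⟨lastTail A S w, hS, hout, ?_, hV 0 (Nat.zero_le _), fun q hq hq' => ?_⟩
      · rw [hE 0 (Nat.zero_le _)]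
        change some s(lastTail A S w, next A (lastTail A S w)) = _
        rw [h.next_eq (arc_last hw)]
      · obtain ⟨j, hj, rfl⟩ := hprev _ le_rfl q hq hq'
        refine ⟨?_, fun r hr hr' => ?_⟩
        · rw [hE 1 (by omega), show len A S w - 1 = j by omega]
          change some s((next A)^[j] w, next A ((next A)^[j] w)) = _
          rw [h.next_eq hq]
        · obtain ⟨i, rfl, rfl⟩ := hprev _ (by omega) r hr hr'
          rw [hV 2 (by omega), show len A S w - 2 = i by omega]
  · exact ⟨h₁.isLeaf h, Or.inl (h₂.isLeaf h)⟩

end IsTrailSystem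

/-- The arc from `a` to `v` is followed by the edge `vb` on a trail, or two trails that arrive from
`a` and `b` meet at `v`. -/
def Follows {V : Type*} (A S : V → V → Prop) (v a b : V) : Prop :=
  A a v ∧ ¬ S a v ∧ (A v b ∨ (S b v ∧ ∀ u, ¬ A v u))

namespace IsTrailSystem

variable {V : Type*} {A S : V → V → Prop}

theorem exists_consecutive [Finite V] {G : SimpleGraph V} (h : IsTrailSystem A S)
    (hG : ∀ u v, A u v → G.Adj u v) {v a b : V} (hf : Follows A S v a b) :
    (∃ p ∈ paths hG S, Consecutive p.2.2.edges s(v, a) s(v, b)) ∨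
      (∃ c ∈ cycles h hG, Consecutive (c.2.edges ++ c.2.edges) s(v, a) s(v, b)) := by
  obtain ⟨ha, ha', hb | ⟨hb, hout⟩⟩ := hf
  · have hna := h.next_eq ha
    have hnv := h.next_eq hb
    have hea : arc A a = s(v, a) := by rw [arc, hna, Sym2.eq_swap]
    have hev : arc A v = s(v, b) := by rw [arc, hnv]
    have hc : Continues A S a := by
      refine ⟨?_, ?_, ?_⟩ <;> rw [hna]
      · exact ha
      · exact ha'
      · rwa [hnv]
    rw [← hea, ← hev, ← hna]
    by_cases hr : IsRecurrent A S a
    · right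
      obtain ⟨w, hw, hu, hmem⟩ := h.exists_cycle hG hr
      exact ⟨_, hmem, h.consecutive_cycle hG hw hu⟩
    · left
      unfold IsRecurrent at hr
      push Not at hr
      obtain ⟨w, k, hw, hk, rfl⟩ := hr hc.1
      obtain ⟨p, hp, -, hcons⟩ := h.exists_path hG hw
      have hlt : k < len A S w := by
        refine h.le_len hw fun j hj => ?_
        rcases (Nat.lt_succ_iff.1 hj).lt_or_eq with hj | rfl
        · exact hk j hj
        · exact hc
      refine ⟨p, hp, ?_⟩
      have := hcons k hlt
      rwa [Function.iterate_succ_apply'] at this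
  · left
    obtain ⟨w₁, h₁, ht₁, hl₁⟩ := h.exists_start_of_not_continues ha hout
    obtain ⟨w₂, h₂, ht₂, hl₂⟩ := h.exists_start_of_not_continues (h.sub _ _ hb) hout
    refine ⟨_, Or.inr ⟨w₁, w₂, h₁, h₂, hl₂.trans hl₁.symm, by rwa [hl₁], by rwa [ht₁, hl₁],
      by rwa [ht₂, hl₂], rfl⟩, ?_⟩
    have hget : ∀ w, ((tails A S w).map (arc A)).reverse[0]? = some (arc A (lastTail A S w)) := by
      intro w
      rw [List.getElem?_reverse (by rw [List.length_map, length_tails]; omega),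
        List.length_map, length_tails, List.getElem?_map,
        show len A S w + 1 - 1 - 0 = len A S w by omega, tails_getElem? le_rfl]
      rfl
    have hlast : ((tails A S w₁).map (arc A))[len A S w₁]? = some (arc A (lastTail A S w₁)) := by
      rw [List.getElem?_map, tails_getElem? le_rfl]
      rfl
    have hlen : ((tails A S w₁).map (arc A)).length = len A S w₁ + 1 := by
      rw [List.length_map, length_tails]
    have e₁ : arc A (lastTail A S w₁) = s(v, a) := by
      rw [ht₁, arc, h.next_eq ha, Sym2.eq_swap]
    have e₂ : arc A (lastTail A S w₂) = s(v, b) := by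
      rw [ht₂, arc, h.next_eq (h.sub _ _ hb), Sym2.eq_swap]
    rw [edges_merged, List.map_reverse]
    dsimp only
    refine consecutive_of_getElem? (k := len A S w₁) ?_ ?_
    · rw [List.getElem?_append_left (by omega), hlast, e₁]
    · rw [List.getElem?_append_right (by omega), hlen, Nat.sub_self, hget, e₂]

/-- Every arc lies on a trail with a beginning or has a recurrent tail, and never both. The cycles
consist of main arcs only, which is what the count of double edges needs. -/
theorem exists_partition [Finite V] (h : IsTrailSystem A S) {E' : Set (Sym2 V)}
    {T : SimpleGraph (V ⊕ Sym2 V)} (hE : ∀ u v, s(u, v) ∈ E' ↔ A u v ∨ A v u)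
    (hfollow : ∀ v a b : V, a ≠ b → s(v, a) ∈ E' → s(v, b) ∈ E' → UsesAt T v a → UsesAt T v b →
      Follows A S v a b ∨ Follows A S v b a) :
    ∃ paths cycles, IsPathCyclePartition T E' paths cycles ∧
      (∀ p ∈ paths, HasTrailEnds A S p.2.2) ∧
      ∀ c ∈ cycles, ∃ K : Finset V, K.card = c.2.length ∧ (∀ x, x ∈ c.2.support ↔ x ∈ K) ∧
        IsCyclic (fun u v => A u v ∧ ¬ S u v) K := by
  have hG : ∀ u v, A u v → (SimpleGraph.fromEdgeSet E').Adj u v := by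
    intro u v huv
    rw [SimpleGraph.fromEdgeSet_adj]
    refine ⟨(hE u v).2 (Or.inl huv), ?_⟩
    rintro rfl
    exact h.asymm _ _ huv huv
  have hcyc : ∀ c ∈ cycles h hG, ∀ e ∈ c.2.edges, ∃ u ∈ orbit A c.1, IsRecurrent A S u ∧
      e = arc A u := by
    rintro _ ⟨v, hv, -, rfl⟩ e he
    rw [edges_cycle, List.mem_map] at he
    obtain ⟨u, hu, rfl⟩ := he
    exact ⟨u, hu, h.recurrent_of_mem_orbit hv hu, rfl⟩
  refine ⟨paths hG S, cycles h hG, ⟨?_, ?_, ?_, ?_, ?_, ?_, ?_, ?_⟩,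
    fun p hp => h.hasTrailEnds hG hp, ?_⟩
  · exact fun p hp => h.isPathPiece_of_mem_paths hG hp
  · rintro _ ⟨v, hv, -, rfl⟩
    exact h.isCycle_cycle hG hv
  · have key : ∀ u v, A u v → (∃ p ∈ paths hG S, s(u, v) ∈ p.2.2.edges) ∨
        ∃ c ∈ cycles h hG, s(u, v) ∈ c.2.edges := by
      intro u v huv
      have hn := h.next_eq huv
      have he : s(u, v) = arc A u := by rw [arc, hn]
      have hu : A u (next A u) := by rwa [hn]
      rw [he]
      by_cases hr : IsRecurrent A S u
      · right
        obtain ⟨w, hw, hu, hmem⟩ := h.exists_cycle hG hr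
        refine ⟨_, hmem, ?_⟩
        rw [edges_cycle]
        exact List.mem_map_of_mem hu
      · left
        unfold IsRecurrent at hr
        push Not at hr
        obtain ⟨w, k, hw, hk, rfl⟩ := hr hu
        obtain ⟨p, hp, hmem, -⟩ := h.exists_path hG hw
        exact ⟨p, hp, hmem _ (mem_tails.2 ⟨k, h.le_len hw hk, rfl⟩)⟩
    intro e he
    induction e using Sym2.ind with
    | _ u v =>
      rcases (hE u v).1 he with huv | huv
      · exact key u v huv
      · rw [Sym2.eq_swap]
        exact key v u huv
  · intro p hp q hq hpq e hep heq
    obtain ⟨w, u, hw, hwp, hu, rfl⟩ := mem_edges_of_mem_paths hG hp hep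
    obtain ⟨w', u', hw', hwq, hu', heq⟩ := mem_edges_of_mem_paths hG hq heq
    obtain rfl := h.arc_inj (arc_of_mem_tails hw hu) (arc_of_mem_tails hw' hu') heq
    obtain rfl := h.start_unique hw hw' hu hu'
    exact hpq (h.eq_of_shared_start hG hp hq hw hwp hwq)
  · intro c hc d hd hcd e hec hed
    obtain ⟨u, hu, hur, rfl⟩ := hcyc c hc e hec
    obtain ⟨u', hu', hur', heq⟩ := hcyc d hd _ hed
    obtain rfl := h.arc_inj hur.1 hur'.1 heq
    exact hcd (h.cycle_unique hG hc hd hu hu')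
  · intro p hp c hc e hep hec
    obtain ⟨w, u, hw, -, hu, rfl⟩ := mem_edges_of_mem_paths hG hp hep
    obtain ⟨u', -, hur', heq⟩ := hcyc c hc _ hec
    obtain rfl := h.arc_inj (arc_of_mem_tails hw hu) hur'.1 heq
    obtain ⟨k, hk, hku⟩ := mem_tails.1 hu
    exact hur'.2 w k hw (fun j hj => continues_of_lt (hj.trans_le hk)) hku
  · intro v a b hab ha hb hTa hTb
    rcases hfollow v a b hab ha hb hTa hTb with hf | hf
    · exact h.exists_consecutive hG hf
    · exact (h.exists_consecutive hG hf).imp (fun ⟨p, hp, hc⟩ => ⟨p, hp, hc.symm⟩)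
        fun ⟨p, hp, hc⟩ => ⟨p, hp, hc.symm⟩
  · intro p hp q hq hpq
    have hstart : ∀ p ∈ paths hG S, IsStart A p.1 := by
      rintro _ (⟨w, hw, -, rfl⟩ | ⟨w₁, w₂, h₁, h₂, -, -, -, -, rfl⟩)
      · exact hw
      · exact h₁
    have hne : ∀ p ∈ paths hG S, ∀ q ∈ paths hG S, p ≠ q → ∀ w, IsStart A w →
        (w = p.1 ∨ w = p.2.1) → (w = q.1 ∨ w = q.2.1) → False :=
      fun p hp q hq hpq w hw hwp hwq => hpq (h.eq_of_shared_start hG hp hq hw hwp hwq)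
    refine ⟨fun heq => ?_, fun heq => ?_, fun heq => ?_, fun heq => ?_⟩
    · exact hne p hp q hq hpq _ (hstart p hp) (Or.inl rfl) (Or.inl heq)
    · exact hne p hp q hq hpq _ (hstart p hp) (Or.inl rfl) (Or.inr heq)
    · exact hne p hp q hq hpq _ (hstart q hq) (Or.inr heq.symm) (Or.inl rfl)
    -- If the common end is not a beginning, both paths are unglued trails. Two such trails with the
    -- same last vertex have both a main or both a stopping last arc, so they coincide.
    · by_cases hs : IsStart A p.2.1
      · exact hne p hp q hq hpq _ hs (Or.inr rfl) (Or.inr heq)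
      · have hs' : ¬ IsStart A q.2.1 := heq ▸ hs
        obtain ⟨w, hw, hm, rfl⟩ | ⟨w₁, w₂, h₁, h₂, _, -, -, -, rfl⟩ := hp
        · obtain ⟨w', hw', hm', rfl⟩ | ⟨w₁, w₂, h₁, h₂, _, -, -, -, rfl⟩ := hq
          · dsimp only at heq
            have hww : w = w' := by
              refine h.lastTail_inj hw hw' ?_
              have h1 := arc_last (S := S) hw
              have h2 := arc_last (S := S) hw'
              have h3 := h.stop_or_sink hw
              have h4 := h.stop_or_sink hw'
              rw [heq] at h1 h3 hm
              by_cases hout : ∀ u, ¬ A (last A S w') u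
              · have hns : ∀ t, ¬ S t (last A S w') := fun t ht => hm ⟨hout, t, ht⟩
                exact h.main_unique _ _ _ h1 (hns _) h2 (hns _)
              · exact h.stop_unique _ _ _ (h3.resolve_right hout) (h4.resolve_right hout)
            subst hww
            exact hpq rfl
          · exact hs' h₂
        · exact hs h₂
  · rintro _ ⟨v, hv, -, rfl⟩
    refine ⟨(orbit A v).toFinset, ?_, fun x => ?_, ⟨?_, ?_, ?_⟩⟩
    · rw [length_cycle, List.toFinset_card_of_nodup (nodup_orbit v)]
    · rw [mem_support_cycle, List.mem_toFinset]
    · exact ⟨v, List.mem_toFinset.2 (h.mem_orbit_of_iterate hv 0)⟩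
    · intro u hu
      rw [List.mem_toFinset] at hu
      obtain ⟨k, rfl⟩ := exists_iterate_of_mem_orbit hu
      have hc := ((hv.iterate h k).next h).2
      refine ⟨_, ?_, hc.1, hc.2.1⟩
      rw [List.mem_toFinset, ← Function.iterate_succ_apply' (next A)]
      exact h.mem_orbit_of_iterate hv _
    · intro u hu
      rw [List.mem_toFinset] at hu
      obtain ⟨k, rfl⟩ := exists_iterate_of_mem_orbit hu
      obtain ⟨x, hx, hc, hxk⟩ := (hv.iterate h k).exists_prev h
      refine ⟨x, ?_, hxk ▸ hc.1, hxk ▸ hc.2.1⟩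
      obtain ⟨j, hj⟩ := h.exists_iterate_iterate_eq hx 1
      rw [Function.iterate_one, hxk, ← Function.iterate_add_apply] at hj
      rw [List.mem_toFinset, ← hj]
      exact h.mem_orbit_of_iterate hv _

end IsTrailSystem

/-! ### Assembling the solutions of all kites -/

section Assembly

variable {V : Type*}

/-- The arcs of `D` that do not lie inside a kite. -/
def boundary (C M : SimpleGraph V) (D : V → V → Prop) (u v : V) : Prop :=
  D u v ∧ ¬ ∃ c : C.ConnectedComponent, IsKite M c ∧ u ∈ c.supp ∧ v ∈ c.supp

/-- `v` has an incoming boundary edge that is not removed. -/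
def KeptIn (C M : SimpleGraph V) (D : V → V → Prop) (gone : Set V) (v : V) : Prop :=
  (∃ u, boundary C M D u v) ∧ v ∉ gone

/-- `v` has an outgoing boundary edge that is not removed. -/
def KeptOut (C M : SimpleGraph V) (D : V → V → Prop) (x v : V) : Prop :=
  (∃ u, boundary C M D v u) ∧ v ≠ x

/-- No arc leaves `v`. -/
def IsSink (C M : SimpleGraph V) (D : V → V → Prop) (x : V) (A : V → V → Prop) (v : V) : Prop :=
  (∀ u, ¬ A v u) ∧ ¬ KeptOut C M D x v

/-- A trail stops at `v` after traversing the edge of `M` at `v`. -/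
def IsBad (M : SimpleGraph V) (S : V → V → Prop) (v : V) : Prop := ∃ p, S p v ∧ M.Adj p v

/-- Exchange sets inside the kite `c`, and arcs on the resulting edges, when the outgoing boundary
edge of `x` and the incoming boundary edges of `gone` are removed. -/
structure IsKiteSolution {C : SimpleGraph V} (M : SimpleGraph V) (T : SimpleGraph (V ⊕ Sym2 V))
    (D : V → V → Prop) (B : Set (Sym2 V)) (c : C.ConnectedComponent) (x : V) (gone allowed : Set V)
    (F₁ F₂ : Set (Sym2 V)) (A S : V → V → Prop) : Prop where
  arc_mem : ∀ u v, A u v → u ∈ c.supp ∧ v ∈ c.supp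
  subset₁ : ∀ e ∈ F₁, e ∈ inside c ∧ e ∈ C.edgeSet ∧ (e ∈ B → e ∉ M.edgeSet)
  subset₂ : ∀ e ∈ F₂, e ∈ inside c ∧ e ∈ B ∧ e ∉ F₁
  card : (F₁.ncard = 1 ∧ F₂ = ∅) ∨
    (IsFourKite M c ∧ F₁.ncard = 2 ∧ F₂.ncard = 1 ∧ Disjoint F₂ M.edgeSet)
  degree : ∀ v ∈ c.supp, {e ∈ F₂ | v ∈ e}.ncard + ((if v = x then 1 else 0) +
    (if v ∈ gone then 1 else 0)) ≤ {e ∈ F₁ | v ∈ e}.ncard + 1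
  edge : ∀ u ∈ c.supp, ∀ v ∈ c.supp, u ≠ v → (s(u, v) ∈ (B ∪ F₁) \ F₂ ↔ A u v ∨ A v u)
  asymm : ∀ u v, A u v → ¬ A v u
  out_unique : ∀ u v w, A u v → A u w → v = w
  out_kept : ∀ u v, A u v → ¬ KeptOut C M D x u
  sub : ∀ u v, S u v → A u v
  main_unique : ∀ u v w, A u v → ¬ S u v → A w v → ¬ S w v → u = w
  main_kept : ∀ u v, A u v → ¬ S u v → ¬ KeptIn C M D gone v
  stop_unique : ∀ u v w, S u v → S w v → u = w
  stop_main : ∀ u v, S u v → KeptIn C M D gone v ∨ ∃ w, A w v ∧ ¬ S w v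
  follow : ∀ u v, S u v → UsesAt T v u → ¬ IsSink C M D x A v →
    ¬ KeptIn C M D gone v ∧ ¬ KeptOut C M D x v ∧ (∀ w, A w v → ¬ S w v → ¬ UsesAt T v w) ∧
      ∀ w, A v w → ¬ UsesAt T v w
  amenable : ∀ u v, S u v → ¬ IsSink C M D x A v → M.Adj u v ∨ ∃ q, A q u ∧ ¬ S q u ∧
    (M.Adj q u ∨ ∃ t, A t q ∧ ¬ S t q ∧ M.Adj u t)
  bad : ∀ v, IsBad M S v → ¬ IsSink C M D x A v →
    (KeptIn C M D gone v ∧ KeptOut C M D x v ∧ v ∈ allowed) ∨ (∃ w, A v w ∧ ¬ IsBad M S w) ∨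
      ∃ w, A w v ∧ ¬ S w v ∧ ¬ IsBad M S w
  dup : ∀ u v, A u v → s(u, v) ∈ B → s(u, v) ∈ F₁ → IsSink C M D x A v

/-- There are two options for the removed outgoing boundary edge of the kite `c` that allow for a
solution whatever incoming boundary edges are removed, except that the second option, if it is to
protect the tail of its own removed edge, requires that the incoming edge of this vertex is kept. -/
def IsGoodKite {C : SimpleGraph V} (M : SimpleGraph V) (T : SimpleGraph (V ⊕ Sym2 V))
    (D : V → V → Prop) (B : Set (Sym2 V)) (c : C.ConnectedComponent) : Prop :=
  ∃ p x : Bool → V, ∀ b, p b ∈ c.supp ∧ x b ∈ c.supp ∧ (∃ w, boundary C M D (x b) w) ∧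
    ∀ gone : Set V, (∀ v ∈ gone, v ∈ c.supp ∧ ∃ u, boundary C M D u v) →
      (b = true → x true = p true → p true ∉ gone) →
      ∃ F₁ F₂ A S, IsKiteSolution M T D B c (x b) gone {v | v = p (!b) ∧ v ≠ p b} F₁ F₂ A S

variable {C M : SimpleGraph V} {T : SimpleGraph (V ⊕ Sym2 V)} {D : V → V → Prop}
  {Z : Set (Sym2 V)}

theorem IsBalancedOrientation.opp (hD : IsBalancedOrientation C M T D) :
    IsBalancedOrientation C M T fun u v => D v u where
  edge u v := (hD.edge u v).trans or_comm
  asymm u v h := hD.asymm v u h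
  out_unique := hD.in_unique
  in_unique := hD.out_unique
  balanced c hc := by
    have key : ∀ (P Q : V → Prop), {p : V × V | P p.1 ∧ Q p.2 ∧ D p.2 p.1}.ncard =
        {p : V × V | Q p.1 ∧ P p.2 ∧ D p.1 p.2}.ncard := by
      intro P Q
      refine Set.ncard_congr (fun p _ => p.swap) ?_ ?_ ?_
      · rintro ⟨a, b⟩ ⟨h1, h2, h3⟩
        exact ⟨h2, h1, h3⟩
      · intro p q _ _ h
        exact Prod.swap_injective h
      · rintro ⟨a, b⟩ ⟨h1, h2, h3⟩
        exact ⟨(b, a), ⟨h2, h1, h3⟩, rfl⟩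
    rw [key (· ∈ c.supp) (· ∉ c.supp), key (· ∉ c.supp) (· ∈ c.supp), hD.balanced c hc]

/-- Solutions for all kites that fit together. -/
structure IsGlobalSolution (C M : SimpleGraph V) (T : SimpleGraph (V ⊕ Sym2 V)) (D : V → V → Prop)
    (B : Set (Sym2 V)) (x : C.ConnectedComponent → V) (allowed : C.ConnectedComponent → Set V)
    (F₁ F₂ : C.ConnectedComponent → Set (Sym2 V)) (A S : C.ConnectedComponent → V → V → Prop) :
    Prop where
  mem : ∀ c, IsKite M c → x c ∈ c.supp
  out : ∀ c, IsKite M c → ∃ w, boundary C M D (x c) w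
  sol : ∀ c : C.ConnectedComponent, IsKite M c → IsKiteSolution M T D B c (x c)
    {v | v ∈ c.supp ∧ ∃ d, IsKite M d ∧ boundary C M D (x d) v} (allowed c) (F₁ c) (F₂ c) (A c) (S c)
  cover : ∀ K : Finset V, IsCyclic (boundary C M D) K →
    (∀ v ∈ K, ∃ c, IsKite M c ∧ v ∈ c.supp ∧ v ∈ allowed c) → ∃ c, IsKite M c ∧ x c ∈ K

/-- The options are fixed for all kites first, by `exists_selection`. This determines all removed
boundary edges, hence the removed incoming edges of each kite, and only then the solutions inside
are taken. -/
theorem exists_globalSolution [Finite V] (hD : IsBalancedOrientation C M T D) {B : Set (Sym2 V)}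
    (hgood : ∀ c : C.ConnectedComponent, IsKite M c → IsGoodKite M T D B c) :
    ∃ x allowed F₁ F₂ A S, IsGlobalSolution C M T D B x allowed F₁ F₂ A S := by
  -- A vertex is needed as default value for components that are not kites.
  rcases isEmpty_or_nonempty V with hV | ⟨⟨v₀⟩⟩
  · have hno : ∀ c : C.ConnectedComponent, False := fun c =>
      c.ind fun v => hV.elim v
    refine ⟨fun c => (hno c).elim, fun _ => ∅, fun _ => ∅, fun _ => ∅, fun _ _ _ => False,
      fun _ _ _ => False, fun c => (hno c).elim, fun c => (hno c).elim, fun c => (hno c).elim, ?_⟩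
    rintro K ⟨⟨v, -⟩, -, -⟩ -
    exact hV.elim v
  let ι := {c : C.ConnectedComponent // IsKite M c}
  have hgood' : ∀ c : ι, IsGoodKite M T D B c.1 := fun c => hgood c.1 c.2
  choose p x hpx using hgood'
  have hsame : ∀ (c c' : ι) i i', boundary C M D (x c' i') (p c i) → c' ≠ c := by
    rintro c c' i i' hb rfl
    exact hb.2 ⟨c'.1, c'.2, (hpx c' i').2.1, (hpx c' i).1⟩
  obtain ⟨b, hb, hb'⟩ := exists_selection (D := boundary C M D)
    (fun v hv => hD.asymm _ _ hv.1 hv.1) (fun u v w h1 h2 => hD.out_unique u v w h1.1 h2.1)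
    (fun u v w h1 h2 => hD.in_unique u v w h1.1 h2.1) p x hsame
  have hsol : ∀ c : ι, ∃ F₁ F₂ A S, IsKiteSolution M T D B c.1 (x c (b c))
      {v | v ∈ c.1.supp ∧ ∃ d : ι, boundary C M D (x d (b d)) v}
      {v | v = p c (!b c) ∧ v ≠ p c (b c)} F₁ F₂ A S := by
    intro c
    refine (hpx c (b c)).2.2.2 _ ?_ ?_
    · rintro v ⟨hv, d, hd⟩
      exact ⟨hv, _, hd⟩
    · rintro hbc hxp ⟨-, d, hd⟩
      exact hb' c hbc hxp d hd
  choose F₁ F₂ A S hsol using hsol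
  refine ⟨fun c => if h : IsKite M c then x ⟨c, h⟩ (b ⟨c, h⟩) else v₀,
    fun c => if h : IsKite M c then {v | v = p ⟨c, h⟩ (!b ⟨c, h⟩) ∧ v ≠ p ⟨c, h⟩ (b ⟨c, h⟩)} else ∅,
    fun c => if h : IsKite M c then F₁ ⟨c, h⟩ else ∅, fun c => if h : IsKite M c then F₂ ⟨c, h⟩ else ∅,
    fun c => if h : IsKite M c then A ⟨c, h⟩ else fun _ _ => False,
    fun c => if h : IsKite M c then S ⟨c, h⟩ else fun _ _ => False, ?_, ?_, ?_, ?_⟩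
  · intro c hc
    rw [dif_pos hc]
    exact (hpx ⟨c, hc⟩ _).2.1
  · intro c hc
    rw [dif_pos hc]
    exact (hpx ⟨c, hc⟩ _).2.2.1
  · intro c hc
    simp only [dif_pos hc]
    convert hsol ⟨c, hc⟩ using 1
    ext v
    refine and_congr_right fun _ => ⟨?_, ?_⟩
    · rintro ⟨d, hd, h⟩
      rw [dif_pos hd] at h
      exact ⟨⟨d, hd⟩, h⟩
    · rintro ⟨d, h⟩
      refine ⟨d.1, d.2, ?_⟩
      rw [dif_pos d.2]
      exact h
  · intro K hK hKall
    obtain ⟨c, hc⟩ := hb K hK (by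
      intro v hv
      obtain ⟨c, hc, -, hva⟩ := hKall v hv
      rw [dif_pos hc] at hva
      exact ⟨⟨c, hc⟩, _, hva.1⟩)
    refine ⟨c.1, c.2, ?_⟩
    rw [dif_pos c.2]
    -- The protected vertex of a kite is not allowed in it, so the set is hit by the tail of a
    -- removed arc.
    refine hc.resolve_left fun hpc => ?_
    obtain ⟨d, hd, hpd, hva⟩ := hKall _ hpc
    have hcd : c.1 = d := component_eq (hpx c (b c)).1 hpd
    subst hcd
    rw [dif_pos hd] at hva
    exact hva.2 rfl

end Assembly

/-! ### The trail system of all kites together -/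

section Global

variable {V : Type*} {C M : SimpleGraph V} {T : SimpleGraph (V ⊕ Sym2 V)} {D : V → V → Prop}
  {B : Set (Sym2 V)} {x : C.ConnectedComponent → V} {allowed : C.ConnectedComponent → Set V}
  {F₁ F₂ : C.ConnectedComponent → Set (Sym2 V)} {A S : C.ConnectedComponent → V → V → Prop}

/-- The arcs inside the kites and the boundary arcs that are not removed. -/
def globalArc (C M : SimpleGraph V) (D : V → V → Prop) (x : C.ConnectedComponent → V)
    (A : C.ConnectedComponent → V → V → Prop) (u v : V) : Prop :=
  (∃ c, IsKite M c ∧ A c u v) ∨ (boundary C M D u v ∧ ∀ c, IsKite M c → u ≠ x c)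

def globalStop (M : SimpleGraph V) (S : C.ConnectedComponent → V → V → Prop) (u v : V) : Prop :=
  ∃ c : C.ConnectedComponent, IsKite M c ∧ S c u v

def globalAdded (M : SimpleGraph V) (F₁ : C.ConnectedComponent → Set (Sym2 V)) : Set (Sym2 V) :=
  {e | ∃ c : C.ConnectedComponent, IsKite M c ∧ e ∈ F₁ c}

def globalRemoved (C M : SimpleGraph V) (D : V → V → Prop) (x : C.ConnectedComponent → V)
    (F₂ : C.ConnectedComponent → Set (Sym2 V)) : Set (Sym2 V) :=
  {e | (∃ c : C.ConnectedComponent, IsKite M c ∧ e ∈ F₂ c) ∨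
    ∃ (c : C.ConnectedComponent) (w : V), IsKite M c ∧ boundary C M D (x c) w ∧ e = s(x c, w)}

/-- The set of edges that the orientation and the chosen half-edges provide. -/
structure IsBase (C M : SimpleGraph V) (D : V → V → Prop) (B : Set (Sym2 V)) : Prop where
  not_diag : ∀ u, s(u, u) ∉ B
  boundary : ∀ u v, (¬ ∃ c : C.ConnectedComponent, IsKite M c ∧ u ∈ c.supp ∧ v ∈ c.supp) →
    (s(u, v) ∈ B ↔ D u v ∨ D v u)

theorem component_eq_of_edge {c d : C.ConnectedComponent} {e : Sym2 V} (hc : e ∈ inside c)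
    (hd : e ∈ inside d) : c = d := by
  induction e using Sym2.ind with
  | _ u v => exact component_eq (mem_inside.1 hc).2.1 (mem_inside.1 hd).2.1

namespace IsGlobalSolution

theorem arc_inside (h : IsGlobalSolution C M T D B x allowed F₁ F₂ A S) {c : C.ConnectedComponent}
    (hc : IsKite M c) {u v : V} (huv : globalArc C M D x A u v) (hu : u ∈ c.supp)
    (hv : v ∈ c.supp) : A c u v := by
  rcases huv with ⟨d, hd, hA⟩ | ⟨hb, -⟩
  · rwa [component_eq hu ((h.sol d hd).arc_mem _ _ hA).1]
  · exact absurd ⟨c, hc, hu, hv⟩ hb.2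

theorem stop_inside (h : IsGlobalSolution C M T D B x allowed F₁ F₂ A S)
    {c : C.ConnectedComponent} {u v : V} (huv : globalStop M S u v)
    (hv : v ∈ c.supp) : S c u v := by
  obtain ⟨d, hd, hS⟩ := huv
  rwa [component_eq hv ((h.sol d hd).arc_mem _ _ ((h.sol d hd).sub _ _ hS)).2]

theorem stop_mem (h : IsGlobalSolution C M T D B x allowed F₁ F₂ A S)
    {c : C.ConnectedComponent} (hc : IsKite M c) {u v : V} (huv : S c u v) :
    u ∈ c.supp ∧ v ∈ c.supp := (h.sol c hc).arc_mem _ _ ((h.sol c hc).sub _ _ huv)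

theorem keptOut_of_boundary
    {c : C.ConnectedComponent} (hc : IsKite M c) {u v : V} (hb : boundary C M D u v)
    (hx : ∀ c, IsKite M c → u ≠ x c) : KeptOut C M D (x c) u :=
  ⟨⟨v, hb⟩, hx c hc⟩

theorem keptIn_of_boundary (hD : IsBalancedOrientation C M T D)
    {c : C.ConnectedComponent} {u v : V} (hb : boundary C M D u v)
    (hx : ∀ c, IsKite M c → u ≠ x c) :
    KeptIn C M D {v | v ∈ c.supp ∧ ∃ d, IsKite M d ∧ boundary C M D (x d) v} v := by
  refine ⟨⟨u, hb⟩, ?_⟩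
  rintro ⟨-, d, hd, hbd⟩
  exact hx d hd (hD.in_unique _ _ _ hb.1 hbd.1)

theorem boundary_of_keptIn {c : C.ConnectedComponent} {v : V} (hv : v ∈ c.supp)
    (hk : KeptIn C M D {v | v ∈ c.supp ∧ ∃ d, IsKite M d ∧ boundary C M D (x d) v} v) :
    ∃ u, boundary C M D u v ∧ ∀ c, IsKite M c → u ≠ x c := by
  obtain ⟨⟨u, hu⟩, hg⟩ := hk
  refine ⟨u, hu, ?_⟩
  rintro d hd rfl
  exact hg ⟨hv, d, hd, hu⟩

theorem boundary_of_keptOut (h : IsGlobalSolution C M T D B x allowed F₁ F₂ A S)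
    {c : C.ConnectedComponent} {v : V} (hv : v ∈ c.supp) (hk : KeptOut C M D (x c) v) :
    ∃ u, boundary C M D v u ∧ ∀ c, IsKite M c → v ≠ x c := by
  obtain ⟨⟨u, hu⟩, hx⟩ := hk
  refine ⟨u, hu, ?_⟩
  rintro d hd rfl
  rw [component_eq (h.mem d hd) hv] at hx
  exact hx rfl

theorem isSink_iff (h : IsGlobalSolution C M T D B x allowed F₁ F₂ A S)
    {c : C.ConnectedComponent} (hc : IsKite M c) {v : V} (hv : v ∈ c.supp) :
    IsSink C M D (x c) (A c) v ↔ ∀ u, ¬ globalArc C M D x A v u := by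
  constructor
  · rintro ⟨h1, h2⟩ u (⟨d, hd, hA⟩ | ⟨hb, hx⟩)
    · rw [← component_eq hv ((h.sol d hd).arc_mem _ _ hA).1] at hA
      exact h1 u hA
    · exact h2 (keptOut_of_boundary hc hb hx)
  · intro h1
    refine ⟨fun u hu => h1 u (Or.inl ⟨c, hc, hu⟩), fun hk => ?_⟩
    obtain ⟨u, hu⟩ := h.boundary_of_keptOut hv hk
    exact h1 u (Or.inr hu)

/-- Arcs inside a kite and boundary arcs do not compete: `out_kept` separates the leaving arcs and
`main_kept` the main entering arcs. Boundary arcs are never stopping arcs. -/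
theorem isTrailSystem (h : IsGlobalSolution C M T D B x allowed F₁ F₂ A S)
    (hD : IsBalancedOrientation C M T D) :
    IsTrailSystem (globalArc C M D x A) (globalStop M S) where
  asymm := by
    rintro u v (⟨c, hc, hA⟩ | ⟨hb, -⟩) h2
    · have hm := (h.sol c hc).arc_mem _ _ hA
      exact (h.sol c hc).asymm _ _ hA (h.arc_inside hc h2 hm.2 hm.1)
    · rcases h2 with ⟨c, hc, hA⟩ | ⟨hb', -⟩
      · exact hb.2 ⟨c, hc, ((h.sol c hc).arc_mem _ _ hA).symm⟩
      · exact hD.asymm _ _ hb.1 hb'.1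
  out_unique := by
    have key : ∀ u v w, (∃ c, IsKite M c ∧ A c u v) →
        (boundary C M D u w ∧ ∀ c, IsKite M c → u ≠ x c) → False := by
      rintro u v w ⟨c, hc, hA⟩ ⟨hb, hx⟩
      exact (h.sol c hc).out_kept _ _ hA (keptOut_of_boundary hc hb hx)
    rintro u v w (h1 | h1) (h2 | h2)
    · obtain ⟨c, hc, hA⟩ := h1
      obtain ⟨d, hd, hA'⟩ := h2
      rw [← component_eq ((h.sol c hc).arc_mem _ _ hA).1 ((h.sol d hd).arc_mem _ _ hA').1] at hA'
      exact (h.sol c hc).out_unique _ _ _ hA hA'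
    · exact (key _ _ _ h1 h2).elim
    · exact (key _ _ _ h2 h1).elim
    · exact hD.out_unique _ _ _ h1.1.1 h2.1.1
  sub := by
    rintro u v ⟨c, hc, hS⟩
    exact Or.inl ⟨c, hc, (h.sol c hc).sub _ _ hS⟩
  main_unique := by
    have key : ∀ u v w, (∃ c, IsKite M c ∧ A c u v) → ¬ globalStop M S u v →
        (boundary C M D w v ∧ ∀ c, IsKite M c → w ≠ x c) → False := by
      rintro u v w ⟨c, hc, hA⟩ hS ⟨hb, hx⟩
      exact (h.sol c hc).main_kept _ _ hA (fun hS' => hS ⟨c, hc, hS'⟩)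
        (keptIn_of_boundary hD hb hx)
    rintro u v w (h1 | h1) h1' (h2 | h2) h2'
    · obtain ⟨c, hc, hA⟩ := h1
      obtain ⟨d, hd, hA'⟩ := h2
      rw [← component_eq ((h.sol c hc).arc_mem _ _ hA).2 ((h.sol d hd).arc_mem _ _ hA').2] at hA'
      exact (h.sol c hc).main_unique _ _ _ hA (fun hS => h1' ⟨c, hc, hS⟩) hA'
        (fun hS => h2' ⟨c, hc, hS⟩)
    · exact (key _ _ _ h1 h1' h2).elim
    · exact (key _ _ _ h2 h2' h1).elim
    · exact hD.in_unique _ _ _ h1.1.1 h2.1.1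
  stop_unique := by
    rintro u v w ⟨c, hc, h1⟩ h2
    exact (h.sol c hc).stop_unique _ _ _ h1 (h.stop_inside h2 (h.stop_mem hc h1).2)
  stop_main := by
    rintro u v ⟨c, hc, hS⟩
    have hv := (h.stop_mem hc hS).2
    rcases (h.sol c hc).stop_main _ _ hS with hk | ⟨w, hw, hw'⟩
    · obtain ⟨w, hw, hx⟩ := boundary_of_keptIn hv hk
      refine ⟨w, Or.inr ⟨hw, hx⟩, ?_⟩
      rintro ⟨d, hd, hS'⟩
      exact hw.2 ⟨d, hd, h.stop_mem hd hS'⟩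
    · exact ⟨w, Or.inl ⟨c, hc, hw⟩, fun hS' => hw' (h.stop_inside hS' hv)⟩

theorem added_inside (h : IsGlobalSolution C M T D B x allowed F₁ F₂ A S)
    {c : C.ConnectedComponent} (hc : IsKite M c) {e : Sym2 V} (he : e ∈ inside c) :
    e ∈ globalAdded M F₁ ↔ e ∈ F₁ c := by
  constructor
  · rintro ⟨d, hd, hed⟩
    rwa [component_eq_of_edge he ((h.sol d hd).subset₁ e hed).1]
  · exact fun h1 => ⟨c, hc, h1⟩

theorem boundary_not_inside {u v : V} (hb : boundary C M D u v) {c : C.ConnectedComponent}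
    (hc : IsKite M c) : s(u, v) ∉ inside c := fun hm =>
  hb.2 ⟨c, hc, (mem_inside.1 hm).2⟩

theorem removed_inside (h : IsGlobalSolution C M T D B x allowed F₁ F₂ A S)
    {c : C.ConnectedComponent} (hc : IsKite M c) {e : Sym2 V} (he : e ∈ inside c) :
    e ∈ globalRemoved C M D x F₂ ↔ e ∈ F₂ c := by
  constructor
  · rintro (⟨d, hd, hed⟩ | ⟨d, w, hd, hb, rfl⟩)
    · rwa [component_eq_of_edge he ((h.sol d hd).subset₂ e hed).1]
    · exact absurd he (boundary_not_inside hb hc)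
  · exact fun h1 => Or.inl ⟨c, hc, h1⟩

theorem mem_exchanged (h : IsGlobalSolution C M T D B x allowed F₁ F₂ A S)
    (hD : IsBalancedOrientation C M T D) (hB : IsBase C M D B) (u v : V) :
    s(u, v) ∈ exchanged B (globalAdded M F₁) (globalRemoved C M D x F₂) ↔
      globalArc C M D x A u v ∨ globalArc C M D x A v u := by
  rcases eq_or_ne u v with rfl | hne
  · have h1 : ¬ globalArc C M D x A u u := fun h1 => (h.isTrailSystem hD).asymm _ _ h1 h1
    simp only [h1, or_self, iff_false]
    rintro ⟨hBu | ⟨c, hc, hu⟩, -⟩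
    · exact hB.not_diag u hBu
    · exact (mem_inside.1 ((h.sol c hc).subset₁ _ hu).1).1 rfl
  by_cases hs : ∃ c : C.ConnectedComponent, IsKite M c ∧ u ∈ c.supp ∧ v ∈ c.supp
  · obtain ⟨c, hc, hu, hv⟩ := hs
    have hm : s(u, v) ∈ inside c := mem_inside.2 ⟨hne, hu, hv⟩
    have h1 := (h.sol c hc).edge u hu v hv hne
    have h2 : ∀ a b, a ∈ c.supp → b ∈ c.supp → (globalArc C M D x A a b ↔ A c a b) :=
      fun a b ha hb => ⟨fun h1 => h.arc_inside hc h1 ha hb, fun h1 => Or.inl ⟨c, hc, h1⟩⟩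
    rw [h2 u v hu hv, h2 v u hv hu, ← h1, exchanged, Set.mem_sdiff, Set.mem_sdiff, Set.mem_union,
      Set.mem_union, h.added_inside hc hm, h.removed_inside hc hm]
  · have h1 : s(u, v) ∉ globalAdded M F₁ := by
      rintro ⟨c, hc, he⟩
      exact hs ⟨c, hc, (mem_inside.1 ((h.sol c hc).subset₁ _ he).1).2⟩
    have hs' : ¬ ∃ c : C.ConnectedComponent, IsKite M c ∧ v ∈ c.supp ∧ u ∈ c.supp :=
      fun ⟨c, hc, h2⟩ => hs ⟨c, hc, h2.symm⟩
    have h2 : ∀ a b, (¬ ∃ c : C.ConnectedComponent, IsKite M c ∧ a ∈ c.supp ∧ b ∈ c.supp) →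
        (globalArc C M D x A a b ↔ D a b ∧ ∀ c, IsKite M c → a ≠ x c) := by
      intro a b hab
      constructor
      · rintro (⟨c, hc, hA⟩ | ⟨hb, hx⟩)
        · exact absurd ⟨c, hc, (h.sol c hc).arc_mem _ _ hA⟩ hab
        · exact ⟨hb.1, hx⟩
      · exact fun h3 => Or.inr ⟨⟨h3.1, hab⟩, h3.2⟩
    have h3 : s(u, v) ∈ globalRemoved C M D x F₂ ↔
        (D u v ∧ ∃ c, IsKite M c ∧ u = x c) ∨ (D v u ∧ ∃ c, IsKite M c ∧ v = x c) := by
      constructor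
      · rintro (⟨d, hd, hed⟩ | ⟨d, w, hd, hb, he⟩)
        · exact absurd ⟨d, hd, (mem_inside.1 ((h.sol d hd).subset₂ _ hed).1).2⟩ hs
        · rcases Sym2.eq_iff.1 he with ⟨rfl, rfl⟩ | ⟨rfl, rfl⟩
          · exact Or.inl ⟨hb.1, d, hd, rfl⟩
          · exact Or.inr ⟨hb.1, d, hd, rfl⟩
      · rintro (⟨hDuv, c, hc, rfl⟩ | ⟨hDuv, c, hc, rfl⟩)
        · exact Or.inr ⟨c, v, hc, ⟨hDuv, hs⟩, rfl⟩
        · exact Or.inr ⟨c, u, hc, ⟨hDuv, hs'⟩, Sym2.eq_swap⟩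
    rw [h2 u v hs, h2 v u hs', exchanged, Set.mem_sdiff, Set.mem_union, or_iff_left h1,
      hB.boundary u v hs, h3]
    have has := hD.asymm u v
    constructor
    · rintro ⟨hd | hd, hr⟩
      · exact Or.inl ⟨hd, fun c hc heq => hr (Or.inl ⟨hd, c, hc, heq⟩)⟩
      · exact Or.inr ⟨hd, fun c hc heq => hr (Or.inr ⟨hd, c, hc, heq⟩)⟩
    · rintro (⟨hd, hx⟩ | ⟨hd, hx⟩)
      · refine ⟨Or.inl hd, ?_⟩
        rintro (⟨-, c, hc, heq⟩ | ⟨hd', -⟩)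
        · exact hx c hc heq
        · exact has hd hd'
      · refine ⟨Or.inr hd, ?_⟩
        rintro (⟨hd', -⟩ | ⟨-, c, hc, heq⟩)
        · exact has hd' hd
        · exact hx c hc heq

/-- Of two remaining edges of the cover at `v` one is the main entering arc and the other leaves,
unless a stopping arc is involved. By the condition `follow` of the kite this happens only at a
sink, where the stopping trail is glued to the main one. -/
theorem follows (h : IsGlobalSolution C M T D B x allowed F₁ F₂ A S)
    (hD : IsBalancedOrientation C M T D) {v a b : V} (hab : a ≠ b)
    (ha : globalArc C M D x A v a ∨ globalArc C M D x A a v)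
    (hb : globalArc C M D x A v b ∨ globalArc C M D x A b v)
    (hTa : UsesAt T v a) (hTb : UsesAt T v b) :
    Follows (globalArc C M D x A) (globalStop M S) v a b ∨
      Follows (globalArc C M D x A) (globalStop M S) v b a := by
  have hts := h.isTrailSystem hD
  have inOut : ∀ a b, globalArc C M D x A a v → globalArc C M D x A v b → UsesAt T v a →
      UsesAt T v b → Follows (globalArc C M D x A) (globalStop M S) v a b := by
    intro a b ha hb hTa hTb
    refine ⟨ha, ?_, Or.inl hb⟩
    rintro ⟨c, hc, hS⟩
    have hv := (h.stop_mem hc hS).2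
    obtain ⟨-, h2, -, h4⟩ := (h.sol c hc).follow _ _ hS hTa
      fun hs => (h.isSink_iff hc hv).1 hs b hb
    rcases hb with ⟨d, hd, hA⟩ | ⟨hb, hx⟩
    · rw [← component_eq hv ((h.sol d hd).arc_mem _ _ hA).1] at hA
      exact h4 b hA hTb
    · exact h2 (keptOut_of_boundary hc hb hx)
  have inIn : ∀ a b, globalArc C M D x A a v → globalArc C M D x A b v → globalStop M S a v →
      ¬ globalStop M S b v → UsesAt T v a → UsesAt T v b →
      Follows (globalArc C M D x A) (globalStop M S) v b a := by
    intro a b ha hb hSa hSb hTa hTb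
    refine ⟨hb, hSb, Or.inr ⟨hSa, ?_⟩⟩
    obtain ⟨c, hc, hS⟩ := hSa
    have hv := (h.stop_mem hc hS).2
    rw [← h.isSink_iff hc hv]
    by_contra hsink
    obtain ⟨h1, -, h3, -⟩ := (h.sol c hc).follow _ _ hS hTa hsink
    rcases hb with ⟨d, hd, hA⟩ | ⟨hb, hx⟩
    · rw [← component_eq hv ((h.sol d hd).arc_mem _ _ hA).2] at hA
      exact h3 b hA (fun hS' => hSb ⟨c, hc, hS'⟩) hTb
    · exact h1 (keptIn_of_boundary hD hb hx)
  rcases ha with ha | ha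
  · rcases hb with hb | hb
    · exact absurd (hts.out_unique _ _ _ ha hb) hab
    · exact Or.inr (inOut b a hb ha hTb hTa)
  · rcases hb with hb | hb
    · exact Or.inl (inOut a b ha hb hTa hTb)
    · by_cases hSa : globalStop M S a v
      · by_cases hSb : globalStop M S b v
        · exact absurd (hts.stop_unique _ _ _ hSa hSb) hab
        · exact Or.inr (inIn a b ha hb hSa hSb hTa hTb)
      · by_cases hSb : globalStop M S b v
        · exact Or.inl (inIn b a hb ha hSb hSa hTb hTa)
        · exact absurd (hts.main_unique _ _ _ ha hSa hb hSb) hab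

end IsGlobalSolution

end Global

/-! ### Double edges and degrees in the multigraph -/

section Multiplicity

variable {V : Type*} {M : SimpleGraph V} {B F₁ F₂ : Set (Sym2 V)} {A S : V → V → Prop}

theorem IsPerfectMatching.eq_of_adj (hM : IsPerfectMatching M) {u v w : V} (h1 : M.Adj u v)
    (h2 : M.Adj u w) : v = w := by
  obtain ⟨y, hy⟩ := Set.ncard_eq_one.1 (hM u)
  have hv : v ∈ M.neighborSet u := h1
  have hw : w ∈ M.neighborSet u := h2
  rw [hy, Set.mem_singleton_iff] at hv hw
  rw [hv, hw]

theorem IsPerfectMatching.exists_adj (hM : IsPerfectMatching M) (u : V) : ∃ v, M.Adj u v :=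
  Set.nonempty_of_ncard_ne_zero (s := M.neighborSet u) (by rw [hM u]; exact one_ne_zero)

/-- The arcs of `A` are the edges that remain after the exchange. -/
structure IsArcSet (M : SimpleGraph V) (B F₁ F₂ : Set (Sym2 V)) (A : V → V → Prop) : Prop where
  edge : ∀ u v, s(u, v) ∈ exchanged B F₁ F₂ ↔ A u v ∨ A v u
  disj : Disjoint F₁ F₂
  not_matched : ∀ e ∈ F₁, e ∈ B → e ∉ M.edgeSet

theorem IsArcSet.mult_eq_two (h : IsArcSet M B F₁ F₂ A) {u v : V} (hM : M.Adj u v)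
    (hA : A u v ∨ A v u) : mult M B F₁ F₂ s(u, v) = 2 := by
  have he := (h.edge u v).2 hA
  have hMe : s(u, v) ∈ M.edgeSet := hM
  rw [mult, if_pos hMe]
  by_cases h1 : s(u, v) ∈ F₁
  · have hB : s(u, v) ∉ B \ F₂ := fun hB => h.not_matched _ h1 hB.1 hMe
    rw [if_neg hB, if_pos h1]
  · have hB : s(u, v) ∈ B \ F₂ := ⟨he.1.resolve_right h1, he.2⟩
    rw [if_pos hB, if_neg h1]

theorem IsArcSet.of_mult_eq_two (h : IsArcSet M B F₁ F₂ A) {u v : V}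
    (hm : mult M B F₁ F₂ s(u, v) = 2) :
    (A u v ∨ A v u) ∧ (M.Adj u v ∨ (s(u, v) ∈ B ∧ s(u, v) ∈ F₁)) := by
  rw [← h.edge]
  have hd : s(u, v) ∈ F₁ → s(u, v) ∉ F₂ := fun h1 h2 => Set.disjoint_left.1 h.disj h1 h2
  unfold mult at hm
  by_cases h1 : s(u, v) ∈ F₁
  · refine ⟨⟨Or.inr h1, hd h1⟩, ?_⟩
    by_cases h2 : s(u, v) ∈ M.edgeSet
    · exact Or.inl h2
    · right
      rw [if_neg h2, if_pos h1] at hm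
      by_cases h3 : s(u, v) ∈ B \ F₂
      · exact ⟨h3.1, h1⟩
      · rw [if_neg h3] at hm
        omega
  · rw [if_neg h1] at hm
    by_cases h2 : s(u, v) ∈ M.edgeSet
    · by_cases h3 : s(u, v) ∈ B \ F₂
      · exact ⟨⟨Or.inl h3.1, h3.2⟩, Or.inl h2⟩
      · rw [if_neg h3, if_pos h2] at hm
        omega
    · rw [if_neg h2] at hm
      split_ifs at hm <;> omega

/-- The edge of M and at most two copies of the only remaining edge of the exchanged set give degree
at most 3. -/
theorem IsArcSet.multDegree_lt [Fintype V] (h : IsArcSet M B F₁ F₂ A) (hM : IsPerfectMatching M)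
    {w : V} (hw : IsLeaf A w) : multDegree M B F₁ F₂ w < 4 := by
  obtain ⟨y, hy⟩ := hw
  have hE : ∀ u, s(w, u) ∈ exchanged B F₁ F₂ → u = y := fun u hu =>
    hy u ((h.edge w u).1 hu).symm
  have hd : ∀ e, e ∈ F₁ → e ∉ F₂ := fun e h1 h2 => Set.disjoint_left.1 h.disj h1 h2
  obtain ⟨m, hm⟩ := hM.exists_adj w
  have hle : ∀ u, mult M B F₁ F₂ s(w, u) ≤ (if u = m then 1 else 0) + (if u = y then 2 else 0) := by
    intro u
    unfold mult
    have h1 : (if s(w, u) ∈ M.edgeSet then 1 else 0) ≤ (if u = m then 1 else 0) := by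
      split_ifs with ha hb
      · exact le_rfl
      · exact absurd (hM.eq_of_adj ha hm) hb
      · exact Nat.zero_le _
      · exact le_rfl
    have h2 : (if s(w, u) ∈ B \ F₂ then 1 else 0) + (if s(w, u) ∈ F₁ then 1 else 0) ≤
        (if u = y then 2 else 0) := by
      by_cases hu : u = y
      · rw [if_pos hu]
        split_ifs <;> omega
      · rw [if_neg fun hB => hu (hE u ⟨Or.inl hB.1, hB.2⟩),
          if_neg fun hF => hu (hE u ⟨Or.inr hF, hd _ hF⟩)]
        exact Nat.zero_le _
    omega
  calc multDegree M B F₁ F₂ w ≤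
        ∑ u ∈ Finset.univ.erase w, ((if u = m then 1 else 0) + (if u = y then 2 else 0)) :=
        Finset.sum_le_sum fun u _ => hle u
    _ ≤ ∑ u : V, ((if u = m then 1 else 0) + (if u = y then 2 else 0)) :=
        Finset.sum_le_sum_of_subset (Finset.subset_univ _)
    _ = 3 := by
        rw [Finset.sum_add_distrib, Finset.sum_ite_eq' Finset.univ m, Finset.sum_ite_eq' Finset.univ y,
          if_pos (Finset.mem_univ _), if_pos (Finset.mem_univ _)]
    _ < 4 := by norm_num

theorem IsArcSet.amenable [Fintype V] (h : IsArcSet M B F₁ F₂ A) (hM : IsPerfectMatching M)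
    {G : SimpleGraph V} {w v : V} {p : G.Walk w v} (hp : HasTrailEnds A S p)
    (hsub : ∀ u v, S u v → A u v)
    (ham : ∀ u v y, S u v → A v y → M.Adj u v ∨ ∃ q, A q u ∧ ¬ S q u ∧
      (M.Adj q u ∨ ∃ t, A t q ∧ ¬ S t q ∧ M.Adj u t)) :
    Amenable M (mult M B F₁ F₂) (multDegree M B F₁ F₂) p := by
  obtain ⟨hw, hv | ⟨t, hS, ⟨y, hy⟩, he0, hs1, hq⟩⟩ := hp
  · exact Or.inl ⟨(h.multDegree_lt hM hw).ne, (h.multDegree_lt hM hv).ne⟩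
  · by_cases hd : multDegree M B F₁ F₂ v = 4
    · right; left
      refine ⟨hd, h.multDegree_lt hM hw, ?_⟩
      rcases ham t v y hS hy with hm | ⟨q, hqt, hqt', hm | ⟨r, hr, hr', hm⟩⟩
      · exact Or.inl ⟨_, he0, h.mult_eq_two hm (Or.inl (hsub _ _ hS))⟩
      · exact Or.inr (Or.inl ⟨_, (hq q hqt hqt').1, h.mult_eq_two hm (Or.inl hqt)⟩)
      · exact Or.inr (Or.inr ⟨t, r, hs1, (hq q hqt hqt').2 r hr hr', hm⟩)
    · exact Or.inl ⟨(h.multDegree_lt hM hw).ne, hd⟩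

/-- A cycle with as many incident double edges as vertices consists of vertices at which a trail
stops after traversing an edge of `M`. -/
theorem IsArcSet.ncard_double_lt [Fintype V] (h : IsArcSet M B F₁ F₂ A) (hM : IsPerfectMatching M)
    (hts : IsTrailSystem A S) (hdup : ∀ u v y, A u v → s(u, v) ∈ B → s(u, v) ∈ F₁ → ¬ A v y)
    {K : Finset V} (hK : IsCyclic (fun u v => A u v ∧ ¬ S u v) K)
    (hbad : ∃ v ∈ K, ¬ IsBad M S v) :
    {e | mult M B F₁ F₂ e = 2 ∧ ∃ x ∈ e, x ∈ K}.ncard < K.card := by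
  obtain ⟨v, hv, hvb⟩ := hbad
  choose m hm using hM.exists_adj
  -- The incident double edges are edges of M at vertices of `K`, and `v` may be omitted: as `v` is
  -- not bad, a double edge at `v` has its other end in `K` too.
  have hsub : {e | mult M B F₁ F₂ e = 2 ∧ ∃ x ∈ e, x ∈ K} ⊆
      ((K.erase v).image fun u => s(u, m u) : Finset (Sym2 V)) := by
    rintro e ⟨he, x, hxe, hx⟩
    obtain ⟨y, rfl⟩ := hxe
    obtain ⟨hA, hcase⟩ := h.of_mult_eq_two he
    obtain ⟨z, hz, hxz⟩ := hK.next x hx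
    have hAdj : M.Adj x y := by
      -- A double edge outside M leads to a sink, whereas an arc leaves every vertex of `K`; in the
      -- first case the head is the successor of `x`, hence in `K`.
      refine hcase.resolve_right fun ⟨hB, hF⟩ => ?_
      rcases hA with hA | hA
      · obtain rfl := hts.out_unique _ _ _ hA hxz.1
        obtain ⟨z', -, hz'⟩ := hK.next _ hz
        exact hdup _ _ _ hA hB hF hz'.1
      · rw [Sym2.eq_swap] at hB hF
        exact hdup _ _ _ hA hB hF hxz.1
    rw [Finset.mem_coe, Finset.mem_image]
    rcases eq_or_ne x v with rfl | hxv
    · have hy : y ∈ K := by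
        rcases hA with hA | hA
        · rwa [hts.out_unique _ _ _ hA hxz.1]
        · by_cases hS : S y x
          · exact absurd ⟨y, hS, hAdj.symm⟩ hvb
          · obtain ⟨u, hu, hux⟩ := hK.prev x hx
            rwa [hts.main_unique _ _ _ hA hS hux.1 hux.2]
      refine ⟨y, Finset.mem_erase.2 ⟨hAdj.ne', hy⟩, ?_⟩
      rw [hM.eq_of_adj (hm y) hAdj.symm, Sym2.eq_swap]
    · refine ⟨x, Finset.mem_erase.2 ⟨hxv, hx⟩, ?_⟩
      rw [hM.eq_of_adj (hm x) hAdj]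
  calc _ ≤ (((K.erase v).image fun u => s(u, m u) : Finset (Sym2 V)) : Set (Sym2 V)).ncard :=
        Set.ncard_le_ncard hsub
    _ ≤ (K.erase v).card := by
        rw [Set.ncard_coe_finset]
        exact Finset.card_image_le
    _ < K.card := Finset.card_erase_lt_of_mem hv

end Multiplicity

/-! ### Exchange pairs from good kites -/

section Exchange

variable {V : Type*} {C M : SimpleGraph V} {T : SimpleGraph (V ⊕ Sym2 V)} {D : V → V → Prop}

/-- On an all-bad cycle a kite can offer no good neighbour, so every vertex is an allowed one with
its outgoing boundary edge kept, and all arcs are boundary arcs. By `cover` such a cycle contains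
some `x c`, whose outgoing boundary edge is removed. -/
theorem IsGlobalSolution.exists_not_isBad {B : Set (Sym2 V)} {x : C.ConnectedComponent → V}
    {allowed : C.ConnectedComponent → Set V} {F₁ F₂ : C.ConnectedComponent → Set (Sym2 V)}
    {A S : C.ConnectedComponent → V → V → Prop}
    (h : IsGlobalSolution C M T D B x allowed F₁ F₂ A S) (hD : IsBalancedOrientation C M T D)
    {K : Finset V} (hK : IsCyclic (fun u v => globalArc C M D x A u v ∧ ¬ globalStop M S u v) K) :
    ∃ v ∈ K, ¬ IsBad M (globalStop M S) v := by
  by_contra hall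
  push Not at hall
  have hts := h.isTrailSystem hD
  have hbad : ∀ c v, v ∈ c.supp → IsBad M (globalStop M S) v → IsBad M (S c) v := by
    rintro c v hv ⟨p, hp, hpv⟩
    exact ⟨p, h.stop_inside hp hv, hpv⟩
  have key : ∀ v ∈ K, ∃ c, IsKite M c ∧ v ∈ c.supp ∧ v ∈ allowed c ∧ KeptOut C M D (x c) v ∧
      ∀ w, ¬ A c v w := by
    intro v hv
    obtain ⟨p, ⟨c, hc, hS⟩, hpv⟩ := hall v hv
    have hvc := (h.stop_mem hc hS).2
    obtain ⟨w, hw, hvw⟩ := hK.next v hv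
    obtain ⟨u, hu, huv⟩ := hK.prev v hv
    have hns : ¬ IsSink C M D (x c) (A c) v := fun hs => (h.isSink_iff hc hvc).1 hs w hvw.1
    rcases (h.sol c hc).bad v ⟨p, hS, hpv⟩ hns with ⟨-, h2, h3⟩ | ⟨w', hw', hb⟩ | ⟨u', hu', hS', hb⟩
    · exact ⟨c, hc, hvc, h3, h2, fun w hw => (h.sol c hc).out_kept _ _ hw h2⟩
    · have hw'' : w' = w := hts.out_unique _ _ _ (Or.inl ⟨c, hc, hw'⟩) hvw.1
      subst hw''
      exact absurd (hbad c _ ((h.sol c hc).arc_mem _ _ hw').2 (hall _ hw)) hb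
    · have hu'' : u' = u := hts.main_unique _ _ _ (Or.inl ⟨c, hc, hu'⟩)
        (fun hS'' => hS' (h.stop_inside hS'' hvc)) huv.1 huv.2
      subst hu''
      exact absurd (hbad c _ ((h.sol c hc).arc_mem _ _ hu').1 (hall _ hu)) hb
  have hbd : ∀ v ∈ K, ∀ w, globalArc C M D x A v w → boundary C M D v w := by
    rintro v hv w (⟨d, hd, hA⟩ | ⟨hb, -⟩)
    · obtain ⟨c, hc, hvc, -, -, hno⟩ := key v hv
      rw [← component_eq hvc ((h.sol d hd).arc_mem _ _ hA).1] at hA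
      exact absurd hA (hno w)
    · exact hb
  obtain ⟨c, hc, hxc⟩ := h.cover K ⟨hK.nonempty,
    fun v hv => (hK.next v hv).imp fun w hw => ⟨hw.1, hbd v hv w hw.2.1⟩,
    fun v hv => (hK.prev v hv).imp fun u hu => ⟨hu.1, hbd u hu.1 v hu.2.1⟩⟩
    fun v hv => (key v hv).imp fun c hc => ⟨hc.1, hc.2.1, hc.2.2.1⟩
  obtain ⟨d, hd, hvd, -, ⟨-, hne⟩, -⟩ := key _ hxc
  rw [component_eq (h.mem c hc) hvd] at hne
  exact hne rfl

theorem exists_exchangePair [Fintype V] (hM : IsPerfectMatching M)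
    (hT : IsRelaxedCycleCover C M T) (hD : IsBalancedOrientation C M T D) {Z : Set (Sym2 V)}
    (hZ : Z ⊆ halfUsedEdges T)
    (hgood : ∀ c : C.ConnectedComponent, IsKite M c → IsGoodKite M T D (wholeEdges T ∪ Z) c) :
    ∃ F₁ F₂ : Set (Sym2 V), IsExchangePair C M T D Z F₁ F₂ := by
  obtain ⟨x, allowed, F₁, F₂, A, S, h⟩ := exists_globalSolution hD hgood
  set B := wholeEdges T ∪ Z with hBdef
  have hB : IsBase C M D B := by
    constructor
    · rintro u (hu | hu)
      · exact hT.ne (mem_wholeEdges.1 hu).1 rfl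
      · rcases mem_halfUsedEdges.1 (hZ hu) with hu | hu <;> exact hT.ne hu.1 rfl
    · intro u v hs
      rw [← hD.edge, hBdef, Set.mem_union, or_iff_left]
      intro hz
      rcases mem_halfUsedEdges.1 (hZ hz) with hu | hu
      · exact hs (hT.half_subset hu.1 hu.2)
      · obtain ⟨c, hc, h1, h2⟩ := hT.half_subset hu.1 hu.2
        exact hs ⟨c, hc, h2, h1⟩
  have hts := h.isTrailSystem hD
  set G₁ := globalAdded M F₁ with hG₁
  set G₂ := globalRemoved C M D x F₂ with hG₂
  have hdisj : Disjoint G₁ G₂ := by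
    rw [Set.disjoint_left]
    rintro e ⟨c, hc, he⟩ he₂
    have hm := ((h.sol c hc).subset₁ e he).1
    rw [hG₂, h.removed_inside hc hm] at he₂
    exact ((h.sol c hc).subset₂ e he₂).2.2 he
  have hA : IsArcSet M B G₁ G₂ (globalArc C M D x A) := by
    refine ⟨fun u v => h.mem_exchanged hD hB u v, hdisj, ?_⟩
    rintro e ⟨c, hc, he⟩ heB
    exact ((h.sol c hc).subset₁ e he).2.2 heB
  have hI₁ : ∀ c : C.ConnectedComponent, IsKite M c → G₁ ∩ inside c = F₁ c := by
    intro c hc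
    ext e
    constructor
    · rintro ⟨he, hm⟩
      rwa [hG₁, h.added_inside hc hm] at he
    · intro he
      exact ⟨⟨c, hc, he⟩, ((h.sol c hc).subset₁ e he).1⟩
  have hI₂ : ∀ c : C.ConnectedComponent, IsKite M c → G₂ ∩ inside c = F₂ c := by
    intro c hc
    ext e
    constructor
    · rintro ⟨he, hm⟩
      rwa [hG₂, h.removed_inside hc hm] at he
    · intro he
      exact ⟨Or.inl ⟨c, hc, he⟩, ((h.sol c hc).subset₂ e he).1⟩
  refine ⟨G₁, G₂, hdisj, ?_, ?_, ?_, ?_, ?_, ?_⟩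
  · rintro e ⟨c, hc, he⟩
    obtain ⟨-, h2, h3⟩ := (h.sol c hc).subset₁ e he
    exact ⟨h2, fun ⟨h4, h5⟩ => h3 (h4.symm) h5⟩
  · rintro e (⟨c, hc, he⟩ | ⟨c, w, hc, hb, rfl⟩)
    · exact ((h.sol c hc).subset₂ e he).2.1
    · exact Or.inl ((hD.edge _ _).2 (Or.inl hb.1))
  · intro c hc
    rw [hI₁ c hc, hI₂ c hc]
    exact (h.sol c hc).card
  · intro c hc
    obtain ⟨w, hw⟩ := h.out c hc
    rw [Set.ncard_eq_one]
    refine ⟨(x c, w), ?_⟩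
    ext ⟨a, b⟩
    rw [Set.mem_singleton_iff]
    constructor
    · rintro ⟨ha, hb, hab, he⟩
      dsimp only at ha hb hab he
      rcases he with ⟨d, hd, he⟩ | ⟨d, w', hd, hb', he⟩
      · have hm := mem_inside.1 ((h.sol d hd).subset₂ _ he).1
        rw [← component_eq ha hm.2.1] at hm
        exact absurd hm.2.2 hb
      · rcases Sym2.eq_iff.1 he with ⟨rfl, rfl⟩ | ⟨rfl, rfl⟩
        · have hdc := component_eq (h.mem d hd) ha
          subst hdc
          rw [hD.out_unique _ _ _ hab hw.1]
        · exact absurd hb'.1 (hD.asymm _ _ hab)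
    · intro heq
      obtain ⟨rfl, rfl⟩ := Prod.mk.inj heq
      exact ⟨h.mem c hc, fun hwc => hw.2 ⟨c, hc, h.mem c hc, hwc⟩, hw.1, Or.inr ⟨c, _, hc, hw, rfl⟩⟩
  · intro c hc v hv
    have h₁ : {e ∈ G₁ | v ∈ e} = {e ∈ F₁ c | v ∈ e} := by
      ext e
      constructor
      · rintro ⟨⟨d, hd, he⟩, hve⟩
        rw [component_eq hv (((h.sol d hd).subset₁ e he).1.2 v hve)]
        exact ⟨he, hve⟩
      · rintro ⟨he, hve⟩
        exact ⟨⟨c, hc, he⟩, hve⟩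
    obtain ⟨w, hw⟩ := h.out c hc
    have hdeg := (h.sol c hc).degree v hv
    obtain ⟨gone, hgone⟩ : ∃ gone : Set V, gone =
      {v | v ∈ c.supp ∧ ∃ d, IsKite M d ∧ boundary C M D (x d) v} := ⟨_, rfl⟩
    rw [← hgone] at hdeg
    -- At `v` the removed boundary edges are at most the outgoing one of the kite, if `v` is its
    -- tail, and one incoming edge, removed by another kite.
    have hout : {e : Sym2 V | e = s(x c, w) ∧ v = x c}.ncard ≤ if v = x c then 1 else 0 := by
      split_ifs with hvx
      · exact (Set.ncard_le_ncard fun e he => he.1 :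
          _ ≤ ({s(x c, w)} : Set (Sym2 V)).ncard).trans (Set.ncard_singleton _).le
      · rw [Set.eq_empty_of_forall_notMem fun e (he : e ∈ {e : Sym2 V | e = s(x c, w) ∧ v = x c}) =>
          hvx he.2, Set.ncard_empty]
    have hin : {e : Sym2 V | ∃ d, IsKite M d ∧ boundary C M D (x d) v ∧ e = s(x d, v)}.ncard ≤
        if v ∈ gone then 1 else 0 := by
      split_ifs with hvg
      · rw [hgone] at hvg
        obtain ⟨-, d, hd, hb⟩ := hvg
        refine (Set.ncard_le_ncard ?_ : _ ≤ ({s(x d, v)} : Set (Sym2 V)).ncard).trans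
          (Set.ncard_singleton _).le
        rintro e ⟨d', hd', hb', rfl⟩
        rw [hD.in_unique _ _ _ hb'.1 hb.1]
        rfl
      · refine ((Set.ncard_eq_zero (Set.toFinite _)).2 (Set.eq_empty_of_forall_notMem ?_)).le
        rintro e ⟨d, hd, hb, -⟩
        exact hvg (hgone ▸ ⟨hv, d, hd, hb⟩)
    have h₂ : {e ∈ G₂ | v ∈ e} ⊆ {e ∈ F₂ c | v ∈ e} ∪ ({e : Sym2 V | e = s(x c, w) ∧ v = x c} ∪
        {e : Sym2 V | ∃ d, IsKite M d ∧ boundary C M D (x d) v ∧ e = s(x d, v)}) := by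
      rintro e ⟨⟨d, hd, he⟩ | ⟨d, w', hd, hb, rfl⟩, hve⟩
      · left
        rw [component_eq hv (((h.sol d hd).subset₂ e he).1.2 v hve)]
        exact ⟨he, hve⟩
      · right
        rcases Sym2.mem_iff.1 hve with rfl | rfl
        · left
          have hdc := component_eq (h.mem d hd) hv
          subst hdc
          exact ⟨by rw [hD.out_unique _ _ _ hb.1 hw.1], rfl⟩
        · exact Or.inr ⟨d, hd, hb, rfl⟩
    rw [h₁]
    refine (Set.ncard_le_ncard h₂).trans ?_
    refine (Set.ncard_union_le _ _).trans ?_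
    have := Set.ncard_union_le {e : Sym2 V | e = s(x c, w) ∧ v = x c}
        {e : Sym2 V | ∃ d, IsKite M d ∧ boundary C M D (x d) v ∧ e = s(x d, v)}
    omega
  · obtain ⟨paths, cycles, hpart, hpaths, hcycles⟩ := hts.exists_partition (T := T)
      (fun u v => h.mem_exchanged hD hB u v) (by
        intro v a b hab ha hb hTa hTb
        exact h.follows hD hab ((hA.edge v a).1 ha) ((hA.edge v b).1 hb) hTa hTb)
    refine ⟨paths, cycles, hpart, ?_, ?_⟩
    · intro c hc _
      obtain ⟨K, hcard, hmem, hK⟩ := hcycles c hc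
      rw [← hcard]
      simp only [hmem]
      refine hA.ncard_double_lt hM hts ?_ hK (h.exists_not_isBad hD hK)
      rintro u v y (⟨d, hd, hAd⟩ | ⟨hb, -⟩) heB heF
      · have hm := (h.sol d hd).arc_mem _ _ hAd
        rw [hG₁, h.added_inside hd ((mem_inside.2 ⟨?_, hm⟩))] at heF
        · exact (h.isSink_iff hd hm.2).1 ((h.sol d hd).dup _ _ hAd heB heF) y
        · rintro rfl
          exact (h.sol d hd).asymm _ _ hAd hAd
      · obtain ⟨c, hc, he⟩ := heF
        exact absurd ((h.sol c hc).subset₁ _ he).1 (IsGlobalSolution.boundary_not_inside hb hc)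
    · intro p hp
      refine hA.amenable hM (hpaths p hp) hts.sub ?_
      rintro u v y ⟨c, hc, hS⟩ hvy
      have hm := h.stop_mem hc hS
      have hmain : ∀ a b, A c a b → ¬ S c a b →
          globalArc C M D x A a b ∧ ¬ globalStop M S a b := fun a b h1 h2 =>
        ⟨Or.inl ⟨c, hc, h1⟩, fun h3 => h2 (h.stop_inside h3 ((h.sol c hc).arc_mem _ _ h1).2)⟩
      rcases (h.sol c hc).amenable u v hS (fun hs => (h.isSink_iff hc hm.2).1 hs y hvy) with
        h1 | ⟨q, hq, hq', h1 | ⟨t, ht, ht', h1⟩⟩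
      · exact Or.inl h1
      · exact Or.inr ⟨q, (hmain _ _ hq hq').1, (hmain _ _ hq hq').2, Or.inl h1⟩
      · exact Or.inr ⟨q, (hmain _ _ hq hq').1, (hmain _ _ hq hq').2,
          Or.inr ⟨t, (hmain _ _ ht ht').1, (hmain _ _ ht ht').2, h1⟩⟩

end Exchange

/-! ### The Boolean tests as propositions -/

namespace Local

/-- The conditions on a solution, spelt out. -/
structure Solution.Spec (s : Solution) (c : Config) : Prop where
  card : (edgeCount c.n s.f₁ = 1 ∧ edgeCount c.n s.f₂ = 0) ∨ (c.n = 4 ∧ edgeCount c.n s.f₁ = 2 ∧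
    edgeCount c.n s.f₂ = 1 ∧ ∀ i < c.n, ∀ j < c.n, s.f₂ i j = true → mate i j = false)
  degree : ∀ v < c.n, sumBelow c.n (s.f₂ v) + ((if v = c.x then 1 else 0) +
    (if c.gone v = true then 1 else 0)) ≤ sumBelow c.n (s.f₁ v) + 1
  side : ∀ i < c.n, ∀ j < c.n, s.f₁ i j = true → side c.n i j = true
  not_mate : ∀ i < c.n, ∀ j < c.n, s.f₁ i j = true → c.rest i j = true → mate i j = false
  removed : ∀ i < c.n, ∀ j < c.n, s.f₂ i j = true → c.rest i j = true ∧ s.f₁ i j = false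
  edge : ∀ i < c.n, ∀ j < c.n, ((c.rest i j = true ∨ s.f₁ i j = true) ∧ s.f₂ i j = false ↔
    s.next i = j ∨ s.next j = i)
  asymm : ∀ i < c.n, ∀ j < c.n, s.next i = j → s.next j ≠ i
  pred : ∀ i < c.n, ∀ j < c.n, s.next i = j → s.pred₁ j = i ∨ s.pred₂ j = i
  next_pred₁ : ∀ v < c.n, s.pred₁ v < c.n → s.next (s.pred₁ v) = v
  next_pred₂ : ∀ v < c.n, s.pred₂ v < c.n → s.next (s.pred₂ v) = v ∧ s.pred₁ v ≠ s.pred₂ v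
  keptOut : ∀ v < c.n, s.next v < c.n → c.keptOut v = false
  keptIn : ∀ v < c.n, c.keptIn v = true → ¬ s.pred₂ v < c.n
  halt_main : ∀ v < c.n, s.halt c v < c.n → c.keptIn v = true ∨ s.main c v < c.n
  amenable : ∀ v < c.n, s.halt c v < c.n → s.sink c v = true ∨ s.amenableOk c (s.halt c v) v = true
  follow : ∀ v < c.n, s.halt c v < c.n → s.sink c v = true ∨ s.followOk c v = true
  bad : ∀ v < c.n, s.badOk c v = true
  dup : ∀ u < c.n, ∀ v < c.n, s.next u = v → c.rest u v = true → s.f₁ u v = true →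
    s.sink c v = true

theorem inside_eq_true {c : Config} {v : ℕ} : Solution.inside c v = true ↔ v < c.n := by
  rw [Solution.inside, Bool.not_eq_true', ← Bool.not_eq_true, Nat.ble_eq, not_le]

theorem inside_eq_false {c : Config} {v : ℕ} : Solution.inside c v = false ↔ ¬ v < c.n := by
  rw [← inside_eq_true, Bool.not_eq_true]

theorem natBeq_eq_false {a b : ℕ} : Nat.beq a b = false ↔ a ≠ b := by
  rw [← Bool.not_eq_true, Nat.beq_eq]

theorem natBeq_eq_true {a b : ℕ} : Nat.beq a b = true ↔ a = b := by
  rw [Nat.beq_eq]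

theorem Solution.spec {s : Solution} {c : Config} (hn : c.n = 3 ∨ c.n = 4)
    (h₁ : s.edgesOk c = true) (h₂ : s.verticesOk c = true) : s.Spec c := by
  simp only [Solution.edgesOk, Bool.and_eq_true, allBelow_iff hn, Solution.predOk,
    Solution.edgeOk, Solution.countOk, Nat.ble_eq, Nat.beq_eq, Bool.or_eq_true, Bool.not_eq_true',
    inside_eq_false, natBeq_eq_false, Bool.and_eq_false_iff] at h₁
  simp only [Solution.verticesOk, allBelow_iff hn, Solution.vertexOk, Bool.and_eq_true,
    Bool.or_eq_true, Bool.not_eq_true', inside_eq_false, Solution.haltOk, inside_eq_true,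
    Bool.or_eq_false_iff, natBeq_eq_false] at h₂
  obtain ⟨hcard, hpred, hedge⟩ := h₁
  refine ⟨?_, ?_, ?_, ?_, ?_, ?_, ?_, ?_, ?_, ?_, ?_, ?_, ?_, ?_, ?_, ?_, ?_⟩
  · refine hcard.imp id fun ⟨h1, h2, h3, h4⟩ => ⟨h1, h2, h3, fun i hi j hj hij => ?_⟩
    exact (h4 i hi j hj).resolve_left (by rw [hij]; exact Bool.noConfusion)
  · intro v hv
    rcases (h₂ v hv).1 with ⟨h1, h2⟩ | h1
    · rw [if_neg h1, if_neg (by rw [h2]; exact Bool.noConfusion)]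
      exact (hpred v hv).1.1
    · rw [Solution.degreeOk, Nat.ble_eq] at h1
      have e₁ : (if v = c.x then 1 else 0) = (Nat.beq v c.x).toNat := by
        by_cases hx : v = c.x
        · rw [if_pos hx, natBeq_eq_true.2 hx]; rfl
        · rw [if_neg hx, natBeq_eq_false.2 hx]; rfl
      have e₂ : (if c.gone v = true then 1 else 0) = (c.gone v).toNat := by
        cases c.gone v <;> rfl
      rw [e₁, e₂]
      exact h1
  · intro i hi j hj hij
    exact ((hedge i hi j hj).1.resolve_left (by rw [hij]; exact Bool.noConfusion)).1
  · intro i hi j hj hij hr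
    exact ((hedge i hi j hj).1.resolve_left (by rw [hij]; exact Bool.noConfusion)).2.resolve_left
      (by rw [hr]; exact Bool.noConfusion)
  · intro i hi j hj hij
    exact (hedge i hi j hj).2.1.resolve_left (by rw [hij]; exact Bool.noConfusion)
  · intro i hi j hj
    have h1 := (hedge i hi j hj).2.2.1
    rw [← Nat.beq_eq, ← Nat.beq_eq]
    revert h1
    cases c.rest i j <;> cases s.f₁ i j <;> cases s.f₂ i j <;> cases (s.next i).beq j <;>
      cases (s.next j).beq i <;> simp
  · intro i hi j hj hij
    exact ((hedge i hi j hj).2.2.2.resolve_left (not_not.2 hij)).1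
  · intro i hi j hj hij
    exact ((hedge i hi j hj).2.2.2.resolve_left (not_not.2 hij)).2.1
  · intro v hv hp
    exact (hpred v hv).1.2.resolve_left (not_not.2 hp)
  · intro v hv hp
    exact (hpred v hv).2.resolve_left (not_not.2 hp)
  · intro v hv hk
    exact (h₂ v hv).2.1.resolve_left (not_not.2 hk)
  · intro v hv hk
    exact (h₂ v hv).2.2.1.resolve_left (by rw [hk]; exact Bool.noConfusion)
  · intro v hv hs
    exact ((h₂ v hv).2.2.2.1.resolve_left (not_not.2 hs)).1
  · intro v hv hs
    exact ((h₂ v hv).2.2.2.1.resolve_left (not_not.2 hs)).2.imp id And.left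
  · intro v hv hs
    exact ((h₂ v hv).2.2.2.1.resolve_left (not_not.2 hs)).2.imp id And.right
  · intro v hv
    exact (h₂ v hv).2.2.2.2.1
  · intro u hu v hv huv hr hf
    have h3 : c.n = 3 := by
      refine ((hedge u hu v hv).2.2.2.resolve_left (not_not.2 huv)).2.2.resolve_left ?_
      rw [hr, hf]
      rintro (h | h) <;> cases h
    have h4 := (h₂ v hv).2.2.2.2.2
    rw [Solution.doubleOk, Bool.or_eq_true, Nat.beq_eq, h3] at h4
    have h5 := h4.resolve_left (by norm_num)
    rw [← h3, allBelow_iff hn] at h5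
    have h6 := h5 u hu
    rw [natBeq_eq_true.2 huv, hr, hf] at h6
    exact h6

end Local
open Local

/-! ### Numberings of the vertices of a kite -/

section Labeling

variable {V : Type*} {C M : SimpleGraph V}

/-- A numbering of the vertices of a kite such that `01` (and `23`) are its edges of `M`. -/
structure IsLabeling (M : SimpleGraph V) (c : C.ConnectedComponent) (n : ℕ) (l : ℕ → V) : Prop where
  size : (n = 3 ∧ IsThreeKite M c) ∨ (n = 4 ∧ IsFourKite M c)
  mem : ∀ v, v ∈ c.supp ↔ ∃ i < n, l i = v
  inj : ∀ i < n, ∀ j < n, l i = l j → i = j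
  side : ∀ i < n, ∀ j < n, i ≠ j → side n i j = true → C.Adj (l i) (l j)
  mate : ∀ i < n, ∀ j < n, (mate i j = true ↔ M.Adj (l i) (l j))

/-- The edges between numbered vertices that are selected by `f`. -/
def edgesOf (n : ℕ) (l : ℕ → V) (f : ℕ → ℕ → Bool) : Set (Sym2 V) :=
  {e | ∃ i < n, ∃ j < n, i ≠ j ∧ f i j = true ∧ e = s(l i, l j)}

variable {c : C.ConnectedComponent} {n : ℕ} {l : ℕ → V}

theorem IsLabeling.size' (hl : IsLabeling M c n l) : n = 3 ∨ n = 4 :=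
  hl.size.imp And.left And.left

theorem IsLabeling.mem_supp (hl : IsLabeling M c n l) {i : ℕ} (hi : i < n) : l i ∈ c.supp :=
  (hl.mem _).2 ⟨i, hi, rfl⟩

theorem IsLabeling.mem_edgesOf (hl : IsLabeling M c n l) {f : ℕ → ℕ → Bool}
    (hf : ∀ i j, f i j = f j i) {i j : ℕ} (hi : i < n) (hj : j < n) :
    s(l i, l j) ∈ edgesOf n l f ↔ i ≠ j ∧ f i j = true := by
  constructor
  · rintro ⟨a, ha, b, hb, hab, hfab, he⟩
    rcases Sym2.eq_iff.1 he with ⟨h1, h2⟩ | ⟨h1, h2⟩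
    · obtain rfl := hl.inj _ hi _ ha h1
      obtain rfl := hl.inj _ hj _ hb h2
      exact ⟨hab, hfab⟩
    · obtain rfl := hl.inj _ hi _ hb h1
      obtain rfl := hl.inj _ hj _ ha h2
      exact ⟨hab.symm, by rwa [hf]⟩
  · rintro ⟨h1, h2⟩
    exact ⟨i, hi, j, hj, h1, h2, rfl⟩

theorem IsLabeling.edgesOf_inside (hl : IsLabeling M c n l) {f : ℕ → ℕ → Bool} {e : Sym2 V}
    (he : e ∈ edgesOf n l f) : e ∈ inside c := by
  obtain ⟨i, hi, j, hj, hij, -, rfl⟩ := he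
  exact mem_inside.2 ⟨fun h => hij (hl.inj _ hi _ hj h), hl.mem_supp hi, hl.mem_supp hj⟩

theorem IsLabeling.ncard_edgesOf (hl : IsLabeling M c n l) {f : ℕ → ℕ → Bool}
    (hf : ∀ i j, f i j = f j i) : (edgesOf n l f).ncard = edgeCount n f := by
  let P : Finset (ℕ × ℕ) := (Finset.range n ×ˢ Finset.range n).filter fun p => p.1 < p.2
  have h1 : edgesOf n l f =
      ((P.filter fun p => f p.1 p.2 = true).image fun p => s(l p.1, l p.2) : Finset (Sym2 V)) := by
    ext e
    simp only [Finset.coe_image, Set.mem_image, Finset.mem_coe, Finset.mem_filter, P,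
      Finset.mem_product, Finset.mem_range, Prod.exists]
    constructor
    · rintro ⟨i, hi, j, hj, hij, hfij, rfl⟩
      rcases lt_or_gt_of_ne hij with h | h
      · exact ⟨i, j, ⟨⟨⟨hi, hj⟩, h⟩, hfij⟩, rfl⟩
      · exact ⟨j, i, ⟨⟨⟨hj, hi⟩, h⟩, by rwa [hf]⟩, Sym2.eq_swap⟩
    · rintro ⟨i, j, ⟨⟨⟨hi, hj⟩, h⟩, hfij⟩, rfl⟩
      exact ⟨i, hi, j, hj, h.ne, hfij, rfl⟩
  rw [h1, Set.ncard_coe_finset, Finset.card_image_of_injOn]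
  · rw [Finset.card_filter]
    have h2 : ∀ b : Bool, (if b = true then 1 else 0) = b.toNat := by
      intro b; cases b <;> rfl
    simp only [h2]
    rcases hl.size' with rfl | rfl
    · have hP : P = {(0, 1), (0, 2), (1, 2)} := by simp only [P]; decide
      have h3 : Nat.ble 3 3 = true := rfl
      rw [hP, Finset.sum_insert (by decide), Finset.sum_insert (by decide), Finset.sum_singleton]
      simp only [edgeCount, h3, cond_true, Nat.add_eq, add_zero]
    · have hP : P = {(0, 1), (0, 2), (1, 2), (0, 3), (1, 3), (2, 3)} := by simp only [P]; decide
      have h3 : Nat.ble 4 3 = false := rfl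
      rw [hP, Finset.sum_insert (by decide), Finset.sum_insert (by decide),
        Finset.sum_insert (by decide), Finset.sum_insert (by decide), Finset.sum_insert (by decide),
        Finset.sum_singleton]
      simp only [edgeCount, h3, cond_false, Nat.add_eq, add_assoc]
  · rintro ⟨a, b⟩ hab ⟨a', b'⟩ hab' h
    simp only [Finset.mem_coe, Finset.mem_filter, P, Finset.mem_product, Finset.mem_range] at hab hab'
    obtain ⟨⟨⟨ha, hb⟩, hlt⟩, -⟩ := hab
    obtain ⟨⟨⟨ha', hb'⟩, hlt'⟩, -⟩ := hab'
    rcases Sym2.eq_iff.1 h with ⟨h1, h2⟩ | ⟨h1, h2⟩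
    · rw [hl.inj _ ha _ ha' h1, hl.inj _ hb _ hb' h2]
    · have := hl.inj _ ha _ hb' h1
      have := hl.inj _ hb _ ha' h2
      omega

theorem IsLabeling.ncard_image (hl : IsLabeling M c n l) (f : ℕ → Bool) :
    {v | ∃ i < n, l i = v ∧ f i = true}.ncard = sumBelow n f := by
  have h1 : {v | ∃ i < n, l i = v ∧ f i = true} =
      (((Finset.range n).filter fun i => f i = true).image l : Finset V) := by
    ext v
    simp only [Finset.coe_image, Set.mem_image, Finset.mem_coe, Finset.mem_filter, Finset.mem_range]
    constructor
    · rintro ⟨i, hi, rfl, hf⟩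
      exact ⟨i, ⟨hi, hf⟩, rfl⟩
    · rintro ⟨i, ⟨hi, hf⟩, rfl⟩
      exact ⟨i, hi, rfl, hf⟩
  rw [h1, Set.ncard_coe_finset, Finset.card_image_of_injOn, Finset.card_filter, sumBelow_eq hl.size']
  · refine Finset.sum_congr rfl fun i _ => ?_
    cases f i <;> rfl
  · intro i hi j hj hij
    simp only [Finset.mem_coe, Finset.mem_filter, Finset.mem_range] at hi hj
    exact hl.inj _ hi.1 _ hj.1 hij

theorem IsLabeling.ncard_edgesOf_vertex (hl : IsLabeling M c n l) {f : ℕ → ℕ → Bool}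
    (hf : ∀ i j, f i j = f j i) {v : ℕ} (hv : v < n) (hvv : f v v = false) :
    {e ∈ edgesOf n l f | l v ∈ e}.ncard = sumBelow n (f v) := by
  rw [← hl.ncard_image]
  symm
  refine Set.ncard_congr (fun u _ => s(l v, u)) ?_ ?_ ?_
  · rintro _ ⟨i, hi, rfl, hfi⟩
    refine ⟨(hl.mem_edgesOf hf hv hi).2 ⟨?_, hfi⟩, Sym2.mem_mk_left _ _⟩
    rintro rfl
    rw [hvv] at hfi
    cases hfi
  · intro a b _ _ h
    exact Sym2.congr_right.1 h
  · rintro e ⟨⟨i, hi, j, hj, hij, hfij, rfl⟩, hm⟩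
    rcases Sym2.mem_iff.1 hm with h | h
    · obtain rfl := hl.inj _ hv _ hi h
      exact ⟨l j, ⟨j, hj, rfl, hfij⟩, rfl⟩
    · obtain rfl := hl.inj _ hv _ hj h
      exact ⟨l i, ⟨i, hi, rfl, by rwa [hf]⟩, Sym2.eq_swap⟩

end Labeling

/-! ### From numbered solutions to solutions in the graph -/

section Transport

variable {V : Type*} {C M : SimpleGraph V} {T : SimpleGraph (V ⊕ Sym2 V)} {D : V → V → Prop}
  {B : Set (Sym2 V)} {c : C.ConnectedComponent} {l : ℕ → V} {k : Config} {s : Solution}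
  {gone allowed : Set V}

theorem Local.Solution.Spec.isKiteSolution (hs : s.Spec k) (hsym : s.IsSymm)
    (hl : IsLabeling M c k.n l) (hx : k.x < k.n)
    (hrest : ∀ i < k.n, ∀ j < k.n, i ≠ j → (k.rest i j = true ↔ s(l i, l j) ∈ B))
    (hused : ∀ i < k.n, ∀ j < k.n, (k.used i j = true ↔ UsesAt T (l i) (l j)))
    (hin : ∀ i < k.n, (k.keptIn i = true ↔ KeptIn C M D gone (l i)))
    (hout : ∀ i < k.n, (k.keptOut i = true ↔ KeptOut C M D (l k.x) (l i)))
    (hgone : ∀ i < k.n, (k.gone i = true ↔ l i ∈ gone))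
    (hallowed : ∀ i < k.n, k.allowed i = true → l i ∈ allowed) :
    IsKiteSolution M T D B c (l k.x) gone allowed (edgesOf k.n l s.f₁) (edgesOf k.n l s.f₂)
      (fun u v => ∃ i < k.n, ∃ j < k.n, u = l i ∧ v = l j ∧ s.next i = j)
      (fun u v => ∃ i < k.n, ∃ j < k.n, u = l i ∧ v = l j ∧ s.halt k j = i) := by
  set A : V → V → Prop := fun u v => ∃ i < k.n, ∃ j < k.n, u = l i ∧ v = l j ∧ s.next i = j with hA
  set S : V → V → Prop := fun u v => ∃ i < k.n, ∃ j < k.n, u = l i ∧ v = l j ∧ s.halt k j = i with hS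
  have hAi : ∀ i < k.n, ∀ j < k.n, (A (l i) (l j) ↔ s.next i = j) := by
    intro i hi j hj
    constructor
    · rintro ⟨a, ha, b, hb, h1, h2, h3⟩
      rwa [hl.inj _ hi _ ha h1, hl.inj _ hj _ hb h2]
    · exact fun h => ⟨i, hi, j, hj, rfl, rfl, h⟩
  have hSi : ∀ i < k.n, ∀ j < k.n, (S (l i) (l j) ↔ s.halt k j = i) := by
    intro i hi j hj
    constructor
    · rintro ⟨a, ha, b, hb, h1, h2, h3⟩
      rwa [hl.inj _ hi _ ha h1, hl.inj _ hj _ hb h2]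
    · exact fun h => ⟨i, hi, j, hj, rfl, rfl, h⟩
  have stop_arc : ∀ v < k.n, s.halt k v < k.n → s.next (s.halt k v) = v := by
    intro v hv h
    unfold Solution.halt at h ⊢
    cases hk : k.keptIn v
    · rw [hk] at h
      exact (hs.next_pred₂ v hv h).1
    · rw [hk] at h
      exact hs.next_pred₁ v hv h
  -- Of the predecessors of a vertex exactly the halting one is no main predecessor. A kept incoming
  -- boundary edge takes the main role, which the value 4, never below n, encodes.
  have main_iff : ∀ i < k.n, ∀ j < k.n, (s.next i = j ∧ s.halt k j ≠ i ↔ s.main k j = i) := by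
    intro i hi j hj
    unfold Solution.halt Solution.main
    cases hk : k.keptIn j
    · simp only [cond_false]
      constructor
      · rintro ⟨h1, h2⟩
        exact (hs.pred i hi j hj h1).resolve_right h2
      · rintro rfl
        refine ⟨hs.next_pred₁ j hj hi, fun h => ?_⟩
        exact (hs.next_pred₂ j hj (h.symm ▸ hi)).2 h.symm
    · simp only [cond_true]
      constructor
      · rintro ⟨h1, h2⟩
        have h3 := (hs.pred i hi j hj h1).resolve_left h2
        exact absurd (h3.symm ▸ hi) (hs.keptIn j hj hk)
      · rintro rfl
        have := hl.size'
        omega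
  have main_kept : ∀ v < k.n, s.main k v < k.n → k.keptIn v = false := by
    intro v hv h
    unfold Solution.main at h
    by_contra hk
    rw [Bool.not_eq_false] at hk
    rw [hk, cond_true] at h
    have := hl.size'
    omega
  have hsink : ∀ v < k.n, (IsSink C M D (l k.x) A (l v) ↔ s.sink k v = true) := by
    intro v hv
    unfold IsSink Solution.sink
    rw [Bool.and_eq_true, Bool.not_eq_true', Bool.not_eq_true', inside_eq_false,
      ← hout v hv, Bool.not_eq_true]
    refine and_congr_left fun _ => ⟨fun h1 h2 => ?_, ?_⟩
    · exact h1 (l (s.next v)) ((hAi _ hv _ h2).2 rfl)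
    · rintro h1 u ⟨i, hi, j, hj, h2, -, rfl⟩
      rw [hl.inj _ hv _ hi h2] at h1
      exact h1 hj
  have hmain : ∀ i < k.n, ∀ j < k.n, (A (l i) (l j) ∧ ¬ S (l i) (l j) ↔ s.main k j = i) := by
    intro i hi j hj
    rw [hAi i hi j hj, hSi i hi j hj, ← main_iff i hi j hj]
  have hbad : ∀ v < k.n, (IsBad M S (l v) ↔ s.bad k v = true) := by
    intro v hv
    unfold IsBad Solution.bad
    rw [Bool.and_eq_true, inside_eq_true]
    constructor
    · rintro ⟨_, ⟨i, hi, j, hj, rfl, h1, h2⟩, h3⟩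
      obtain rfl := hl.inj _ hv _ hj h1
      rw [h2]
      exact ⟨hi, (hl.mate _ hi _ hv).2 h3⟩
    · rintro ⟨h1, h2⟩
      exact ⟨_, (hSi _ h1 _ hv).2 rfl, (hl.mate _ h1 _ hv).1 h2⟩
  have hnk : ∀ v < k.n, (¬ KeptIn C M D gone (l v) ↔ k.keptIn v = false) := by
    intro v hv
    rw [← hin v hv, Bool.not_eq_true]
  refine ⟨?_, ?_, ?_, ?_, ?_, ?_, ?_, ?_, ?_, ?_, ?_, ?_, ?_, ?_, ?_, ?_, ?_, ?_⟩
  · rintro u v ⟨i, hi, j, hj, rfl, rfl, -⟩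
    exact ⟨hl.mem_supp hi, hl.mem_supp hj⟩
  · intro e he
    refine ⟨hl.edgesOf_inside he, ?_⟩
    obtain ⟨i, hi, j, hj, hij, hf, rfl⟩ := he
    refine ⟨hl.side i hi j hj hij (hs.side i hi j hj hf), fun hb hm => ?_⟩
    have h1 := hs.not_mate i hi j hj hf ((hrest i hi j hj hij).2 hb)
    have h2 := (hl.mate i hi j hj).2 hm
    rw [h1] at h2
    cases h2
  · intro e he
    refine ⟨hl.edgesOf_inside he, ?_⟩
    obtain ⟨i, hi, j, hj, hij, hf, rfl⟩ := he
    obtain ⟨h1, h2⟩ := hs.removed i hi j hj hf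
    refine ⟨(hrest i hi j hj hij).1 h1, fun h3 => ?_⟩
    have h4 := ((hl.mem_edgesOf hsym.comm₁ hi hj).1 h3).2
    rw [h2] at h4
    cases h4
  · rw [hl.ncard_edgesOf hsym.comm₁, hl.ncard_edgesOf hsym.comm₂]
    rcases hs.card with ⟨h1, h2⟩ | ⟨h1, h2, h3, h4⟩
    · refine Or.inl ⟨h1, ?_⟩
      rw [← hl.ncard_edgesOf hsym.comm₂] at h2
      refine (Set.ncard_eq_zero ?_).1 h2
      have hfin : edgesOf k.n l s.f₂ ⊆
          (fun p : ℕ × ℕ => s(l p.1, l p.2)) '' (Set.Iio k.n ×ˢ Set.Iio k.n) := by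
        rintro e ⟨i, hi, j, hj, -, -, rfl⟩
        exact ⟨(i, j), ⟨hi, hj⟩, rfl⟩
      exact (((Set.finite_Iio _).prod (Set.finite_Iio _)).image _).subset hfin
    · refine Or.inr ⟨?_, h2, h3, ?_⟩
      · rcases hl.size with ⟨h5, -⟩ | ⟨-, h5⟩
        · omega
        · exact h5
      · rw [Set.disjoint_left]
        rintro e ⟨i, hi, j, hj, hij, hf, rfl⟩ hm
        have h5 := (hl.mate i hi j hj).2 hm
        rw [h4 i hi j hj hf] at h5
        cases h5
  · intro v hv
    obtain ⟨i, hi, rfl⟩ := (hl.mem v).1 hv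
    rw [hl.ncard_edgesOf_vertex hsym.comm₁ hi (hsym.self₁ i),
      hl.ncard_edgesOf_vertex hsym.comm₂ hi (hsym.self₂ i)]
    have h1 := hs.degree i hi
    have h2 : (l i = l k.x) ↔ i = k.x := ⟨fun h => hl.inj _ hi _ hx h, fun h => h ▸ rfl⟩
    simp only [h2, ← hgone i hi]
    exact h1
  · intro u hu v hv huv
    obtain ⟨i, hi, rfl⟩ := (hl.mem u).1 hu
    obtain ⟨j, hj, rfl⟩ := (hl.mem v).1 hv
    have hij : i ≠ j := fun h => huv (h ▸ rfl)
    rw [hAi i hi j hj, hAi j hj i hi, ← hs.edge i hi j hj, Set.mem_sdiff, Set.mem_union,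
      hl.mem_edgesOf hsym.comm₁ hi hj, hl.mem_edgesOf hsym.comm₂ hi hj, hrest i hi j hj hij,
      and_iff_right hij, and_iff_right hij, Bool.not_eq_true]
  · rintro u v ⟨i, hi, j, hj, rfl, rfl, h⟩ h'
    exact hs.asymm i hi j hj h ((hAi _ hj _ hi).1 h')
  · rintro u v w ⟨i, hi, j, hj, rfl, rfl, rfl⟩ ⟨i', hi', j', hj', h1, rfl, rfl⟩
    rw [hl.inj _ hi _ hi' h1]
  · rintro u v ⟨i, hi, j, hj, rfl, rfl, rfl⟩ hk
    have h1 := (hout i hi).2 hk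
    rw [hs.keptOut i hi hj] at h1
    cases h1
  · rintro u v ⟨i, hi, j, hj, rfl, rfl, rfl⟩
    exact (hAi _ hi _ hj).2 (stop_arc j hj hi)
  · rintro u v w ⟨i, hi, j, hj, rfl, rfl, h1⟩ h1' ⟨i', hi', j', hj', rfl, h2, h3⟩ h2'
    obtain rfl := hl.inj _ hj _ hj' h2
    have e₁ := (hmain i hi j hj).1 ⟨(hAi _ hi _ hj).2 h1, h1'⟩
    have e₂ := (hmain i' hi' j hj).1 ⟨(hAi _ hi' _ hj).2 h3, h2'⟩
    rw [← e₁, ← e₂]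
  · rintro u v ⟨i, hi, j, hj, rfl, rfl, h1⟩ h1'
    rw [hnk j hj]
    have e₁ := (hmain i hi j hj).1 ⟨(hAi _ hi _ hj).2 h1, h1'⟩
    exact main_kept j hj (e₁.symm ▸ hi)
  · rintro u v w ⟨i, hi, j, hj, rfl, rfl, rfl⟩ ⟨i', hi', j', hj', rfl, h2, rfl⟩
    rw [hl.inj _ hj _ hj' h2]
  · rintro u v ⟨i, hi, j, hj, rfl, rfl, rfl⟩
    refine (hs.halt_main j hj hi).imp (hin j hj).1 fun h => ?_
    exact ⟨_, (hmain _ h j hj).2 rfl⟩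
  · rintro u v ⟨i, hi, j, hj, rfl, rfl, rfl⟩ hu hns
    rw [hsink j hj] at hns
    have h1 := (hs.follow j hj hi).resolve_left hns
    rw [Solution.followOk, (hused j hj _ hi).2 hu] at h1
    simp only [Bool.not_true, Bool.false_or, Bool.and_eq_true, Bool.not_eq_true', Bool.or_eq_true,
      inside_eq_false] at h1
    obtain ⟨h1, h2, h3, h4⟩ := h1
    refine ⟨(hnk j hj).2 h1, fun hk => ?_, ?_, ?_⟩
    · have := (hout j hj).2 hk
      rw [h2] at this
      cases this
    · rintro w ⟨a, ha, b, hb, rfl, h5, h6⟩ h7 h8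
      obtain rfl := hl.inj _ hj _ hb h5
      have h9 := (hmain a ha j hj).1 ⟨(hAi _ ha _ hj).2 h6, h7⟩
      rw [h9, (hused j hj a ha).2 h8] at h3
      rcases h3 with h3 | h3
      · exact h3 ha
      · cases h3
    · rintro w ⟨a, ha, b, hb, h5, rfl, rfl⟩ h8
      obtain rfl := hl.inj _ hj _ ha h5
      rw [(hused j hj _ hb).2 h8] at h4
      rcases h4 with h4 | h4
      · exact h4 hb
      · cases h4
  · rintro u v ⟨i, hi, j, hj, rfl, rfl, rfl⟩ hns
    rw [hsink j hj] at hns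
    have h1 := (hs.amenable j hj hi).resolve_left hns
    simp only [Solution.amenableOk, Bool.or_eq_true, Bool.and_eq_true, inside_eq_true] at h1
    refine h1.imp (hl.mate _ hi _ hj).1 ?_
    rintro ⟨h2, h3⟩
    refine ⟨_, ((hmain _ h2 _ hi).2 rfl).1, ((hmain _ h2 _ hi).2 rfl).2,
      h3.imp (hl.mate _ h2 _ hi).1 ?_⟩
    rintro ⟨h4, h5⟩
    exact ⟨_, ((hmain _ h4 _ h2).2 rfl).1, ((hmain _ h4 _ h2).2 rfl).2,
      ((hl.mate _ h4 _ hi).1 h5).symm⟩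
  · intro v hv hns
    obtain ⟨p, ⟨i, hi, j, hj, rfl, rfl, h1⟩, hp⟩ := hv
    have hb : s.bad k j = true := (hbad j hj).1 ⟨_, (hSi _ hi _ hj).2 h1, hp⟩
    rw [hsink j hj] at hns
    have h2 := hs.bad j hj
    rw [Solution.badOk, hb] at h2
    simp only [Bool.not_true, Bool.false_or, Bool.or_eq_true, Bool.and_eq_true, inside_eq_true,
      Bool.not_eq_true'] at h2
    rcases h2.resolve_left hns with ⟨h3, h4, h5⟩ | ⟨h3, h4⟩ | ⟨h3, h4⟩
    · exact Or.inl ⟨(hin j hj).1 h3, (hout j hj).1 h4, hallowed j hj h5⟩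
    · refine Or.inr (Or.inl ⟨l (s.next j), (hAi _ hj _ h3).2 rfl, ?_⟩)
      rw [hbad _ h3, h4]
      exact Bool.noConfusion
    · refine Or.inr (Or.inr ⟨l (s.main k j), ((hmain _ h3 _ hj).2 rfl).1,
        ((hmain _ h3 _ hj).2 rfl).2, ?_⟩)
      rw [hbad _ h3, h4]
      exact Bool.noConfusion
  · rintro u v ⟨i, hi, j, hj, rfl, rfl, h1⟩ hB hF
    obtain ⟨hij, hf⟩ := (hl.mem_edgesOf hsym.comm₁ hi hj).1 hF
    exact (hsink j hj).2 (hs.dup i hi j hj h1 ((hrest i hi j hj hij).2 hB) hf)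

end Transport

/-! ### Existence of numberings -/

section ExistsLabeling

variable {V : Type*} {C M : SimpleGraph V} {c : C.ConnectedComponent}

theorem mem_supp_of_adj {u v : V} (hu : u ∈ c.supp) (h : C.Adj u v) : v ∈ c.supp :=
  (c.mem_supp_congr_adj h).1 hu

theorem adj_of_isThreeKite [Finite V] (hC : IsCycleCover C) (hc : c.supp.ncard = 3) {u v : V}
    (hu : u ∈ c.supp) (hv : v ∈ c.supp) (huv : u ≠ v) : C.Adj u v := by
  have h1 : C.neighborSet u ⊆ c.supp \ {u} := fun w hw =>
    ⟨mem_supp_of_adj hu hw, fun h => C.loopless.irrefl u (by rw [← h] at hw; exact h ▸ hw)⟩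
  have h2 : (c.supp \ {u}).ncard = 2 := by
    rw [Set.ncard_sdiff_singleton_of_mem hu, hc]
  have h3 := Set.eq_of_subset_of_ncard_le h1 (by rw [h2, hC u])
  have : v ∈ C.neighborSet u := by
    rw [h3]
    exact ⟨hv, huv.symm⟩
  exact this

theorem exists_labeling_three [Finite V] (hC : IsCycleCover C) (hM : IsPerfectMatching M)
    (hc : IsThreeKite M c) : ∃ l, IsLabeling M c 3 l := by
  obtain ⟨e, he⟩ := Set.ncard_eq_one.1 hc.2
  have hmem : e ∈ M.edgeSet ∩ inside c := by rw [he]; rfl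
  induction e using Sym2.ind with
  | _ a b =>
    obtain ⟨hab, hin⟩ := hmem
    obtain ⟨hne, ha, hb⟩ := mem_inside.1 hin
    have hab : M.Adj a b := hab
    obtain ⟨w, hw, hwab⟩ : ∃ w ∈ c.supp, w ∉ ({a, b} : Set V) :=
      Set.exists_mem_notMem_of_ncard_lt_ncard (by rw [Set.ncard_pair hne, hc.1]; norm_num)
    simp only [Set.mem_insert_iff, Set.mem_singleton_iff, not_or] at hwab
    have hset : c.supp = {a, b, w} := by
      refine (Set.eq_of_subset_of_ncard_le ?_ ?_).symm
      · rintro x (rfl | rfl | rfl) <;> assumption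
      · rw [hc.1, Set.ncard_eq_three.2 ⟨a, b, w, hne, Ne.symm hwab.1, Ne.symm hwab.2, rfl⟩]
    have hwa : ¬ M.Adj w a := fun h => hwab.2 (hM.eq_of_adj h.symm hab)
    have hwb : ¬ M.Adj w b := fun h => hwab.1 (hM.eq_of_adj h.symm hab.symm)
    let l : ℕ → V := fun i => if i = 0 then a else if i = 1 then b else w
    have l0 : l 0 = a := rfl
    have l1 : l 1 = b := rfl
    have l2 : l 2 = w := rfl
    have hlm : ∀ i < 3, l i ∈ c.supp := by
      intro i hi
      interval_cases i
      · exact ha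
      · exact hb
      · exact hw
    have hinj : ∀ i < 3, ∀ j < 3, l i = l j → i = j := by
      intro i hi j hj h
      interval_cases i <;> interval_cases j <;> simp only [l0, l1, l2] at h <;>
        first
        | rfl
        | exact absurd h hne
        | exact absurd h hne.symm
        | exact absurd h hwab.1
        | exact absurd h (Ne.symm hwab.1)
        | exact absurd h hwab.2
        | exact absurd h (Ne.symm hwab.2)
    refine ⟨l, Or.inl ⟨rfl, hc⟩, ?_, hinj, ?_, ?_⟩
    · intro v
      rw [hset]
      constructor
      · rintro (rfl | rfl | rfl)
        · exact ⟨0, by norm_num, rfl⟩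
        · exact ⟨1, by norm_num, rfl⟩
        · exact ⟨2, by norm_num, rfl⟩
      · rintro ⟨i, hi, rfl⟩
        rw [← hset]
        exact hlm i hi
    · intro i hi j hj hij _
      exact adj_of_isThreeKite hC hc.1 (hlm i hi) (hlm j hj) fun h => hij (hinj i hi j hj h)
    · have m01 : mate 0 1 = true := rfl
      intro i hi j hj
      interval_cases i <;> interval_cases j <;> simp only [l0, l1, l2] <;>
        first
        | exact iff_of_true rfl hab
        | exact iff_of_true rfl hab.symm
        | exact iff_of_false Bool.noConfusion (M.loopless.irrefl _)
        | exact iff_of_false Bool.noConfusion hwa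
        | exact iff_of_false Bool.noConfusion hwb
        | exact iff_of_false Bool.noConfusion fun h => hwa h.symm
        | exact iff_of_false Bool.noConfusion fun h => hwb h.symm

/-- Two edges of a matching are disjoint, so they cover all four vertices. -/
theorem exists_mate_of_isFourKite [Finite V] (hM : IsPerfectMatching M) (hc : IsFourKite M c) {v : V}
    (hv : v ∈ c.supp) : ∃ w ∈ c.supp, M.Adj v w := by
  obtain ⟨e, f, hef, hE⟩ := Set.ncard_eq_two.1 hc.2
  have he : e ∈ M.edgeSet ∩ inside c := by rw [hE]; exact Or.inl rfl
  have hf : f ∈ M.edgeSet ∩ inside c := by rw [hE]; exact Or.inr rfl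
  clear hE
  induction e using Sym2.ind with
  | _ a b =>
  induction f using Sym2.ind with
  | _ p q =>
    obtain ⟨hab, hin⟩ := he
    obtain ⟨hne, ha, hb⟩ := mem_inside.1 hin
    obtain ⟨hpq, hin'⟩ := hf
    obtain ⟨hne', hp, hq⟩ := mem_inside.1 hin'
    have hab : M.Adj a b := hab
    have hpq : M.Adj p q := hpq
    have h1 : p ≠ a := by
      rintro rfl
      exact hef (by rw [hM.eq_of_adj hab hpq])
    have h2 : p ≠ b := by
      rintro rfl
      exact hef (by rw [hM.eq_of_adj hab.symm hpq, Sym2.eq_swap])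
    have h3 : q ≠ a := by
      rintro rfl
      exact hef (by rw [hM.eq_of_adj hab hpq.symm, Sym2.eq_swap])
    have h4 : q ≠ b := by
      rintro rfl
      exact hef (by rw [hM.eq_of_adj hab.symm hpq.symm])
    have hcard : ({q, p, b, a} : Set V).ncard = 4 := by
      rw [Set.ncard_insert_of_notMem, Set.ncard_insert_of_notMem, Set.ncard_pair hne.symm]
      · simp only [Set.mem_insert_iff, Set.mem_singleton_iff, not_or]
        exact ⟨h2, h1⟩
      · simp only [Set.mem_insert_iff, Set.mem_singleton_iff, not_or]
        exact ⟨hne'.symm, h4, h3⟩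
    have hset : ({q, p, b, a} : Set V) = c.supp := by
      refine Set.eq_of_subset_of_ncard_le ?_ (by rw [hcard, hc.1])
      rintro x (rfl | rfl | rfl | rfl) <;> assumption
    rw [← hset] at hv
    rcases hv with rfl | rfl | rfl | rfl
    · exact ⟨p, hp, hpq.symm⟩
    · exact ⟨q, hq, hpq⟩
    · exact ⟨a, ha, hab.symm⟩
    · exact ⟨b, hb, hab⟩

theorem exists_other_neighbor (hC : IsCycleCover C) {u v : V} (h : C.Adj u v) :
    ∃ w, C.Adj u w ∧ w ≠ v ∧ ∀ z, C.Adj u z → z = v ∨ z = w := by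
  obtain ⟨a, b, hab, hE⟩ := Set.ncard_eq_two.1 (hC u)
  have hmem : ∀ z, C.Adj u z ↔ z = a ∨ z = b := fun z => by
    change z ∈ C.neighborSet u ↔ _
    rw [hE]
    rfl
  rcases (hmem v).1 h with rfl | rfl
  · exact ⟨b, (hmem b).2 (Or.inr rfl), hab.symm, fun z hz => (hmem z).1 hz⟩
  · exact ⟨a, (hmem a).2 (Or.inl rfl), hab, fun z hz => ((hmem z).1 hz).symm⟩

/-- The prescribed vertex `a`, its mate `b`, and the further neighbours of `b` and `a` on the
4-cycle are numbered 0, 1, 2, 3. The choice of `a` is free, so that 0 can later be a vertex with the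
fewest boundary edges. -/
theorem exists_labeling_four [Finite V] (hC : IsCycleCover C) (hM : IsPerfectMatching M)
    (hc : IsFourKite M c) (hdiag : M.edgeSet ∩ inside c ⊆ C.edgeSet) {a : V} (ha : a ∈ c.supp) :
    ∃ l, IsLabeling M c 4 l ∧ l 0 = a := by
  have hMC : ∀ u v, u ∈ c.supp → v ∈ c.supp → M.Adj u v → C.Adj u v := fun u v hu hv h =>
    hdiag ⟨h, mem_inside.2 ⟨h.ne, hu, hv⟩⟩
  obtain ⟨b, hb, hab⟩ := exists_mate_of_isFourKite hM hc ha
  have hCab := hMC a b ha hb hab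
  obtain ⟨p, hbp, hpa, hbp'⟩ := exists_other_neighbor hC hCab.symm
  obtain ⟨q, haq, hqb, haq'⟩ := exists_other_neighbor hC hCab
  have hp := mem_supp_of_adj hb hbp
  have hq := mem_supp_of_adj ha haq
  obtain ⟨r, hr, hpr⟩ := exists_mate_of_isFourKite hM hc hp
  have hra : r ≠ a := by
    rintro rfl
    exact hbp.ne (hM.eq_of_adj hab hpr.symm)
  have hrb : r ≠ b := by
    rintro rfl
    exact hpa (hM.eq_of_adj hpr.symm hab.symm)
  -- Otherwise `p` would have the neighbours `a` and `b` on the cycle, and also its mate `r`,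
  -- because edges of M inside a 4-kite are sides.
  have hpq : p ≠ q := by
    rintro rfl
    obtain ⟨w, -, -, hw⟩ := exists_other_neighbor hC hbp.symm
    have e₁ := (hw a haq.symm).resolve_left hCab.ne
    have e₂ := (hw r (hMC p r hp hr hpr)).resolve_left hrb
    exact hra (e₂.trans e₁.symm)
  have hcard : ({p, q, b, a} : Set V).ncard = 4 := by
    rw [Set.ncard_insert_of_notMem, Set.ncard_insert_of_notMem, Set.ncard_pair hab.ne']
    · simp only [Set.mem_insert_iff, Set.mem_singleton_iff, not_or]
      exact ⟨hqb, haq.ne'⟩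
    · simp only [Set.mem_insert_iff, Set.mem_singleton_iff, not_or]
      exact ⟨hpq, hbp.ne', hpa⟩
  have hset : ({p, q, b, a} : Set V) = c.supp := by
    refine Set.eq_of_subset_of_ncard_le ?_ (by rw [hcard, hc.1])
    rintro x (rfl | rfl | rfl | rfl) <;> assumption
  have hrq : r = q := by
    have hr' := hr
    rw [← hset] at hr'
    rcases hr' with rfl | rfl | rfl | rfl
    · exact absurd rfl hpr.ne
    · rfl
    · exact absurd rfl hrb
    · exact absurd rfl hra
  subst hrq
  have nap : ¬ M.Adj a p := fun h => hbp.ne (hM.eq_of_adj hab h)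
  have naq : ¬ M.Adj a r := fun h => hqb (hM.eq_of_adj h hab)
  have nbp : ¬ M.Adj b p := fun h => hpa (hM.eq_of_adj h hab.symm)
  have nbq : ¬ M.Adj b r := fun h => hra (hM.eq_of_adj h hab.symm)
  have hCpr := hMC p r hp hr hpr
  let l : ℕ → V := fun i => if i = 0 then a else if i = 1 then b else if i = 2 then p else r
  have l0 : l 0 = a := rfl
  have l1 : l 1 = b := rfl
  have l2 : l 2 = p := rfl
  have l3 : l 3 = r := rfl
  refine ⟨l, ⟨Or.inr ⟨rfl, hc⟩, ?_, ?_, ?_, ?_⟩, rfl⟩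
  · intro v
    constructor
    · rw [← hset]
      rintro (rfl | rfl | rfl | rfl)
      · exact ⟨2, by norm_num, rfl⟩
      · exact ⟨3, by norm_num, rfl⟩
      · exact ⟨1, by norm_num, rfl⟩
      · exact ⟨0, by norm_num, rfl⟩
    · rintro ⟨i, hi, rfl⟩
      interval_cases i
      · exact ha
      · exact hb
      · exact hp
      · exact hr
  · intro i hi j hj h
    interval_cases i <;> interval_cases j <;> simp only [l0, l1, l2, l3] at h <;>
      first
      | rfl
      | exact absurd h hab.ne
      | exact absurd h hab.ne'
      | exact absurd h hpa
      | exact absurd h (Ne.symm hpa)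
      | exact absurd h hbp.ne
      | exact absurd h hbp.ne'
      | exact absurd h hra
      | exact absurd h (Ne.symm hra)
      | exact absurd h hrb
      | exact absurd h (Ne.symm hrb)
      | exact absurd h hpr.ne
      | exact absurd h hpr.ne'
  · intro i hi j hj hij hs
    interval_cases i <;> interval_cases j <;> simp only [l0, l1, l2, l3] <;>
      first
      | exact absurd rfl hij
      | exact hCab
      | exact hCab.symm
      | exact hbp
      | exact hbp.symm
      | exact haq
      | exact haq.symm
      | exact hCpr
      | exact hCpr.symm
      | exact Bool.noConfusion hs
  · intro i hi j hj
    interval_cases i <;> interval_cases j <;> simp only [l0, l1, l2, l3] <;>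
      first
      | exact iff_of_true rfl hab
      | exact iff_of_true rfl hab.symm
      | exact iff_of_true rfl hpr
      | exact iff_of_true rfl hpr.symm
      | exact iff_of_false Bool.noConfusion (M.loopless.irrefl _)
      | exact iff_of_false Bool.noConfusion nap
      | exact iff_of_false Bool.noConfusion naq
      | exact iff_of_false Bool.noConfusion nbp
      | exact iff_of_false Bool.noConfusion nbq
      | exact iff_of_false Bool.noConfusion fun h => nap h.symm
      | exact iff_of_false Bool.noConfusion fun h => naq h.symm
      | exact iff_of_false Bool.noConfusion fun h => nbp h.symm
      | exact iff_of_false Bool.noConfusion fun h => nbq h.symm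

end ExistsLabeling

/-! ### The configuration of a kite and its split -/

section KiteConfig

variable {V : Type*} {C M : SimpleGraph V} {T : SimpleGraph (V ⊕ Sym2 V)} {D : V → V → Prop}
  {c : C.ConnectedComponent} {n : ℕ} {l : ℕ → V}

noncomputable def usedAt (T : SimpleGraph (V ⊕ Sym2 V)) (n : ℕ) (l : ℕ → V) (i j : ℕ) : Bool :=
  decide (i < n ∧ j < n ∧ UsesAt T (l i) (l j))

noncomputable def innAt (C M : SimpleGraph V) (D : V → V → Prop) (n : ℕ) (l : ℕ → V) (i : ℕ) :
    Bool := decide (i < n ∧ ∃ u, boundary C M D u (l i))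

noncomputable def outAt (C M : SimpleGraph V) (D : V → V → Prop) (n : ℕ) (l : ℕ → V) (i : ℕ) :
    Bool := decide (i < n ∧ ∃ u, boundary C M D (l i) u)

theorem boundary_opp {u v : V} :
    boundary C M (fun u v => D v u) u v ↔ boundary C M D v u := by
  unfold boundary
  refine and_congr_right fun _ => not_congr (exists_congr fun c => and_congr_right fun _ => and_comm)

theorem innAt_opp : innAt C M (fun u v => D v u) n l = outAt C M D n l := by
  funext i
  simp only [innAt, outAt, boundary_opp]

theorem outAt_opp : outAt C M (fun u v => D v u) n l = innAt C M D n l := by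
  funext i
  simp only [innAt, outAt, boundary_opp]

theorem not_mem_of_boundary (hc : IsKite M c) {u v : V} (h : boundary C M D u v) (hu : u ∈ c.supp) :
    v ∉ c.supp := fun hv => h.2 ⟨c, hc, hu, hv⟩

theorem IsLabeling.isKite (hl : IsLabeling M c n l) : IsKite M c :=
  hl.size.imp And.right And.right

theorem ncard_boundary_out (hD : IsBalancedOrientation C M T D) (hi : i < n) :
    {v | boundary C M D (l i) v}.ncard = (outAt C M D n l i).toNat := by
  by_cases h : ∃ u, boundary C M D (l i) u
  · have h1 : outAt C M D n l i = true := decide_eq_true ⟨hi, h⟩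
    obtain ⟨u, hu⟩ := h
    rw [h1, Set.ncard_eq_one.2 ⟨u, ?_⟩]
    · rfl
    · ext v
      exact ⟨fun hv => hD.out_unique _ _ _ hv.1 hu.1, fun hv => by rw [Set.mem_singleton_iff.1 hv]; exact hu⟩
  · have h1 : outAt C M D n l i = false := decide_eq_false fun h2 => h h2.2
    have h2 : {v | boundary C M D (l i) v} = ∅ :=
      Set.eq_empty_of_forall_notMem fun v hv => h ⟨v, hv⟩
    rw [h1, h2, Set.ncard_empty]
    rfl

theorem ncard_boundary_in (hD : IsBalancedOrientation C M T D) (hi : i < n) :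
    {v | boundary C M D v (l i)}.ncard = (innAt C M D n l i).toNat := by
  have := ncard_boundary_out (l := l) hD.opp hi
  rw [outAt_opp] at this
  simpa only [boundary_opp] using this

theorem IsLabeling.ncard_used_inside (hl : IsLabeling M c n l) {i : ℕ} (hi : i < n) :
    {v | v ∈ c.supp ∧ UsesAt T (l i) v}.ncard = sumBelow n (usedAt T n l i) := by
  rw [← hl.ncard_image]
  congr 1
  ext v
  constructor
  · rintro ⟨hv, h⟩
    obtain ⟨j, hj, rfl⟩ := (hl.mem v).1 hv
    exact ⟨j, hj, rfl, decide_eq_true ⟨hi, hj, h⟩⟩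
  · rintro ⟨j, hj, rfl, h⟩
    exact ⟨hl.mem_supp hj, (of_decide_eq_true h).2.2⟩

/-- Each of the two edges or half-edges of the cover at a vertex stays inside the kite, or belongs
to a boundary edge, which is whole and thus directed. -/
theorem IsLabeling.degree [Finite V] (hl : IsLabeling M c n l) (hT : IsRelaxedCycleCover C M T)
    (hD : IsBalancedOrientation C M T D) {i : ℕ} (hi : i < n) :
    sumBelow n (usedAt T n l i) + ((innAt C M D n l i).toNat + (outAt C M D n l i).toNat) = 2 := by
  have hli := hl.mem_supp hi
  rw [← hl.ncard_used_inside hi, ← ncard_boundary_in hD hi, ← ncard_boundary_out hD hi,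
    ← hT.ncard_usesAt (l i), ← Set.ncard_union_eq, ← Set.ncard_union_eq]
  · congr 1
    ext v
    constructor
    · rintro (⟨-, h⟩ | h | h)
      · exact h
      · exact (mem_wholeEdges.1 ((hD.edge v (l i)).2 (Or.inl h.1))).2
      · exact (mem_wholeEdges.1 ((hD.edge (l i) v).2 (Or.inl h.1))).1
    · intro h
      by_cases hv : v ∈ c.supp
      · exact Or.inl ⟨hv, h⟩
      · right
        have hs : ¬ ∃ d : C.ConnectedComponent, IsKite M d ∧ l i ∈ d.supp ∧ v ∈ d.supp := by
          rintro ⟨d, -, h1, h2⟩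
          rw [← component_eq hli h1] at h2
          exact hv h2
        have hs' : ¬ ∃ d : C.ConnectedComponent, IsKite M d ∧ v ∈ d.supp ∧ l i ∈ d.supp :=
          fun ⟨d, h1, h2, h3⟩ => hs ⟨d, h1, h3, h2⟩
        have h' : UsesAt T v (l i) := hT.usesAt_symm h fun hp =>
          hs ((problematic_iff (hT.ne h)).1 hp)
        rcases (hD.edge (l i) v).1 (mem_wholeEdges.2 ⟨h, h'⟩) with hd | hd
        · exact Or.inr ⟨hd, hs⟩
        · exact Or.inl ⟨hd, hs'⟩
  · rw [Set.disjoint_left]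
    rintro v ⟨hv, -⟩ (h | h)
    · exact h.2 ⟨c, hl.isKite, hv, hli⟩
    · exact h.2 ⟨c, hl.isKite, hli, hv⟩
  · rw [Set.disjoint_left]
    exact fun v h1 h2 => hD.asymm _ _ h1.1 h2.1

theorem IsLabeling.ncard_outgoing (hl : IsLabeling M c n l) (hD : IsBalancedOrientation C M T D) :
    {p : V × V | p.1 ∈ c.supp ∧ p.2 ∉ c.supp ∧ D p.1 p.2}.ncard = sumBelow n (outAt C M D n l) := by
  rw [← hl.ncard_image]
  refine Set.ncard_congr (fun p _ => p.1) ?_ ?_ ?_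
  · rintro ⟨u, v⟩ ⟨hu, hv, h⟩
    obtain ⟨i, hi, rfl⟩ := (hl.mem u).1 hu
    refine ⟨i, hi, rfl, decide_eq_true ⟨hi, v, h, ?_⟩⟩
    rintro ⟨d, -, h1, h2⟩
    rw [← component_eq hu h1] at h2
    exact hv h2
  · rintro ⟨u, v⟩ ⟨u', v'⟩ h h' heq
    obtain rfl : u = u' := heq
    exact Prod.ext rfl (hD.out_unique u v v' h.2.2 h'.2.2)
  · rintro _ ⟨i, hi, rfl, h⟩
    obtain ⟨-, u, hu⟩ := of_decide_eq_true h
    exact ⟨(l i, u), ⟨hl.mem_supp hi, not_mem_of_boundary hl.isKite hu (hl.mem_supp hi), hu.1⟩, rfl⟩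

theorem IsLabeling.ncard_incoming (hl : IsLabeling M c n l) (hD : IsBalancedOrientation C M T D) :
    {p : V × V | p.1 ∉ c.supp ∧ p.2 ∈ c.supp ∧ D p.1 p.2}.ncard = sumBelow n (innAt C M D n l) := by
  rw [← outAt_opp, ← hl.ncard_outgoing hD.opp]
  refine Set.ncard_congr (fun p _ => p.swap) ?_ ?_ ?_
  · rintro ⟨u, v⟩ ⟨hu, hv, h⟩
    exact ⟨hv, hu, h⟩
  · intro p q _ _ h
    exact Prod.swap_injective h
  · rintro ⟨u, v⟩ ⟨hu, hv, h⟩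
    exact ⟨(v, u), ⟨hv, hu, h⟩, rfl⟩

theorem IsLabeling.isConfig [Finite V] (hl : IsLabeling M c n l) (hT : IsRelaxedCycleCover C M T)
    (hD : IsBalancedOrientation C M T D)
    (hfirst : n = 4 → ∀ i < n, (innAt C M D n l 0).toNat + (outAt C M D n l 0).toNat ≤
      (innAt C M D n l i).toNat + (outAt C M D n l i).toNat) :
    IsConfig n (usedAt T n l) (innAt C M D n l) (outAt C M D n l) where
  size := hl.size'
  used_lt i j h := ⟨(of_decide_eq_true h).1, (of_decide_eq_true h).2.1⟩
  inn_lt i h := (of_decide_eq_true h).1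
  out_lt i h := (of_decide_eq_true h).1
  irrefl i := decide_eq_false fun h => hT.ne h.2.2 rfl
  degree i hi := by
    rw [← sumBelow_eq hl.size']
    exact hl.degree hT hD hi
  balanced := by
    rw [← sumBelow_eq hl.size', ← sumBelow_eq hl.size', ← hl.ncard_incoming hD,
      ← hl.ncard_outgoing hD, hD.balanced c hl.isKite]
  nonempty := by
    -- Without outgoing edges there are no incoming ones, so 2n half-edges would lie inside the
    -- kite, but at most 2n - 2 are permitted.
    by_contra hno
    push Not at hno
    have h0 : sumBelow n (outAt C M D n l) = 0 := by
      rw [sumBelow_eq hl.size']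
      exact Finset.sum_eq_zero fun i _ => by
        rw [Bool.eq_false_iff.2 (hno i)]
        rfl
    have h1 : sumBelow n (innAt C M D n l) = 0 := by
      rw [← hl.ncard_incoming hD, ← hD.balanced c hl.isKite, hl.ncard_outgoing hD, h0]
    have h2 : ∀ i < n, sumBelow n (usedAt T n l i) = 2 := by
      intro i hi
      have h3 := hl.degree hT hD hi
      rw [sumBelow_eq hl.size', Finset.sum_eq_zero_iff] at h0 h1
      rw [h0 i (Finset.mem_range.2 hi), h1 i (Finset.mem_range.2 hi)] at h3
      exact h3
    have h3 := (hT.even_card hl.isKite).2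
    have h4 : {p : V × V | p.1 ∈ c.supp ∧ p.2 ∈ c.supp ∧ UsesAt T p.1 p.2} =
        ((((Finset.range n ×ˢ Finset.range n).filter fun p => usedAt T n l p.1 p.2 = true).image
          fun p => (l p.1, l p.2) : Finset (V × V)) : Set (V × V)) := by
      ext ⟨u, v⟩
      simp only [Finset.coe_image, Set.mem_image, Finset.mem_coe, Finset.mem_filter,
        Finset.mem_product, Finset.mem_range, Prod.exists, Prod.mk.injEq]
      constructor
      · rintro ⟨hu, hv, h⟩
        obtain ⟨i, hi, rfl⟩ := (hl.mem u).1 hu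
        obtain ⟨j, hj, rfl⟩ := (hl.mem v).1 hv
        exact ⟨i, j, ⟨⟨hi, hj⟩, decide_eq_true ⟨hi, hj, h⟩⟩, rfl, rfl⟩
      · rintro ⟨i, j, ⟨⟨hi, hj⟩, h⟩, rfl, rfl⟩
        exact ⟨hl.mem_supp hi, hl.mem_supp hj, (of_decide_eq_true h).2.2⟩
    have h5 : c.supp.ncard = n := by
      rcases hl.size with ⟨rfl, h⟩ | ⟨rfl, h⟩ <;> exact h.1
    rw [h4, Set.ncard_coe_finset, Finset.card_image_of_injOn, Finset.card_filter,
      Finset.sum_product, h5] at h3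
    · have h6 : ∀ i ∈ Finset.range n, (∑ j ∈ Finset.range n,
          if usedAt T n l i j = true then 1 else 0) = 2 := by
        intro i hi
        rw [← h2 i (Finset.mem_range.1 hi), sumBelow_eq hl.size']
        refine Finset.sum_congr rfl fun j _ => ?_
        cases usedAt T n l i j <;> rfl
      rw [Finset.sum_congr rfl h6, Finset.sum_const, Finset.card_range] at h3
      simp only [smul_eq_mul] at h3
      omega
    · rintro ⟨i, j⟩ hij ⟨i', j'⟩ hij' h
      simp only [Finset.mem_coe, Finset.mem_filter, Finset.mem_product, Finset.mem_range] at hij hij'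
      rw [hl.inj _ hij.1.1 _ hij'.1.1 (Prod.mk.inj h).1, hl.inj _ hij.1.2 _ hij'.1.2 (Prod.mk.inj h).2]
  alternate i j hij hji hi hj heq := by
    obtain ⟨hin, hjn, h1⟩ := of_decide_eq_true hij
    obtain ⟨-, -, h2⟩ := of_decide_eq_true hji
    -- An arc inside the kite is the only one leaving its tail and the only one entering its head.
    -- Hence a boundary edge at the tail comes in, and one at the head goes out.
    have key : ∀ i j, i < n → j < n → D (l i) (l j) →
        outAt C M D n l i = false ∧ innAt C M D n l j = false := by
      intro i j hin hjn hd
      constructor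
      · refine decide_eq_false ?_
        rintro ⟨-, u, hu⟩
        have := hD.out_unique _ _ _ hd hu.1
        exact not_mem_of_boundary hl.isKite hu (hl.mem_supp hin) (this ▸ hl.mem_supp hjn)
      · refine decide_eq_false ?_
        rintro ⟨-, u, hu⟩
        have := hD.in_unique _ _ _ hd hu.1
        exact hu.2 ⟨c, hl.isKite, this ▸ hl.mem_supp hin, hl.mem_supp hjn⟩
    revert hi hj heq
    rcases (hD.edge (l i) (l j)).1 (mem_wholeEdges.2 ⟨h1, h2⟩) with hd | hd
    · obtain ⟨e₁, e₂⟩ := key i j hin hjn hd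
      rw [e₁, e₂]
      cases innAt C M D n l i <;> simp
    · obtain ⟨e₁, e₂⟩ := key j i hjn hin hd
      rw [e₁, e₂]
      cases innAt C M D n l j <;> simp
  first := hfirst

/-- The numbering can be chosen to begin with a vertex with the fewest boundary edges. -/
theorem exists_isConfig [Finite V] (hC : IsCycleCover C) (hM : IsPerfectMatching M)
    (hT : IsRelaxedCycleCover C M T) (hD : IsBalancedOrientation C M T D) (hc : IsKite M c)
    (hdiag : IsFourKite M c → M.edgeSet ∩ inside c ⊆ C.edgeSet) :
    ∃ n l, IsLabeling M c n l ∧ IsConfig n (usedAt T n l) (innAt C M D n l) (outAt C M D n l) := by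
  rcases hc with hc | hc
  · obtain ⟨l, hl⟩ := exists_labeling_three hC hM hc
    exact ⟨3, l, hl, hl.isConfig hT hD (by norm_num)⟩
  · let deg : V → ℕ := fun v => (if ∃ u, boundary C M D u v then 1 else 0) +
      if ∃ u, boundary C M D v u then 1 else 0
    obtain ⟨a, ha, hmin⟩ := exists_minimalFor_of_wellFoundedLT (· ∈ c.supp) deg c.nonempty_supp
    obtain ⟨l, hl, rfl⟩ := exists_labeling_four hC hM hc (hdiag hc) ha
    refine ⟨4, l, hl, hl.isConfig hT hD fun _ i hi => ?_⟩
    have hdeg : ∀ i < 4, deg (l i) = (innAt C M D 4 l i).toNat + (outAt C M D 4 l i).toNat := by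
      intro i hi
      have h1 : innAt C M D 4 l i = decide (∃ u, boundary C M D u (l i)) := by
        simp only [innAt, hi, true_and]
      have h2 : outAt C M D 4 l i = decide (∃ u, boundary C M D (l i) u) := by
        simp only [outAt, hi, true_and]
      have h3 (p : Prop) : (decide p).toNat = if p then 1 else 0 := by by_cases h : p <;> simp [h]
      rw [h1, h2, h3, h3]
    rw [← hdeg 0 (by norm_num), ← hdeg i hi]
    rcases le_total (deg (l 0)) (deg (l i)) with h | h
    · exact h
    · exact hmin (hl.mem_supp hi) h

theorem IsLabeling.isGoodKite (hl : IsLabeling M c n l) {rest : ℕ → ℕ → Bool} {B : Set (Sym2 V)}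
    (hrest : ∀ i < n, ∀ j < n, i ≠ j → (rest i j = true ↔ s(l i, l j) ∈ B))
    (h : Good n (usedAt T n l) rest (innAt C M D n l) (outAt C M D n l)) :
    IsGoodKite M T D B c := by
  obtain ⟨p, x, h⟩ := h
  refine ⟨fun b => l (p b), fun b => l (x b), fun b => ?_⟩
  obtain ⟨hp, hx, hox, hsol⟩ := h b
  refine ⟨hl.mem_supp hp, hl.mem_supp hx, (of_decide_eq_true hox).2, fun gone hgone hcond => ?_⟩
  have hinn : ∀ i < n, (innAt C M D n l i = true ↔ ∃ u, boundary C M D u (l i)) := fun i hi =>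
    ⟨fun h => (of_decide_eq_true h).2, fun h => decide_eq_true ⟨hi, h⟩⟩
  have hout : ∀ i < n, (outAt C M D n l i = true ↔ ∃ u, boundary C M D (l i) u) := fun i hi =>
    ⟨fun h => (of_decide_eq_true h).2, fun h => decide_eq_true ⟨hi, h⟩⟩
  obtain ⟨k, s, rfl, hkx, hki, hko, hkg, hka, hku, hkr, hsym, h₁, h₂⟩ :=
    hsol (fun i => decide (i < n ∧ l i ∈ gone))
      (fun i hi => by
        obtain ⟨hi, hg⟩ := of_decide_eq_true hi
        exact (hinn i hi).2 (hgone _ hg).2)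
      (fun hb hxp => decide_eq_false fun hg => hcond hb (congrArg l hxp) hg.2)
  have hspec := Solution.spec hl.size' h₁ h₂
  have hgone' : ∀ i < k.n, (k.gone i = true ↔ l i ∈ gone) := fun i hi => by
    rw [hkg i hi, decide_eq_true_iff, and_iff_right hi]
  refine ⟨_, _, _, _, hkx ▸ hspec.isKiteSolution hsym hl (hkx ▸ hx) ?_ ?_ ?_ ?_ hgone' ?_⟩
  · intro i hi j hj hij
    rw [hkr i hi j hj, hrest i hi j hj hij]
  · intro i hi j hj
    rw [hku i hi j hj, usedAt, decide_eq_true_iff, and_iff_right hi, and_iff_right hj]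
  · intro i hi
    rw [hki i hi, Bool.and_eq_true, hinn i hi, ← hkg i hi, Bool.not_eq_true', ← Bool.not_eq_true,
      hgone' i hi]
    rfl
  · intro i hi
    rw [hko i hi, Bool.and_eq_true, hout i hi, Bool.not_eq_true', natBeq_eq_false, ← hkx]
    refine and_congr_right fun _ => not_congr ⟨fun h => h ▸ rfl, fun h => ?_⟩
    exact hl.inj _ hi _ (hkx ▸ hx) h
  · intro i hi hai
    obtain ⟨rfl, hne⟩ := hka i hi hai
    exact ⟨rfl, fun h => hne (hl.inj _ hi _ hp h)⟩

/-- The halved edges inside a kite can be divided into two equal parts, the first of which is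
suitable for the orientation and the second one for its opposite. -/
theorem exists_kite_split [Finite V] (hC : IsCycleCover C) (hM : IsPerfectMatching M)
    (hT : IsRelaxedCycleCover C M T) (hD : IsBalancedOrientation C M T D) (hc : IsKite M c)
    (hdiag : IsFourKite M c → M.edgeSet ∩ inside c ⊆ C.edgeSet) :
    ∃ Z : Set (Sym2 V), Z ⊆ halfUsedEdges T ∩ inside c ∧
      2 * Z.ncard = (halfUsedEdges T ∩ inside c).ncard ∧
      (∀ Z' : Set (Sym2 V), Z' ∩ inside c = Z → IsGoodKite M T D (wholeEdges T ∪ Z') c) ∧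
      ∀ Z' : Set (Sym2 V), Z' ∩ inside c = (halfUsedEdges T ∩ inside c) \ Z →
        IsGoodKite M T (fun u v => D v u) (wholeEdges T ∪ Z') c := by
  obtain ⟨n, l, hl, hconf⟩ := exists_isConfig hC hM hT hD hc hdiag
  obtain ⟨z, hz, hsub, hcount, hg₁, hg₂⟩ := hconf.exists_split
  have hu : ∀ i < n, ∀ j < n, (usedAt T n l i j = true ↔ UsesAt T (l i) (l j)) := by
    intro i hi j hj
    rw [usedAt, decide_eq_true_iff, and_iff_right hi, and_iff_right hj]
  have hin : ∀ i < n, ∀ j < n, i ≠ j → s(l i, l j) ∈ inside c := fun i hi j hj hij =>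
    mem_inside.2 ⟨fun h => hij (hl.inj _ hi _ hj h), hl.mem_supp hi, hl.mem_supp hj⟩
  have hhalf : ∀ i < n, ∀ j < n, (xor (usedAt T n l i j) (usedAt T n l j i) = true ↔
      s(l i, l j) ∈ halfUsedEdges T) := by
    intro i hi j hj
    rw [mem_halfUsedEdges, ← hu i hi j hj, ← hu j hj i hi]
    cases usedAt T n l i j <;> cases usedAt T n l j i <;> simp
  have hwhole : ∀ i < n, ∀ j < n, ((usedAt T n l i j && usedAt T n l j i) = true ↔
      s(l i, l j) ∈ wholeEdges T) := by
    intro i hi j hj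
    rw [mem_wholeEdges, ← hu i hi j hj, ← hu j hj i hi, Bool.and_eq_true]
  have hhalfset : halfUsedEdges T ∩ inside c =
      edgesOf n l fun i j => xor (usedAt T n l i j) (usedAt T n l j i) := by
    ext e
    constructor
    · rintro ⟨he, hec⟩
      induction e using Sym2.ind with
      | _ u v =>
        obtain ⟨huv, hu', hv'⟩ := mem_inside.1 hec
        obtain ⟨i, hi, rfl⟩ := (hl.mem u).1 hu'
        obtain ⟨j, hj, rfl⟩ := (hl.mem v).1 hv'
        exact ⟨i, hi, j, hj, fun h => huv (h ▸ rfl), (hhalf i hi j hj).2 he, rfl⟩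
    · intro he
      refine ⟨?_, hl.edgesOf_inside he⟩
      obtain ⟨i, hi, j, hj, -, h, rfl⟩ := he
      exact (hhalf i hi j hj).1 h
  have hzmem : ∀ i < n, ∀ j < n, i ≠ j → (s(l i, l j) ∈ edgesOf n l z ↔ z i j = true) :=
    fun i hi j hj hij => by rw [hl.mem_edgesOf hz hi hj, and_iff_right hij]
  refine ⟨edgesOf n l z, ?_, ?_, ?_, ?_⟩
  · rintro _ ⟨i, hi, j, hj, hij, h, rfl⟩
    refine ⟨(hhalf i hi j hj).1 ?_, hin i hi j hj hij⟩
    have := hsub i hi j hj h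
    revert this
    cases usedAt T n l i j <;> cases usedAt T n l j i <;> simp
  · rw [hl.ncard_edgesOf hz, hcount, hhalfset, hl.ncard_edgesOf]
    exact fun i j => Bool.xor_comm _ _
  · intro Z' hZ'
    refine hl.isGoodKite (fun i hi j hj hij => ?_) hg₁
    have h1 : s(l i, l j) ∈ Z' ↔ s(l i, l j) ∈ edgesOf n l z := by
      rw [← hZ', Set.mem_inter_iff, and_iff_left (hin i hi j hj hij)]
    rw [Set.mem_union, h1, hzmem i hi j hj hij, ← hwhole i hi j hj, Bool.or_eq_true]
  · intro Z' hZ'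
    -- Under the opposite orientation incoming and outgoing boundary edges exchange their roles.
    rw [← outAt_opp, ← innAt_opp] at hg₂
    refine hl.isGoodKite (fun i hi j hj hij => ?_) hg₂
    have h1 : s(l i, l j) ∈ Z' ↔ s(l i, l j) ∈ (halfUsedEdges T ∩ inside c) \ edgesOf n l z := by
      rw [← hZ', Set.mem_inter_iff, and_iff_left (hin i hi j hj hij)]
    rw [Set.mem_union, h1, Set.mem_sdiff, Set.mem_inter_iff, and_iff_left (hin i hi j hj hij),
      hzmem i hi j hj hij, ← hwhole i hi j hj, ← hhalf i hi j hj, Bool.or_eq_true]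
    have := hsub i hi j hj
    revert this
    cases usedAt T n l i j <;> cases usedAt T n l j i <;> cases z i j <;> simp

end KiteConfig

end MaxTSP

/-! ### The lemma -/

theorem lemmaF12 {V : Type*} [Fintype V] (C M : SimpleGraph V) (T : SimpleGraph (V ⊕ Sym2 V))
    (hC : MaxTSP.IsCycleCover C) (hM : MaxTSP.IsPerfectMatching M)
    (hdiag : ∀ c : C.ConnectedComponent, MaxTSP.IsFourKite M c →
      M.edgeSet ∩ MaxTSP.inside c ⊆ C.edgeSet)
    (hT : MaxTSP.IsRelaxedCycleCover C M T) :
    ∃ (D : V → V → Prop) (Z₁ Z₂ : Set (Sym2 V)),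
      MaxTSP.IsBalancedOrientation C M T D ∧ MaxTSP.IsBalancedSplit C M T Z₁ Z₂ ∧
      (∃ F₁ F₂ : Set (Sym2 V), MaxTSP.IsExchangePair C M T D Z₁ F₁ F₂) ∧
      (∃ F₁ F₂ : Set (Sym2 V),
        MaxTSP.IsExchangePair C M T (fun u v => D v u) Z₂ F₁ F₂) := by
  obtain ⟨D, hD⟩ := hT.exists_orientation
  have hsplit := fun (c : C.ConnectedComponent) (hc : MaxTSP.IsKite M c) =>
    MaxTSP.exists_kite_split hC hM hT hD hc (hdiag c)
  choose Z hZ using hsplit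
  -- An edge lies inside at most one kite, so the union of the chosen sets restricts to the chosen
  -- set in each kite, and its complement to the other half.
  let Z₁ : Set (Sym2 V) := {e | ∃ c hc, e ∈ Z c hc}
  have hZ₁ : ∀ c hc, Z₁ ∩ MaxTSP.inside c = Z c hc := by
    intro c hc
    ext e
    constructor
    · rintro ⟨⟨d, hd, he⟩, hec⟩
      obtain rfl := MaxTSP.component_eq_of_edge ((hZ d hd).1 he).2 hec
      exact he
    · exact fun he => ⟨⟨c, hc, he⟩, ((hZ c hc).1 he).2⟩
  have hsub : Z₁ ⊆ MaxTSP.halfUsedEdges T := by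
    rintro e ⟨c, hc, he⟩
    exact ((hZ c hc).1 he).1
  have hZ₂ : ∀ c hc, (MaxTSP.halfUsedEdges T \ Z₁) ∩ MaxTSP.inside c =
      (MaxTSP.halfUsedEdges T ∩ MaxTSP.inside c) \ Z c hc := by
    intro c hc
    rw [← hZ₁ c hc]
    ext e
    constructor
    · rintro ⟨⟨h1, h2⟩, h3⟩
      exact ⟨⟨h1, h3⟩, fun h4 => h2 h4.1⟩
    · rintro ⟨⟨h1, h3⟩, h2⟩
      exact ⟨⟨h1, fun h4 => h2 ⟨h4, h3⟩⟩, h3⟩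
  refine ⟨D, Z₁, MaxTSP.halfUsedEdges T \ Z₁, hD, ⟨Set.union_sdiff_cancel hsub,
    Set.disjoint_sdiff_right, fun c hc => ?_⟩,
    MaxTSP.exists_exchangePair hM hT hD hsub fun c hc => (hZ c hc).2.2.1 _ (hZ₁ c hc),
    MaxTSP.exists_exchangePair hM hT hD.opp Set.sdiff_subset fun c hc =>
      (hZ c hc).2.2.2 _ (hZ₂ c hc)⟩
  rw [hZ₁ c hc, hZ₂ c hc, Set.ncard_sdiff (hZ c hc).1, ← (hZ c hc).2.1]
  omega
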